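/- **Model.** Let $s\ge 1$ be an integer and $v=1/s$ (the velocity). $n$ users are placed independently and uniformly in the unit square at time $0$; the square is divided into an $s\times s$ grid of $m=1/v^2$ subsquares of side $v$. *Mobile network:* at the beginning of each slot, every user independently picks one of nine moves (stay, or go to one of the eight neighbouring subsquares), each with probability $1/9$; if the move would leave the unit square the user stays in its subsquare; its position is then redrawn uniformly inside its current subsquare. *Static network:* the users keep their initial positions. *Unicast transmission:* in each slot every user is independently designated a sender with probability $\theta\in(0,1/2)$ and is a potential receiver otherwise; each sender $i$ transmits to its nearest potential receiver $j$, and the packet is received iff $$\mathrm{SINR}_{ij}=\frac{P r_{ij}^{-\alpha}}{\eta+\sum_{l\ne i,\ l\text{ a sender}}P r_{lj}^{-\alpha}}\ \ge\ \beta ,$$ where $r_{ij}$ is the current Euclidean distance and $P,\eta,\beta>0$, $\alpha>2$ are constants. *RANDOM PUSH:* each sender transmits a message chosen uniformly among those it possesses at the beginning of the slot. There are $k$ messages; message $i$ is injected at a single user at an arbitrary fixed time, and the spreading time $T(i)$ is the number of slots from its injection until all $n$ users possess it (in the mobile network), and $T^{\mathrm{st}}(i)$ is the same quantity in the static network. **Theorem.**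 For all constants $P,\eta,\alpha,\beta,\theta$ as above and every $K$ there are constants $a,b,g,h>0$ such that, for all $n$, all $1\le k\le K$ and all $v=1/s$ with $v>\sqrt{32\log n/n}$, all sources and all injection times: 1. with probability at least $1-n^{-2}$, for all messages $i$, $$\frac{a}{v}\ \le\ T(i)\ \le\ b\,\frac{\log n}{v};$$ 2. with probability at least $1-n^{-2}$, for all messages $i$, $T^{\mathrm{st}}(i)\ge h\,\sqrt n/\log n$; 3. when a mobile and a static network are run independently with the same sources and injection times, with probability at least $1-n^{-2}$, for all messages $i$, $$T^{\mathrm{st}}(i)\ \ge\ g\,\frac{v\sqrt n}{\log^2 n}\;T(i).$$ -/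

import Mathlib

open MeasureTheory unitInterval
open scoped ENNReal

noncomputable section

namespace Gossip

/-! ### Parameters and randomness -/

/-- Physical-layer parameters: transmit power `P`, noise `η`, path-loss exponent `α`, SINR threshold
`β`, and the probability `θ` of being designated as a sender. -/
structure Phy where
  P : ℝ
  η : ℝ
  α : ℝ
  β : ℝ
  θ : ℝ
  P_pos : 0 < P
  η_pos : 0 < η
  two_lt_α : 2 < α
  β_pos : 0 < β
  θ_pos : 0 < θ
  θ_lt_half : θ < 1 / 2

/-- The primitive randomness that one user draws in one time slot: a direction, an offset inside
the subsquare, a seed for the sender designation, and a seed for the message selection. -/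
abbrev SlotSeed : Type := (Fin 3 × Fin 3) × (I × I) × I × I

/-- In one slot, the direction is uniform over the nine possibilities, the offset is uniform on the
unit square and the two other seeds are uniform on the unit interval, all independently. -/
def slotLaw : Measure SlotSeed :=
  (PMF.uniformOfFintype (Fin 3 × Fin 3)).toMeasure.prod volume

instance : IsProbabilityMeasure slotLaw := by
  unfold slotLaw; infer_instance

/-- Sample space of a network of `n` users: the initial positions in the unit square, and the seeds
of every user in every time slot. -/
abbrev Run (n : ℕ) : Type := (Fin n → I × I) × (ℕ → Fin n → SlotSeed)

/-- All primitive random variables are independent; initial positions are uniform on the square. -/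
def runLaw (n : ℕ) : Measure (Run n) :=
  (Measure.pi fun _ : Fin n => (volume : Measure (I × I))).prod
    (Measure.infinitePi fun _ : ℕ => Measure.pi fun _ : Fin n => slotLaw)

instance (n : ℕ) : IsProbabilityMeasure (runLaw n) := by
  unfold runLaw; infer_instance

variable {n k : ℕ}

/-- Initial position of user `i`. -/
def Run.init (ω : Run n) (i : Fin n) : I × I := ω.1 i
/-- Direction drawn by user `i` in slot `t` (the slot that leads from time `t` to `t + 1`). -/
def Run.dir (ω : Run n) (t : ℕ) (i : Fin n) : Fin 3 × Fin 3 := (ω.2 t i).1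
/-- Offset of user `i` inside its new subsquare in slot `t`, as a fraction of the side length. -/
def Run.offset (ω : Run n) (t : ℕ) (i : Fin n) : I × I := (ω.2 t i).2.1
/-- Seed of user `i` in slot `t` for the sender designation. -/
def Run.coin (ω : Run n) (t : ℕ) (i : Fin n) : I := (ω.2 t i).2.2.1
/-- Seed of user `i` in slot `t` for the message selection. -/
def Run.pick (ω : Run n) (t : ℕ) (i : Fin n) : I := (ω.2 t i).2.2.2

/-! ### Node positions -/

/-- The plane with the Euclidean distance. -/
abbrev Plane : Type := EuclideanSpace ℝ (Fin 2)

/-- One step of the walk on the `s × s` grid of subsquares `(x, y)` with `0 ≤ x, y < s`: move by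
`(d.1 - 1, d.2 - 1)`, or stay if that would lead out of the square. -/
def move (s : ℕ) (c : ℤ × ℤ) (d : Fin 3 × Fin 3) : ℤ × ℤ :=
  let c' : ℤ × ℤ := (c.1 + (d.1.val : ℤ) - 1, c.2 + (d.2.val : ℤ) - 1)
  if 0 ≤ c'.1 ∧ c'.1 < s ∧ 0 ≤ c'.2 ∧ c'.2 < s then c' else c

/-- The subsquare (of side `1 / s`) that contains a point of the unit square; points on the upper
and right sides of the unit square belong to the last subsquares. -/
def cellOf (s : ℕ) (p : I × I) : ℤ × ℤ :=
  (min ⌊(s : ℝ) * p.1⌋ (s - 1), min ⌊(s : ℝ) * p.2⌋ (s - 1))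

/-- The subsquare of user `i` at time `t`. -/
def cell (s : ℕ) (ω : Run n) (i : Fin n) : ℕ → ℤ × ℤ
  | 0 => cellOf s (ω.init i)
  | t + 1 => move s (cell s ω i t) (ω.dir t i)

/-- The initial position of user `i`, as a point of the plane. -/
def initPos (ω : Run n) (i : Fin n) : Plane :=
  !₂[((ω.init i).1 : ℝ), ((ω.init i).2 : ℝ)]

/-- Position of user `i` at time `t` in the mobile network with velocity `1 / s`: after each move,
it is redrawn uniformly inside the current subsquare. -/
def mobilePos (s : ℕ) (ω : Run n) : ℕ → Fin n → Plane
  | 0, i => initPos ω i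
  | t + 1, i =>
    !₂[(((cell s ω i (t + 1)).1 : ℝ) + ((ω.offset t i).1 : ℝ)) / s,
       (((cell s ω i (t + 1)).2 : ℝ) + ((ω.offset t i).2 : ℝ)) / s]

/-- Positions in the static network: nobody ever moves. -/
def staticPos (ω : Run n) (_t : ℕ) (i : Fin n) : Plane := initPos ω i

/-! ### Unicast physical layer -/

/-- The users designated as senders in slot `t`: each independently with probability `θ`. -/
def senders (φ : Phy) (ω : Run n) (t : ℕ) : Finset (Fin n) :=
  {i | (ω.coin t i : ℝ) < φ.θ}

/-- Signal-to-interference-plus-noise ratio at `j` of the signal of `i`, with set of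
transmitters `S` and node positions `x`. -/
def sinr (φ : Phy) (x : Fin n → Plane) (S : Finset (Fin n)) (i j : Fin n) : ℝ :=
  φ.P * dist (x i) (x j) ^ (-φ.α) /
    (φ.η + ∑ l ∈ S.erase i, φ.P * dist (x l) (x j) ^ (-φ.α))

/-- `i` is a sender, `j` is a potential receiver (a non-sender) nearest to `i`, and the packet from
`i` is successfully received by `j`. -/
def Delivers (φ : Phy) (x : Fin n → Plane) (S : Finset (Fin n)) (i j : Fin n) : Prop :=
  i ∈ S ∧ j ∉ S ∧ (∀ j' ∉ S, dist (x i) (x j) ≤ dist (x i) (x j')) ∧ φ.β ≤ sinr φ x S i j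

/-! ### RANDOM PUSH -/

/-- From the set `A` of messages it possesses, a user with uniform seed `u` selects message `m`:
each of the `#A` messages is selected on an interval of seeds of length `1 / #A`. -/
def Selects (u : I) (A : Finset (Fin k)) (m : Fin k) : Prop :=
  m ∈ A ∧ ⌊(u : ℝ) * (A.card : ℝ)⌋₊ = (A.filter (· < m)).card

open Classical in
/-- The set of messages possessed by user `j` at time `t`, when message `m` is injected at time
`τ m` at the user `src m`. In slot `t` every user first moves (so positions are those of time
`t + 1`), then senders are designated, and each sender pushes one of the messages
that it possesses at the beginning of the slot. -/
def holds (φ : Phy) (pos : ℕ → Fin n → Plane) (src : Fin k → Fin n) (τ : Fin k → ℕ)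
    (ω : Run n) : ℕ → Fin n → Finset (Fin k)
  | 0, j => {m | τ m = 0 ∧ src m = j}
  | t + 1, j => {m | m ∈ holds φ pos src τ ω t j ∨ (τ m = t + 1 ∧ src m = j) ∨
      ∃ i, Delivers φ (pos (t + 1)) (senders φ ω t) i j ∧
        Selects (ω.pick t i) (holds φ pos src τ ω t i) m}

/-- Time needed, counted from the injection of message `m`, until all users possess it
(`⊤` if this never happens). -/
def spreadingTime (φ : Phy) (pos : ℕ → Fin n → Plane) (src : Fin k → Fin n) (τ : Fin k → ℕ)
    (ω : Run n) (m : Fin k) : ℕ∞ :=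
  ⨅ (d : ℕ) (_ : ∀ j, m ∈ holds φ pos src τ ω (τ m + d) j), (d : ℕ∞)

/-- Spreading time of message `m` in the mobile network with velocity `1 / s`. -/
def mobileTime (φ : Phy) (s : ℕ) (src : Fin k → Fin n) (τ : Fin k → ℕ) (ω : Run n)
    (m : Fin k) : ℝ≥0∞ :=
  (spreadingTime φ (mobilePos s ω) src τ ω m : ℕ∞)

/-- Spreading time of message `m` in the static network. -/
def staticTime (φ : Phy) (src : Fin k → Fin n) (τ : Fin k → ℕ) (ω : Run n) (m : Fin k) : ℝ≥0∞ :=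
  (spreadingTime φ (staticPos ω) src τ ω m : ℕ∞)

end Gossip

end

/-!
The upper bound follows the odds `(n - a) / a` of the `n - a` uninformed to the `a` informed users.
While the users are balanced over the grid, an isoperimetric inequality gives many neighbouring
pairs of an informed and an uninformed user. Since `α > 2`, the expected interference at a receiver
is of the order of the density of the users, so each such pair exchanges the message with
probability of order `s² / n`, and the odds contract in expectation by a factor `1 - κ / s` per
slot. Markov's inequality turns this into a tail bound. For boundedly many users balance may fail,
but the users may with positive probability all gather in one corner of the grid and communicate
there, so that a suitable potential still contracts by some fixed factor per slot.

For the lower bounds, as long as every subsquare contains a potential receiver, nobody transmits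
beyond its neighbouring subsquares, so that a message travels at most three subsquares per slot.
The mobile network is handled with its own grid, the static one with the finest grid that is still
above the connectivity threshold. The comparison of the two networks combines the upper bound for
the mobile network with the lower bound for the static one.
-/

noncomputable section

namespace Gossip

/-! ### Product measures and Chernoff bounds -/

section ProductMeasure

variable {ι : Type*} {X : ι → Type*} [∀ i, MeasurableSpace (X i)] (μ : ∀ i, Measure (X i))
  [∀ i, IsProbabilityMeasure (μ i)]

lemma measurePreserving_update_infinitePi [DecidableEq ι] (i : ι) :
    MeasurePreserving (fun p : (∀ i, X i) × X i => Function.update p.1 i p.2)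
      ((Measure.infinitePi μ).prod (μ i)) (Measure.infinitePi μ) := by
  refine ⟨measurable_update', Measure.eq_infinitePi _ fun s t ht => ?_⟩
  have preimage_update : (fun p : (∀ i, X i) × X i => Function.update p.1 i p.2) ⁻¹'
      (s : Set ι).pi t =
        ((s.erase i : Finset ι) : Set ι).pi t ×ˢ (if i ∈ s then t i else Set.univ) := by
    ext ⟨x, y⟩
    simp only [Set.mem_preimage, Set.mem_pi, Finset.mem_coe, Finset.mem_erase, Set.mem_prod]
    constructor
    · intro h
      refine ⟨fun j hj => by simpa [hj.1] using h j hj.2, ?_⟩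
      split_ifs with hi
      · simpa using h i hi
      · trivial
    · rintro ⟨hx, hy⟩ j hj
      by_cases hji : j = i
      · subst hji
        simpa [hj] using hy
      · simpa [hji] using hx j ⟨hji, hj⟩
  rw [Measure.map_apply measurable_update' (.pi s.countable_toSet fun _ _ => ht _),
    preimage_update, Measure.prod_prod, Measure.infinitePi_pi _ fun i _ => ht i]
  split_ifs with hi
  · rw [mul_comm, Finset.mul_prod_erase s (fun j => μ j (t j)) hi]
  · rw [measure_univ, mul_one, Finset.erase_eq_of_notMem hi]

variable [Fintype ι]

lemma lintegral_pi_update [DecidableEq ι] (i : ι) {f : (∀ i, X i) → ℝ≥0∞} (hf : Measurable f) :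
    ∫⁻ x, f x ∂(Measure.pi μ) =
      ∫⁻ x, ∫⁻ y, f (Function.update x i y) ∂(μ i) ∂(Measure.pi μ) := by
  rw [← Measure.infinitePi_eq_pi, ← (measurePreserving_update_infinitePi μ i).lintegral_comp hf]
  exact lintegral_prod _ (hf.comp measurable_update').aemeasurable

lemma lintegral_pi_prod {f : ∀ i, X i → ℝ≥0∞} (hf : ∀ i, Measurable (f i)) :
    ∫⁻ x, ∏ i, f i (x i) ∂(Measure.pi μ) = ∏ i, ∫⁻ y, f i y ∂(μ i) := by
  rw [ProbabilityTheory.lintegral_prod_eq_prod_lintegral_of_indepFun Finset.univ _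
    (ProbabilityTheory.iIndepFun_pi fun i => (hf i).aemeasurable)
    fun i => (hf i).comp (measurable_pi_apply i)]
  exact Finset.prod_congr rfl fun i _ => (measurePreserving_eval μ i).lintegral_comp (hf i)

lemma map_prodMk_eval_pi {i j : ι} (hij : i ≠ j) :
    (Measure.pi μ).map (fun x => (x i, x j)) = (μ i).prod (μ j) := by
  have indep := (ProbabilityTheory.iIndepFun_pi (μ := μ) (X := fun _ => id)
    fun _ => aemeasurable_id).indepFun hij
  have map_eq := (ProbabilityTheory.indepFun_iff_map_prod_eq_prod_map_map
    (measurable_pi_apply i).aemeasurable (measurable_pi_apply j).aemeasurable).1 indep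
  rwa [(measurePreserving_eval μ i).map_eq, (measurePreserving_eval μ j).map_eq] at map_eq

lemma mul_le_pi_of_forall_le {i j : ι} (hij : i ≠ j) {B : Set (X i)} (hB : MeasurableSet B)
    {F : X i → Set (X j)} (hF : MeasurableSet {p : X i × X j | p.2 ∈ F p.1}) {q : ℝ≥0∞}
    (hq : ∀ x ∈ B, q ≤ μ j (F x)) :
    q * μ i B ≤ Measure.pi μ {x | x i ∈ B ∧ x j ∈ F (x i)} := by
  have hBF : MeasurableSet {p : X i × X j | p.1 ∈ B ∧ p.2 ∈ F p.1} := (measurable_fst hB).inter hF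
  calc q * μ i B = ∫⁻ _ in B, q ∂μ i := (setLIntegral_const B q).symm
    _ ≤ ∫⁻ x in B, μ j {y | x ∈ B ∧ y ∈ F x} ∂μ i :=
        setLIntegral_mono' hB fun x hx => by simpa [hx] using hq x hx
    _ ≤ ∫⁻ x, μ j {y | x ∈ B ∧ y ∈ F x} ∂μ i := setLIntegral_le_lintegral _ _
    _ = Measure.pi μ {x | x i ∈ B ∧ x j ∈ F (x i)} := by
        refine (Measure.prod_apply hBF).symm.trans ?_
        rw [← map_prodMk_eval_pi μ hij, Measure.map_apply (by fun_prop) hBF]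
        rfl

lemma setLIntegral_pi_update [DecidableEq ι] (i : ι) {E : Set (∀ i, X i)} (hE : MeasurableSet E)
    (hEi : ∀ x y, Function.update x i y ∈ E ↔ x ∈ E) {f : (∀ i, X i) → ℝ≥0∞} (hf : Measurable f) :
    ∫⁻ x in E, f x ∂(Measure.pi μ) =
      ∫⁻ x in E, ∫⁻ y, f (Function.update x i y) ∂(μ i) ∂(Measure.pi μ) := by
  rw [← lintegral_indicator hE, ← lintegral_indicator hE, lintegral_pi_update μ i (hf.indicator hE)]
  refine lintegral_congr fun x => ?_
  by_cases hx : x ∈ E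
  · simp only [Set.indicator_of_mem hx, Set.indicator_of_mem ((hEi x _).2 hx)]
  · simp only [Set.indicator_of_notMem hx, Set.indicator_of_notMem (mt (hEi x _).1 hx),
      lintegral_zero]

end ProductMeasure

lemma measure_le_two_mul_inter_lt {Ω : Type*} [MeasurableSpace Ω] {μ : Measure Ω}
    [IsFiniteMeasure μ] {E : Set Ω} {f : Ω → ℝ≥0∞} (hf : Measurable f) {T : ℝ≥0∞} (hT0 : T ≠ 0)
    (hT : T ≠ ⊤) (h : ∫⁻ x in E, f x ∂μ ≤ μ E * (T / 2)) :
    μ E ≤ 2 * μ (E ∩ {x | f x < T}) := by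
  have hlt : MeasurableSet {x | f x < T} := measurableSet_lt hf measurable_const
  have markov : T * μ (E \ {x | f x < T}) ≤ T * (μ E / 2) := by
    have compl_eq : {x | f x < T}ᶜ = {x | T ≤ f x} := by
      ext x
      simp
    calc T * μ (E \ {x | f x < T}) = T * μ.restrict E {x | T ≤ f x} := by
          rw [← compl_eq, Measure.restrict_apply hlt.compl, Set.inter_comm, Set.sdiff_eq]
      _ ≤ μ E * (T / 2) := (mul_meas_ge_le_lintegral hf T).trans h
      _ = T * (μ E / 2) := by
          rw [ENNReal.div_eq_inv_mul, ENNReal.div_eq_inv_mul, mul_left_comm, mul_comm (μ E),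
            mul_left_comm]
  have diff_le := (ENNReal.mul_le_mul_iff_right hT0 hT).1 markov
  have half_le : μ E - μ E / 2 ≤ μ (E ∩ {x | f x < T}) := by
    rw [tsub_le_iff_right]
    nth_rw 1 [← measure_inter_add_sdiff E hlt]
    gcongr
  rw [ENNReal.sub_half (measure_ne_top μ E)] at half_le
  exact mul_comm (2 : ℝ≥0∞) _ ▸ (ENNReal.div_le_iff (by simp) (by simp)).1 half_le

section Chernoff

variable {ι X : Type*} [Fintype ι] [MeasurableSpace X] (ν : Measure X) [IsProbabilityMeasure ν]
  {A : Set X}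

lemma pi_forall_notMem_le (hA : MeasurableSet A) :
    Measure.pi (fun _ : ι => ν) {x | ∀ i, x i ∉ A} ≤
      ENNReal.ofReal (Real.exp (-(Fintype.card ι * ν.real A))) := by
  have compl_le : ν Aᶜ ≤ ENNReal.ofReal (Real.exp (-ν.real A)) := by
    rw [← ofReal_measureReal, measureReal_compl hA, probReal_univ]
    exact ENNReal.ofReal_le_ofReal (Real.one_sub_le_exp_neg _)
  calc Measure.pi (fun _ : ι => ν) {x | ∀ i, x i ∉ A}
      = Measure.pi (fun _ : ι => ν) (Set.univ.pi fun _ => Aᶜ) := by congr 1; ext; simp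
    _ = ν Aᶜ ^ Fintype.card ι := by simp
    _ ≤ ENNReal.ofReal (Real.exp (-ν.real A)) ^ Fintype.card ι := by gcongr
    _ = ENNReal.ofReal (Real.exp (-(Fintype.card ι * ν.real A))) := by
        rw [← ENNReal.ofReal_pow (Real.exp_pos _).le, ← Real.exp_nat_mul, mul_neg]

variable [DecidablePred (· ∈ A)]

lemma lintegral_pow_card_mem_le (hA : MeasurableSet A) {z : ℝ} (hz : 0 ≤ z) :
    ∫⁻ x, ENNReal.ofReal (z ^ ({i | x i ∈ A} : Finset ι).card) ∂(Measure.pi fun _ => ν) ≤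
      ENNReal.ofReal (Real.exp ((z - 1) * (Fintype.card ι * ν.real A))) := by
  let f : X → ℝ≥0∞ := A.piecewise (fun _ => ENNReal.ofReal z) fun _ => 1
  have hf : Measurable f := measurable_const.piecewise hA measurable_const
  have pow_card_eq : ∀ x : ι → X,
      ENNReal.ofReal (z ^ ({i | x i ∈ A} : Finset ι).card) = ∏ i, f (x i) := fun x => by
    simp [f, Set.piecewise, Finset.prod_ite, ENNReal.ofReal_pow hz]
  have lintegral_le : ∫⁻ y, f y ∂ν ≤ ENNReal.ofReal (Real.exp ((z - 1) * ν.real A)) := by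
    have h : ∫⁻ y, f y ∂ν = ENNReal.ofReal ((z - 1) * ν.real A + 1) := by
      rw [lintegral_piecewise hA, setLIntegral_const, setLIntegral_const, one_mul,
        ← ofReal_measureReal, ← ofReal_measureReal, ← ENNReal.ofReal_mul hz,
        ← ENNReal.ofReal_add (by positivity) (by positivity), measureReal_compl hA, probReal_univ]
      ring_nf
    rw [h]
    exact ENNReal.ofReal_le_ofReal (Real.add_one_le_exp _)
  simp_rw [pow_card_eq, lintegral_pi_prod (fun _ => ν) fun _ => hf]
  calc ∏ _ : ι, ∫⁻ y, f y ∂ν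
      = (∫⁻ y, f y ∂ν) ^ Fintype.card ι := by simp
    _ ≤ ENNReal.ofReal (Real.exp ((z - 1) * ν.real A)) ^ Fintype.card ι := by gcongr
    _ = ENNReal.ofReal (Real.exp ((z - 1) * (Fintype.card ι * ν.real A))) := by
        rw [← ENNReal.ofReal_pow (Real.exp_pos _).le, ← Real.exp_nat_mul, mul_left_comm]

lemma pi_rpow_le_pow_card_mem_le (hA : MeasurableSet A) {z : ℝ} (hz : 0 < z) (a : ℝ) :
    Measure.pi (fun _ : ι => ν) {x | z ^ a ≤ z ^ ({i | x i ∈ A} : Finset ι).card} ≤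
      ENNReal.ofReal (Real.exp ((z - 1) * (Fintype.card ι * ν.real A) - a * Real.log z)) := by
  have hza : 0 < z ^ a := Real.rpow_pos_of_pos hz a
  have measurable_card : Measurable fun x : ι → X => ({i | x i ∈ A} : Finset ι).card := by
    simp_rw [Finset.card_filter]
    exact Finset.measurable_sum _ fun i _ =>
      Measurable.ite (measurable_pi_apply i hA) measurable_const measurable_const
  have measurable_pow : Measurable fun x : ι → X =>
      ENNReal.ofReal (z ^ ({i | x i ∈ A} : Finset ι).card) :=
    (measurable_of_countable fun m : ℕ => ENNReal.ofReal (z ^ m)).comp measurable_card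
  have markov := meas_ge_le_lintegral_div (μ := Measure.pi fun _ : ι => ν)
    (ε := ENNReal.ofReal (z ^ a)) measurable_pow.aemeasurable (by simp [hza]) ENNReal.ofReal_ne_top
  calc Measure.pi (fun _ : ι => ν) {x | z ^ a ≤ z ^ ({i | x i ∈ A} : Finset ι).card}
      ≤ Measure.pi (fun _ : ι => ν) {x | ENNReal.ofReal (z ^ a) ≤
          ENNReal.ofReal (z ^ ({i | x i ∈ A} : Finset ι).card)} :=
        measure_mono fun x hx => ENNReal.ofReal_le_ofReal hx
    _ ≤ _ := markov
    _ ≤ ENNReal.ofReal (Real.exp ((z - 1) * (Fintype.card ι * ν.real A))) /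
          ENNReal.ofReal (z ^ a) :=
        ENNReal.div_le_div_right (lintegral_pow_card_mem_le ν hA hz.le) _
    _ = _ := by
        rw [← ENNReal.ofReal_div_of_pos hza, Real.rpow_def_of_pos hz, ← Real.exp_sub, mul_comm a]

lemma pi_not_card_mem_between_le (hA : MeasurableSet A) {N : ℝ}
    (hN : Fintype.card ι * ν.real A = N) :
    Measure.pi (fun _ : ι => ν) {x | ¬ (N / 8 ≤ ({i | x i ∈ A} : Finset ι).card ∧
      (({i | x i ∈ A} : Finset ι).card : ℝ) ≤ 4 * N)} ≤
        ENNReal.ofReal (2 * Real.exp (-(0.4 * N))) := by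
  have hN0 : 0 ≤ N := hN ▸ by positivity
  have log_two_lt := Real.log_two_lt_d9
  have log_two_gt := Real.log_two_gt_d9
  have subset_union : {x : ι → X | ¬ (N / 8 ≤ ({i | x i ∈ A} : Finset ι).card ∧
      (({i | x i ∈ A} : Finset ι).card : ℝ) ≤ 4 * N)} ⊆
      {x | (1 / 2 : ℝ) ^ (N / 8) ≤ (1 / 2 : ℝ) ^ ({i | x i ∈ A} : Finset ι).card} ∪
      {x | (2 : ℝ) ^ (4 * N) ≤ (2 : ℝ) ^ ({i | x i ∈ A} : Finset ι).card} := by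
    intro x hx
    simp only [Set.mem_union, Set.mem_ofPred_eq, ← Real.rpow_natCast] at hx ⊢
    rw [not_and_or, not_le, not_le] at hx
    exact hx.imp (fun h => Real.rpow_le_rpow_of_exponent_ge (by norm_num) (by norm_num) h.le)
      fun h => Real.rpow_le_rpow_of_exponent_le (by norm_num) h.le
  refine (measure_mono subset_union).trans ((measure_union_le _ _).trans ?_)
  refine (add_le_add (pi_rpow_le_pow_card_mem_le ν hA (by norm_num) _)
    (pi_rpow_le_pow_card_mem_le ν hA (by norm_num) _)).trans ?_
  rw [hN, ← ENNReal.ofReal_add (Real.exp_pos _).le (Real.exp_pos _).le, two_mul, one_div,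
    Real.log_inv]
  refine ENNReal.ofReal_le_ofReal (add_le_add ?_ ?_) <;> rw [Real.exp_le_exp] <;> nlinarith

end Chernoff

lemma lintegral_le_ofReal_sub {α : Type*} [MeasurableSpace α] {μ : Measure α}
    [IsProbabilityMeasure μ] {f g : α → ℝ≥0∞} (hg : Measurable g) {a b : ℝ} (hb : 0 ≤ b)
    (hfg : ∀ x, f x + g x ≤ ENNReal.ofReal a) (hbg : ENNReal.ofReal b ≤ ∫⁻ x, g x ∂μ) :
    ∫⁻ x, f x ∂μ ≤ ENNReal.ofReal (a - b) := by
  rw [ENNReal.ofReal_sub _ hb]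
  refine ENNReal.le_sub_of_add_le_right ENNReal.ofReal_ne_top ?_
  calc ∫⁻ x, f x ∂μ + ENNReal.ofReal b
      ≤ ∫⁻ x, f x ∂μ + ∫⁻ x, g x ∂μ := by gcongr
    _ = ∫⁻ x, f x + g x ∂μ := (lintegral_add_right _ hg).symm
    _ ≤ ∫⁻ _, ENNReal.ofReal a ∂μ := lintegral_mono hfg
    _ = ENNReal.ofReal a := by simp

/-! ### The walk on the grid -/

section Grid

/-- The subsquares of the `s × s` grid. -/
def grid (s : ℕ) : Finset (ℤ × ℤ) := Finset.Ico 0 (s : ℤ) ×ˢ Finset.Ico 0 (s : ℤ)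

variable {s : ℕ} {c : ℤ × ℤ}

lemma mem_grid : c ∈ grid s ↔ 0 ≤ c.1 ∧ c.1 < s ∧ 0 ≤ c.2 ∧ c.2 < s := by
  simp [grid, and_assoc]

lemma card_grid (s : ℕ) : (grid s).card = s ^ 2 := by
  simp [grid, sq]

/-- The point of `ℤ × ℤ` reached from `c` by the move `d`, regardless of the boundary of the
grid. -/
def shift (c : ℤ × ℤ) (d : Fin 3 × Fin 3) : ℤ × ℤ :=
  (c.1 + (d.1.val : ℤ) - 1, c.2 + (d.2.val : ℤ) - 1)

lemma shift_shift_rev (c : ℤ × ℤ) (d : Fin 3 × Fin 3) :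
    shift (shift c d) (d.1.rev, d.2.rev) = c := by
  ext <;> simp only [shift, Fin.val_rev] <;> omega

lemma shift_rev_shift (c : ℤ × ℤ) (d : Fin 3 × Fin 3) :
    shift (shift c (d.1.rev, d.2.rev)) d = c := by
  simpa only [Fin.rev_rev] using shift_shift_rev c (d.1.rev, d.2.rev)

lemma move_eq_ite (s : ℕ) (c : ℤ × ℤ) (d : Fin 3 × Fin 3) :
    move s c d = if shift c d ∈ grid s then shift c d else c := by
  simp only [move, shift, mem_grid]

lemma move_mem_grid (hc : c ∈ grid s) (d : Fin 3 × Fin 3) : move s c d ∈ grid s := by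
  rw [move_eq_ite]
  split_ifs with h <;> assumption

lemma cellOf_mem_grid (hs : 1 ≤ s) (p : I × I) : cellOf s p ∈ grid s := by
  have floor_nonneg : ∀ u : I, 0 ≤ ⌊(s : ℝ) * u⌋ := fun u =>
    Int.floor_nonneg.2 (mul_nonneg s.cast_nonneg u.2.1)
  have := floor_nonneg p.1
  have := floor_nonneg p.2
  simp only [mem_grid, cellOf]
  omega

lemma cell_mem_grid {n : ℕ} (hs : 1 ≤ s) (ω : Run n) (i : Fin n) (t : ℕ) :
    cell s ω i t ∈ grid s := by
  induction t with
  | zero => exact cellOf_mem_grid hs _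
  | succ t ih => exact move_mem_grid ih _

lemma abs_move_sub_le (s : ℕ) (c : ℤ × ℤ) (d : Fin 3 × Fin 3) :
    |(move s c d).1 - c.1| ≤ 1 ∧ |(move s c d).2 - c.2| ≤ 1 := by
  rw [move_eq_ite]
  split_ifs <;> simp only [shift, abs_le] <;> omega

/-- Reversing the moves that stay in the grid shows that the walk is doubly stochastic. -/
lemma sum_grid_move {M : Type*} [AddCommMonoid M] (s : ℕ) (f : ℤ × ℤ → M) :
    ∑ c ∈ grid s, ∑ d : Fin 3 × Fin 3, f (move s c d) = 9 • ∑ c ∈ grid s, f c := by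
  let rev : Fin 3 × Fin 3 ≃ Fin 3 × Fin 3 := Fin.revPerm.prodCongr Fin.revPerm
  have sum_inside : ∀ d, ∑ c ∈ grid s with shift c d ∈ grid s, f (shift c d) =
      ∑ c ∈ grid s with shift c (rev d) ∈ grid s, f c := fun d => by
    refine Finset.sum_nbij' (shift · d) (shift · (rev d)) ?_ ?_
      (fun c _ => shift_shift_rev c d) (fun c _ => shift_rev_shift c d) fun _ _ => rfl
    · intro c hc
      rw [Finset.mem_filter] at hc ⊢
      exact ⟨hc.2, (shift_shift_rev c d).symm ▸ hc.1⟩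
    · intro c hc
      rw [Finset.mem_filter] at hc ⊢
      exact ⟨hc.2, (shift_rev_shift c d).symm ▸ hc.1⟩
  calc ∑ c ∈ grid s, ∑ d, f (move s c d)
      = ∑ d, (∑ c ∈ grid s with shift c d ∈ grid s, f (shift c d) +
          ∑ c ∈ grid s with shift c d ∉ grid s, f c) := by
        rw [Finset.sum_comm]
        refine Finset.sum_congr rfl fun d _ => ?_
        simp only [move_eq_ite, apply_ite f, Finset.sum_ite]
    _ = ∑ d, (∑ c ∈ grid s with shift c d ∈ grid s, f c +
          ∑ c ∈ grid s with shift c d ∉ grid s, f c) := by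
        simp only [sum_inside, Finset.sum_add_distrib]
        congr 1
        exact rev.sum_comp fun d => ∑ c ∈ grid s with shift c d ∈ grid s, f c
    _ = 9 • ∑ c ∈ grid s, f c := by
        simp only [Finset.sum_filter_add_sum_filter_not]
        simp

end Grid

section GridLaw

variable {s : ℕ}

/-- The uniform distribution on the subsquares of the `s × s` grid. -/
def gridLaw (s : ℕ) : Measure (ℤ × ℤ) := ProbabilityTheory.uniformOn (grid s : Set (ℤ × ℤ))

lemma isProbabilityMeasure_gridLaw (hs : 1 ≤ s) : IsProbabilityMeasure (gridLaw s) :=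
  ProbabilityTheory.isProbabilityMeasure_uniformOn (grid s).finite_toSet
    ⟨(0, 0), by simp only [Finset.mem_coe, mem_grid]; omega⟩

instance (s : ℕ) : IsFiniteMeasure (gridLaw s) := by
  rcases Nat.eq_zero_or_pos s with rfl | hs
  · simp only [gridLaw, grid, Nat.cast_zero, Finset.Ico_self, Finset.empty_product,
      Finset.coe_empty, ProbabilityTheory.uniformOn_empty_meas]
    infer_instance
  · have := isProbabilityMeasure_gridLaw hs
    infer_instance

lemma gridLaw_singleton {c : ℤ × ℤ} (hc : c ∈ grid s) : gridLaw s {c} = ((s : ℝ≥0∞) ^ 2)⁻¹ := by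
  have h := ProbabilityTheory.uniformOn_apply_finset (s := grid s) (t := {c})
  rw [Finset.inter_singleton_of_mem hc, card_grid] at h
  simpa [gridLaw, ENNReal.div_eq_inv_mul] using h

lemma lintegral_gridLaw (s : ℕ) (f : ℤ × ℤ → ℝ≥0∞) :
    ∫⁻ c, f c ∂(gridLaw s) = ((s : ℝ≥0∞) ^ 2)⁻¹ * ∑ c ∈ grid s, f c := by
  rw [gridLaw, ProbabilityTheory.uniformOn, ProbabilityTheory.cond, lintegral_smul_measure,
    lintegral_finset]
  simp [card_grid]

lemma volume_min_floor_eq {x : ℤ} (h0 : 0 ≤ x) (h1 : x < s) :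
    volume {u : I | min ⌊(s : ℝ) * u⌋ (s - 1) = x} = (s : ℝ≥0∞)⁻¹ := by
  have hs : (0 : ℝ) < s := by exact_mod_cast h0.trans_lt h1
  have : (0 : ℝ) ≤ x := by exact_mod_cast h0
  have hx1 : (x : ℝ) + 1 ≤ s := by exact_mod_cast h1
  let p : I := ⟨x / s, by positivity, by rw [div_le_one hs]; linarith⟩
  let q : I := ⟨(x + 1) / s, by positivity, by rw [div_le_one hs]; linarith⟩
  have length_eq : ENNReal.ofReal ((q : ℝ) - p) = (s : ℝ≥0∞)⁻¹ := by
    rw [show (q : ℝ) - p = (s : ℝ)⁻¹ by simp only [p, q]; field_simp; ring,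
      ENNReal.ofReal_inv_of_pos hs, ENNReal.ofReal_natCast]
  rw [← length_eq]
  apply le_antisymm
  · rw [← unitInterval.volume_Icc]
    refine measure_mono fun u (hu : min ⌊(s : ℝ) * u⌋ (s - 1) = x) => ⟨?_, ?_⟩
    · have := Int.le_floor.1 (show x ≤ ⌊(s : ℝ) * u⌋ by omega)
      change (x : ℝ) / s ≤ u
      rw [div_le_iff₀ hs]
      linarith
    · change (u : ℝ) ≤ (x + 1) / s
      rw [le_div_iff₀ hs]
      by_cases last : (s : ℤ) = x + 1
      · have : (s : ℝ) = x + 1 := by exact_mod_cast last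
        nlinarith [u.2.2]
      · have := Int.lt_floor_add_one ((s : ℝ) * u)
        rw [show ⌊(s : ℝ) * u⌋ = x by omega] at this
        linarith
  · rw [← unitInterval.volume_Ioo]
    refine measure_mono fun u ⟨hpu, huq⟩ => ?_
    have hpu' : (x : ℝ) / s < u := hpu
    have huq' : (u : ℝ) < (x + 1) / s := huq
    rw [div_lt_iff₀ hs] at hpu'
    rw [lt_div_iff₀ hs] at huq'
    have : ⌊(s : ℝ) * u⌋ = x := Int.floor_eq_iff.2 ⟨by linarith, by linarith⟩
    change min ⌊(s : ℝ) * u⌋ ((s : ℤ) - 1) = x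
    omega

lemma measurable_cellOf (s : ℕ) : Measurable (cellOf s) :=
  ((Int.measurable_floor.comp (by fun_prop)).min measurable_const).prodMk
    ((Int.measurable_floor.comp (by fun_prop)).min measurable_const)

lemma map_cellOf_volume (hs : 1 ≤ s) : volume.map (cellOf s) = gridLaw s := by
  refine Measure.ext_of_singleton fun c => ?_
  rw [Measure.map_apply (measurable_cellOf s) (measurableSet_singleton c)]
  by_cases hc : c ∈ grid s
  · have preimage_eq : cellOf s ⁻¹' {c} = {u : I | min ⌊(s : ℝ) * u⌋ (s - 1) = c.1} ×ˢ
        {u : I | min ⌊(s : ℝ) * u⌋ (s - 1) = c.2} := by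
      ext p
      simp [cellOf, Prod.ext_iff]
    obtain ⟨h10, h1s, h20, h2s⟩ := mem_grid.1 hc
    rw [preimage_eq, Measure.volume_eq_prod, Measure.prod_prod, volume_min_floor_eq h10 h1s,
      volume_min_floor_eq h20 h2s, gridLaw_singleton hc, sq,
      ENNReal.mul_inv (by simp) (by simp)]
  · rw [gridLaw, (ProbabilityTheory.uniformOn_eq_zero_iff (grid s).finite_toSet).2 (by simpa),
      Set.preimage_singleton_eq_empty.2 fun ⟨p, hp⟩ => hc (hp ▸ cellOf_mem_grid hs p),
      measure_empty]

/-- The uniform distribution on the nine moves. -/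
def moveLaw : Measure (Fin 3 × Fin 3) := (PMF.uniformOfFintype (Fin 3 × Fin 3)).toMeasure

instance : IsProbabilityMeasure moveLaw := by
  unfold moveLaw; infer_instance

lemma slotLaw_eq_prod : slotLaw = moveLaw.prod volume := rfl

lemma moveLaw_singleton (d : Fin 3 × Fin 3) : moveLaw {d} = 9⁻¹ := by
  rw [moveLaw, PMF.toMeasure_apply_singleton _ _ (measurableSet_singleton _),
    PMF.uniformOfFintype_apply]
  norm_num

lemma lintegral_moveLaw (f : Fin 3 × Fin 3 → ℝ≥0∞) : ∫⁻ d, f d ∂moveLaw = 9⁻¹ * ∑ d, f d := by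
  simp only [lintegral_fintype, moveLaw_singleton, ← Finset.sum_mul, mul_comm]

lemma map_move_gridLaw (s : ℕ) :
    ((gridLaw s).prod moveLaw).map (Function.uncurry (move s)) = gridLaw s := by
  have measurable_move : Measurable (Function.uncurry (move s)) := measurable_of_countable _
  refine Measure.ext_of_singleton fun c => ?_
  calc ((gridLaw s).prod moveLaw).map (Function.uncurry (move s)) {c}
      = ∫⁻ a, ∫⁻ d, ({c} : Set (ℤ × ℤ)).indicator 1 (move s a d) ∂moveLaw ∂(gridLaw s) := by
        rw [← lintegral_indicator_one (measurableSet_singleton c),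
          lintegral_map (measurable_of_countable _) measurable_move,
          lintegral_prod _ (measurable_of_countable _).aemeasurable]
        rfl
    _ = ∫⁻ a, ({c} : Set (ℤ × ℤ)).indicator 1 a ∂(gridLaw s) := by
        simp only [lintegral_gridLaw, lintegral_moveLaw, ← Finset.mul_sum, sum_grid_move,
          nsmul_eq_mul, ← mul_assoc]
        congr 1
        rw [mul_assoc, Nat.cast_ofNat, ENNReal.inv_mul_cancel (by norm_num) (by norm_num), mul_one]
    _ = gridLaw s {c} := lintegral_indicator_one (measurableSet_singleton c)

lemma map_move_gridLaw_prod_slotLaw (s : ℕ) :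
    ((gridLaw s).prod slotLaw).map (fun p => (move s p.1 p.2.1, p.2.2)) =
      (gridLaw s).prod volume := by
  have measurable_move : Measurable (Function.uncurry (move s)) := measurable_of_countable _
  have assoc := (measurePreserving_prodAssoc (gridLaw s) moveLaw
    (volume : Measure ((I × I) × I × I))).map_eq
  conv_rhs => rw [← map_move_gridLaw s, ← Measure.map_id (μ := volume)]
  rw [slotLaw_eq_prod, ← assoc, Measure.map_map (by fun_prop) (by fun_prop),
    Measure.map_prod_map _ _ measurable_move measurable_id]
  rfl

end GridLaw

section SlotsLaw

variable {n : ℕ}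

/-- The law of the seeds of all users in one slot. -/
def slotsLaw (n : ℕ) : Measure (Fin n → SlotSeed) := Measure.pi fun _ => slotLaw

instance (n : ℕ) : IsProbabilityMeasure (slotsLaw n) := by
  unfold slotsLaw; infer_instance

/-- The run in which the seeds of slot `t` are replaced by `ξ`; invariance under this operation
expresses that a quantity does not depend on slot `t`. -/
def Run.resample (ω : Run n) (t : ℕ) (ξ : Fin n → SlotSeed) : Run n :=
  (ω.1, Function.update ω.2 t ξ)

lemma Run.resample_snd (ω : Run n) (t : ℕ) (ξ : Fin n → SlotSeed) : (ω.resample t ξ).2 t = ξ :=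
  Function.update_self ..

lemma Run.resample_snd_of_ne (ω : Run n) {t u : ℕ} (h : u ≠ t) (ξ : Fin n → SlotSeed) :
    (ω.resample t ξ).2 u = ω.2 u :=
  Function.update_of_ne h ..

lemma measurePreserving_resample (t : ℕ) :
    MeasurePreserving (fun p : Run n × (Fin n → SlotSeed) => p.1.resample t p.2)
      ((runLaw n).prod (slotsLaw n)) (runLaw n) :=
  ((MeasurePreserving.id _).prod (measurePreserving_update_infinitePi _ t)).comp
    (measurePreserving_prodAssoc _ _ _)

lemma map_prodMk_seed {X : Type*} [MeasurableSpace X] {x : Run n → X} (hx : Measurable x) {t : ℕ}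
    (hxt : ∀ ω ξ, x (ω.resample t ξ) = x ω) :
    (runLaw n).map (fun ω => (x ω, ω.2 t)) = ((runLaw n).map x).prod (slotsLaw n) := by
  have resample_eq : (fun p : Run n × (Fin n → SlotSeed) =>
      (x (p.1.resample t p.2), (p.1.resample t p.2).2 t)) = Prod.map x id := by
    funext p
    simp only [hxt, Run.resample_snd, Prod.map, id]
  rw [← (measurePreserving_resample t).map_eq,
    Measure.map_map (hx.prodMk (by fun_prop)) (measurePreserving_resample t).measurable,
    show _ ∘ _ = Prod.map x id from resample_eq, ← Measure.map_prod_map _ _ hx measurable_id,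
    Measure.map_id, (measurePreserving_resample t).map_eq]

lemma lintegral_prodMk_seed {X : Type*} [MeasurableSpace X] {x : Run n → X} (hx : Measurable x)
    {t : ℕ} (hxt : ∀ ω ξ, x (ω.resample t ξ) = x ω) {f : X → (Fin n → SlotSeed) → ℝ≥0∞}
    (hf : Measurable (Function.uncurry f)) :
    ∫⁻ ω, f (x ω) (ω.2 t) ∂(runLaw n) = ∫⁻ ω, ∫⁻ ξ, f (x ω) ξ ∂(slotsLaw n) ∂(runLaw n) := by
  calc ∫⁻ ω, f (x ω) (ω.2 t) ∂(runLaw n)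
      = ∫⁻ p, Function.uncurry f p ∂((runLaw n).map fun ω => (x ω, ω.2 t)) :=
        (lintegral_map hf (hx.prodMk (by fun_prop))).symm
    _ = ∫⁻ a, ∫⁻ ξ, f a ξ ∂(slotsLaw n) ∂((runLaw n).map x) := by
        rw [map_prodMk_seed hx hxt, lintegral_prod _ hf.aemeasurable]
        rfl
    _ = ∫⁻ ω, ∫⁻ ξ, f (x ω) ξ ∂(slotsLaw n) ∂(runLaw n) :=
        lintegral_map hf.lintegral_prod_right' hx

lemma setLIntegral_prodMk_seed {X : Type*} [MeasurableSpace X] {x : Run n → X} (hx : Measurable x)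
    {t : ℕ} (hxt : ∀ ω ξ, x (ω.resample t ξ) = x ω) {E : Set (Run n)} (hE : MeasurableSet E)
    (hEt : ∀ ω ξ, ω.resample t ξ ∈ E ↔ ω ∈ E) {f : X → (Fin n → SlotSeed) → ℝ≥0∞}
    (hf : Measurable (Function.uncurry f)) :
    ∫⁻ ω in E, f (x ω) (ω.2 t) ∂(runLaw n) =
      ∫⁻ ω in E, ∫⁻ ξ, f (x ω) ξ ∂(slotsLaw n) ∂(runLaw n) := by
  let f' (p : X × ℝ≥0∞) (ξ : Fin n → SlotSeed) : ℝ≥0∞ := p.2 * f p.1 ξ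
  have measurable_f' : Measurable (Function.uncurry f') := by
    have : Measurable fun p : (X × ℝ≥0∞) × (Fin n → SlotSeed) => f p.1.1 p.2 :=
      hf.comp (by fun_prop : Measurable fun p : (X × ℝ≥0∞) × (Fin n → SlotSeed) => (p.1.1, p.2))
    exact (measurable_snd.comp measurable_fst).mul this
  have key := lintegral_prodMk_seed (t := t) (hx.prodMk (measurable_one.indicator hE))
    (fun ω ξ => Prod.ext (hxt ω ξ) (Set.indicator_const_eq_indicator_const (hEt ω ξ)))
    measurable_f'
  have f'_eq (ω : Run n) (ξ : Fin n → SlotSeed) :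
      f' (x ω, E.indicator 1 ω) ξ = E.indicator (fun ω => f (x ω) ξ) ω := by
    by_cases h : ω ∈ E <;> simp [f', h]
  rw [← lintegral_indicator hE, ← lintegral_indicator hE]
  refine (lintegral_congr fun ω => ?_).trans (key.trans (lintegral_congr fun ω => ?_))
  · exact (f'_eq ω (ω.2 t)).symm
  · by_cases h : ω ∈ E <;> simp [f', h]

end SlotsLaw

lemma map_comp_of_map_eq_pi {Ω ι Y Z : Type*} [MeasurableSpace Ω] [Fintype ι] [MeasurableSpace Y]
    [MeasurableSpace Z] {μ : Measure Ω} {ν : Measure Y} [IsFiniteMeasure ν] {x : Ω → ι → Y}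
    (hx : Measurable x) (hμ : μ.map x = Measure.pi fun _ => ν) {g : Y → Z} (hg : Measurable g) :
    μ.map (fun ω i => g (x ω i)) = Measure.pi fun _ => ν.map g := by
  have measurable_map_g : Measurable fun (y : ι → Y) i => g (y i) :=
    measurable_pi_lambda _ fun i => hg.comp (measurable_pi_apply i)
  rw [← Measure.pi_map_pi fun _ => hg.aemeasurable, ← hμ, Measure.map_map measurable_map_g hx]
  rfl

section CellLaw

variable {n s t u : ℕ} {c : ℤ × ℤ}

lemma measurable_cell (s : ℕ) (i : Fin n) (t : ℕ) : Measurable fun ω : Run n => cell s ω i t := by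
  induction t with
  | zero => exact (measurable_cellOf s).comp (by unfold Run.init; fun_prop)
  | succ t ih =>
    have measurable_move : Measurable (Function.uncurry (move s)) := measurable_of_countable _
    exact measurable_move.comp (ih.prodMk (by fun_prop : Measurable fun ω : Run n => (ω.2 t i).1))

lemma cell_resample (s : ℕ) (i : Fin n) (h : u ≤ t) (ω : Run n) (ξ : Fin n → SlotSeed) :
    cell s (ω.resample t ξ) i u = cell s ω i u := by
  induction u with
  | zero => rfl
  | succ u ih =>
    simp only [cell, Run.dir]
    rw [ih (by omega), Run.resample_snd_of_ne ω (by omega)]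

lemma map_cell_seed_of_map_cell {μ : Measure (ℤ × ℤ)} [SigmaFinite μ] (h : u ≤ t)
    (hμ : (runLaw n).map (fun ω i => cell s ω i u) = Measure.pi fun _ => μ) :
    (runLaw n).map (fun ω i => (cell s ω i u, ω.2 t i)) = Measure.pi fun _ => μ.prod slotLaw := by
  have measurable_cells : Measurable fun (ω : Run n) i => cell s ω i u :=
    measurable_pi_lambda _ fun i => measurable_cell s i u
  have zip := (measurePreserving_arrowProdEquivProdArrow (ℤ × ℤ) SlotSeed (Fin n)
    (fun _ => μ) fun _ => slotLaw).symm.map_eq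
  rw [← zip, ← slotsLaw, ← hμ,
    ← map_prodMk_seed measurable_cells fun ω ξ => funext fun i => cell_resample s i h ω ξ,
    Measure.map_map (MeasurableEquiv.measurable _) (measurable_cells.prodMk (by fun_prop))]
  rfl

lemma map_cell (hs : 1 ≤ s) (t : ℕ) :
    (runLaw n).map (fun ω i => cell s ω i t) = Measure.pi fun _ => gridLaw s := by
  have := isProbabilityMeasure_gridLaw hs
  induction t with
  | zero =>
    have map_fst : (runLaw n).map Prod.fst = Measure.pi fun _ => volume := by
      rw [runLaw, Measure.map_fst_prod, measure_univ, one_smul]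
    rw [← map_cellOf_volume hs]
    exact map_comp_of_map_eq_pi measurable_fst map_fst (measurable_cellOf s)
  | succ t ih =>
    have measurable_move : Measurable fun p : (ℤ × ℤ) × SlotSeed => move s p.1 p.2.1 :=
      (measurable_of_countable (Function.uncurry (move s))).comp
        (by fun_prop : Measurable fun p : (ℤ × ℤ) × SlotSeed => (p.1, p.2.1))
    have map_move : ((gridLaw s).prod slotLaw).map (fun p => move s p.1 p.2.1) = gridLaw s := by
      have h := congrArg (Measure.map Prod.fst) (map_move_gridLaw_prod_slotLaw s)
      rw [Measure.map_map measurable_fst (measurable_move.prodMk (by fun_prop)),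
        Measure.map_fst_prod, measure_univ, one_smul] at h
      exact h
    rw [← map_move]
    exact map_comp_of_map_eq_pi
      (measurable_pi_lambda _ fun i => (measurable_cell s i t).prodMk (by fun_prop))
      (map_cell_seed_of_map_cell le_rfl ih) measurable_move

lemma map_cell_seed (hs : 1 ≤ s) (h : u ≤ t) :
    (runLaw n).map (fun ω i => (cell s ω i u, ω.2 t i)) =
      Measure.pi fun _ => (gridLaw s).prod slotLaw :=
  map_cell_seed_of_map_cell h (map_cell hs u)

lemma map_cell_seed_snd (hs : 1 ≤ s) (h : u ≤ t + 1) :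
    (runLaw n).map (fun ω i => (cell s ω i u, (ω.2 t i).2)) =
      Measure.pi fun _ => (gridLaw s).prod volume := by
  have := isProbabilityMeasure_gridLaw hs
  have map_of_step {step : ℤ × ℤ → Fin 3 × Fin 3 → ℤ × ℤ} {r : ℕ} (hr : r ≤ t)
      (hstep : ((gridLaw s).prod slotLaw).map (fun p => (step p.1 p.2.1, p.2.2)) =
        (gridLaw s).prod volume) :
      (runLaw n).map (fun ω i => (step (cell s ω i r) (ω.2 t i).1, (ω.2 t i).2)) =
        Measure.pi fun _ => (gridLaw s).prod volume := by
    have measurable_step : Measurable fun p : (ℤ × ℤ) × SlotSeed => (step p.1 p.2.1, p.2.2) :=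
      ((measurable_of_countable (Function.uncurry step)).comp
        (by fun_prop : Measurable fun p : (ℤ × ℤ) × SlotSeed => (p.1, p.2.1))).prodMk (by fun_prop)
    rw [← hstep]
    exact map_comp_of_map_eq_pi
      (measurable_pi_lambda _ fun i => (measurable_cell s i r).prodMk (by fun_prop))
      (map_cell_seed hs hr) measurable_step
  rcases h.lt_or_eq with h | rfl
  · refine map_of_step (step := fun c _ => c) (by omega) ?_
    rw [show (fun p : (ℤ × ℤ) × SlotSeed => (p.1, p.2.2)) = Prod.map id Prod.snd from rfl,
      ← Measure.map_prod_map _ _ measurable_id measurable_snd, Measure.map_id, slotLaw_eq_prod,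
      Measure.map_snd_prod, measure_univ, one_smul]
  · exact map_of_step le_rfl (map_move_gridLaw_prod_slotLaw s)

lemma volume_coin_lt (φ : Phy) : volume {u : I | (u : ℝ) < φ.θ} = ENNReal.ofReal φ.θ :=
  unitInterval.volume_Iio (x := ⟨φ.θ, φ.θ_pos.le, by linarith [φ.θ_lt_half]⟩)

lemma volume_coin_ge (φ : Phy) : volume {u : I | φ.θ ≤ u} = ENNReal.ofReal (1 - φ.θ) :=
  unitInterval.volume_Ici (x := ⟨φ.θ, φ.θ_pos.le, by linarith [φ.θ_lt_half]⟩)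

lemma notMem_senders {φ : Phy} {ω : Run n} {i : Fin n} :
    i ∉ senders φ ω t ↔ φ.θ ≤ (ω.2 t i).2.2.1 := by
  unfold senders Run.coin
  rw [Finset.mem_filter]
  simp

lemma real_gridLaw_singleton (hc : c ∈ grid s) : (gridLaw s).real {c} = 1 / (s : ℝ) ^ 2 := by
  simp [measureReal_def, gridLaw_singleton hc]

lemma measure_no_receiver_le (hs : 1 ≤ s) (φ : Phy) (hu : u ≤ t + 1) (hc : c ∈ grid s) :
    runLaw n {ω | ∀ i, ¬ (cell s ω i u = c ∧ i ∉ senders φ ω t)} ≤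
      ENNReal.ofReal (Real.exp (-(n / (s : ℝ) ^ 2 / 2))) := by
  have := isProbabilityMeasure_gridLaw hs
  let receiving : Set ((I × I) × I × I) := Set.univ ×ˢ {v : I | φ.θ ≤ v} ×ˢ Set.univ
  let A : Set ((ℤ × ℤ) × (I × I) × I × I) := {c} ×ˢ receiving
  have hA : MeasurableSet A := (measurableSet_singleton c).prod
    (.prod .univ (.prod (measurableSet_le measurable_const measurable_subtype_coe) .univ))
  have measureReal_A : ((gridLaw s).prod volume).real A = 1 / (s : ℝ) ^ 2 * (1 - φ.θ) := by
    have : volume receiving = ENNReal.ofReal (1 - φ.θ) := by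
      simp only [receiving, Measure.volume_eq_prod, Measure.prod_prod, volume_coin_ge,
        measure_univ, one_mul, mul_one]
    rw [measureReal_prod_prod, real_gridLaw_singleton hc, measureReal_def, this,
      ENNReal.toReal_ofReal (by linarith [φ.θ_lt_half])]
  have preimage_eq : {ω : Run n | ∀ i, ¬ (cell s ω i u = c ∧ i ∉ senders φ ω t)} =
      (fun ω i => (cell s ω i u, (ω.2 t i).2)) ⁻¹' {x | ∀ i, x i ∉ A} := by
    ext ω
    simp [A, receiving, notMem_senders]
  have measurable_cell_seed : Measurable fun (ω : Run n) i => (cell s ω i u, (ω.2 t i).2) :=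
    measurable_pi_lambda _ fun i => (measurable_cell s i u).prodMk (by fun_prop)
  calc runLaw n {ω | ∀ i, ¬ (cell s ω i u = c ∧ i ∉ senders φ ω t)}
      ≤ Measure.pi (fun _ : Fin n => (gridLaw s).prod volume) {x | ∀ i, x i ∉ A} := by
        rw [preimage_eq, ← map_cell_seed_snd hs hu]
        exact Measure.le_map_apply measurable_cell_seed.aemeasurable _
    _ ≤ ENNReal.ofReal (Real.exp (-(n * (1 / (s : ℝ) ^ 2 * (1 - φ.θ))))) := by
        have h := pi_forall_notMem_le (ι := Fin n) ((gridLaw s).prod volume) hA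
        rwa [measureReal_A, Fintype.card_fin] at h
    _ ≤ ENNReal.ofReal (Real.exp (-(n / (s : ℝ) ^ 2 / 2))) := by
        have : 0 ≤ n / (s : ℝ) ^ 2 := by positivity
        gcongr
        rw [← mul_assoc, mul_one_div]
        nlinarith [φ.θ_lt_half]

/-- The number of users located in the subsquare `c`. -/
def occupancy (x : Fin n → ℤ × ℤ) (c : ℤ × ℤ) : ℕ :=
  (Finset.univ.filter fun i => x i = c).card

lemma measure_occupancy_unbalanced_le (hs : 1 ≤ s) (t : ℕ) (hc : c ∈ grid s) :
    runLaw n {ω | ¬ ((n / (s : ℝ) ^ 2) / 8 ≤ occupancy (fun i => cell s ω i t) c ∧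
      (occupancy (fun i => cell s ω i t) c : ℝ) ≤ 4 * (n / (s : ℝ) ^ 2))} ≤
        ENNReal.ofReal (2 * Real.exp (-(0.4 * (n / (s : ℝ) ^ 2)))) := by
  have := isProbabilityMeasure_gridLaw hs
  have hN : Fintype.card (Fin n) * (gridLaw s).real {c} = n / (s : ℝ) ^ 2 := by
    rw [Fintype.card_fin, real_gridLaw_singleton hc, mul_one_div]
  let unbalanced : Set (Fin n → ℤ × ℤ) := {x | ¬ ((n / (s : ℝ) ^ 2) / 8 ≤ occupancy x c ∧
    (occupancy x c : ℝ) ≤ 4 * (n / (s : ℝ) ^ 2))}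
  calc runLaw n ((fun ω i => cell s ω i t) ⁻¹' unbalanced)
      ≤ (runLaw n).map (fun ω i => cell s ω i t) unbalanced :=
        Measure.le_map_apply
          (measurable_pi_lambda _ fun i => measurable_cell s i t).aemeasurable _
    _ ≤ ENNReal.ofReal (2 * Real.exp (-(0.4 * (n / (s : ℝ) ^ 2)))) := by
        rw [map_cell hs]
        exact pi_not_card_mem_between_le (gridLaw s) (measurableSet_singleton c) hN

end CellLaw

/-! ### Finite speed of propagation -/

section Plane

lemma abs_apply_sub_apply_le_dist {ι : Type*} [Fintype ι] (x y : EuclideanSpace ℝ ι) (i : ι) :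
    |x i - y i| ≤ dist x y := by
  rw [dist_eq_norm]
  exact PiLp.norm_apply_le (x - y) i

lemma dist_le_of_abs_sub_le {x y : Plane} {a : ℝ} (h0 : |x 0 - y 0| ≤ a) (h1 : |x 1 - y 1| ≤ a) :
    dist x y ≤ 3 / 2 * a := by
  have ha : 0 ≤ a := (abs_nonneg _).trans h0
  rw [EuclideanSpace.dist_eq]
  refine Real.sqrt_le_iff.2 ⟨by positivity, ?_⟩
  rw [Fin.sum_univ_two, Real.dist_eq, Real.dist_eq]
  nlinarith [pow_le_pow_left₀ (abs_nonneg _) h0 2, pow_le_pow_left₀ (abs_nonneg _) h1 2,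
    sq_nonneg a]

/-- `x` lies in the closed subsquare `c` of the grid of mesh `1 / s`. -/
def InSquare (s : ℕ) (x : Plane) (c : ℤ × ℤ) : Prop :=
  s * x 0 ∈ Set.Icc (c.1 : ℝ) (c.1 + 1) ∧ s * x 1 ∈ Set.Icc (c.2 : ℝ) (c.2 + 1)

variable {s : ℕ} {x y : Plane} {c d : ℤ × ℤ}

lemma InSquare.dist_le (hs : 1 ≤ s) (hx : InSquare s x c) (hy : InSquare s y c) :
    dist x y ≤ 3 / 2 * (1 / s) := by
  have hs0 : (0 : ℝ) < s := by positivity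
  have abs_sub_le {u v a : ℝ} (hu : s * u ∈ Set.Icc a (a + 1)) (hv : s * v ∈ Set.Icc a (a + 1)) :
      |u - v| ≤ 1 / s := by
    rw [le_div_iff₀ hs0, ← abs_of_pos hs0, ← abs_mul, abs_le]
    constructor <;> linarith [hu.1, hu.2, hv.1, hv.2]
  exact dist_le_of_abs_sub_le (abs_sub_le hx.1 hy.1) (abs_sub_le hx.2 hy.2)

lemma InSquare.abs_sub_le_two (hs : 1 ≤ s) (hx : InSquare s x c) (hy : InSquare s y d)
    (hxy : dist x y ≤ 3 / 2 * (1 / s)) : |d.1 - c.1| ≤ 2 := by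
  have : (0 : ℝ) < s := by positivity
  have abs_mul_sub_le : |s * x 0 - s * y 0| ≤ 3 / 2 := by
    calc |s * x 0 - s * y 0| = s * |x 0 - y 0| := by rw [← mul_sub, abs_mul, Nat.abs_cast]
      _ ≤ s * (3 / 2 * (1 / s)) := by
        gcongr
        exact (abs_apply_sub_apply_le_dist x y 0).trans hxy
      _ = 3 / 2 := by field_simp
  rw [abs_le] at abs_mul_sub_le
  have hdc : ((d.1 : ℝ)) - c.1 < 3 := by linarith [hx.1.2, hy.1.1]
  have hcd : ((c.1 : ℝ)) - d.1 < 3 := by linarith [hx.1.1, hy.1.2]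
  norm_cast at hdc hcd
  rw [abs_le]
  omega

lemma inSquare_cellOf (s : ℕ) (p : I × I) :
    InSquare s !₂[(p.1 : ℝ), (p.2 : ℝ)] (cellOf s p) := by
  have mem_Icc (u : I) : (s : ℝ) * u ∈ Set.Icc ((min ⌊(s : ℝ) * u⌋ ((s : ℤ) - 1) : ℤ) : ℝ)
      ((min ⌊(s : ℝ) * u⌋ ((s : ℤ) - 1) : ℤ) + 1) := by
    have floor_le := Int.floor_le ((s : ℝ) * u)
    have lt_floor_add_one := Int.lt_floor_add_one ((s : ℝ) * u)
    have : (s : ℝ) * u ≤ s := mul_le_of_le_one_right s.cast_nonneg u.2.2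
    push_cast
    refine ⟨(min_le_left _ _).trans floor_le, ?_⟩
    rcases min_choice (⌊(s : ℝ) * u⌋ : ℝ) ((s : ℝ) - 1) with h | h <;> rw [h] <;> linarith
  exact ⟨mem_Icc p.1, mem_Icc p.2⟩

lemma inSquare_mobilePos_succ {n : ℕ} (hs : 1 ≤ s) (ω : Run n) (t : ℕ) (i : Fin n) :
    InSquare s (mobilePos s ω (t + 1) i) (cell s ω i (t + 1)) := by
  have hs0 : (s : ℝ) ≠ 0 := by positivity
  have offset_fst := (ω.offset t i).1.2
  have offset_snd := (ω.offset t i).2.2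
  simp only [InSquare, Set.mem_Icc, mobilePos, PiLp.toLp_apply, Matrix.cons_val_zero,
    Matrix.cons_val_one, mul_div_cancel₀ _ hs0]
  refine ⟨⟨?_, ?_⟩, ?_, ?_⟩ <;>
    linarith [offset_fst.1, offset_fst.2, offset_snd.1, offset_snd.2]

end Plane

section Holds

variable {n k : ℕ} {φ : Phy} {pos : ℕ → Fin n → Plane} {src : Fin k → Fin n} {τ : Fin k → ℕ}
  {ω : Run n} {t u d : ℕ} {m : Fin k} {j : Fin n}

lemma mem_holds_zero : m ∈ holds φ pos src τ ω 0 j ↔ τ m = 0 ∧ src m = j := by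
  rw [holds, Finset.mem_filter]
  simp

lemma mem_holds_succ :
    m ∈ holds φ pos src τ ω (t + 1) j ↔ m ∈ holds φ pos src τ ω t j ∨ (τ m = t + 1 ∧ src m = j) ∨
      ∃ i, Delivers φ (pos (t + 1)) (senders φ ω t) i j ∧
        Selects (ω.pick t i) (holds φ pos src τ ω t i) m := by
  classical
  rw [holds, Finset.mem_filter]
  simp

lemma holds_mono (h : t ≤ u) (hm : m ∈ holds φ pos src τ ω t j) :
    m ∈ holds φ pos src τ ω u j := by
  induction u, h using Nat.le_induction with
  | base => exact hm
  | succ u _ ih => exact mem_holds_succ.2 (Or.inl ih)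

lemma notMem_holds_of_lt (h : t < τ m) (j : Fin n) : m ∉ holds φ pos src τ ω t j := by
  induction t generalizing j with
  | zero =>
    rw [mem_holds_zero]
    omega
  | succ t ih =>
    rw [mem_holds_succ]
    rintro (old | ⟨injected, _⟩ | ⟨i, _, selects⟩)
    · exact ih (by omega) _ old
    · omega
    · exact ih (by omega) _ selects.1

lemma mem_holds_injection : m ∈ holds φ pos src τ ω (τ m) j ↔ src m = j := by
  rcases h : τ m with _ | t
  · simp [mem_holds_zero, h]
  · rw [mem_holds_succ]
    constructor
    · rintro (old | ⟨_, hsrc⟩ | ⟨i, _, selects⟩)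
      · exact absurd old (notMem_holds_of_lt (by omega) _)
      · exact hsrc
      · exact absurd selects.1 (notMem_holds_of_lt (by omega) _)
    · exact fun hsrc => Or.inr (Or.inl ⟨h, hsrc⟩)

lemma le_spreadingTime {x : ℝ}
    (h : ∀ d : ℕ, (∀ j, m ∈ holds φ pos src τ ω (τ m + d) j) → x ≤ d) :
    ENNReal.ofReal x ≤ ((spreadingTime φ pos src τ ω m : ℕ∞) : ℝ≥0∞) := by
  have ceil_le : ((⌈x⌉₊ : ℕ) : ℕ∞) ≤ spreadingTime φ pos src τ ω m :=
    le_iInf₂ fun d hd => by exact_mod_cast Nat.ceil_le.2 (h d hd)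
  calc ENNReal.ofReal x ≤ ENNReal.ofReal (⌈x⌉₊ : ℝ) := ENNReal.ofReal_le_ofReal (Nat.le_ceil x)
    _ = (((⌈x⌉₊ : ℕ) : ℕ∞) : ℝ≥0∞) := by simp
    _ ≤ _ := by exact_mod_cast ceil_le

lemma spreadingTime_le (h : ∀ j, m ∈ holds φ pos src τ ω (τ m + d) j) :
    ((spreadingTime φ pos src τ ω m : ℕ∞) : ℝ≥0∞) ≤ ENNReal.ofReal d := by
  have le_d : spreadingTime φ pos src τ ω m ≤ d := iInf₂_le d h
  rw [ENNReal.ofReal_natCast, ← ENat.toENNReal_coe]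
  exact_mod_cast le_d

lemma one_le_of_forall_mem_holds (hn : 2 ≤ n) (h : ∀ j, m ∈ holds φ pos src τ ω (τ m + d) j) :
    1 ≤ d := by
  by_contra hd
  obtain rfl : d = 0 := by omega
  simp only [add_zero, mem_holds_injection] at h
  have := (h ⟨0, by omega⟩).symm.trans (h ⟨1, by omega⟩)
  simp at this

end Holds

section Propagation

variable {n k s : ℕ} {φ : Phy} {pos : ℕ → Fin n → Plane} {src : Fin k → Fin n} {τ : Fin k → ℕ}
  {ω : Run n} {C : ℕ → Fin n → ℤ × ℤ}

/-- The users move along `C` in the `s × s` grid, changing column by at most one per slot, and from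
time `1` on their positions `pos` lie in the corresponding subsquares. -/
structure IsCellPath (s : ℕ) (pos : ℕ → Fin n → Plane) (C : ℕ → Fin n → ℤ × ℤ) : Prop where
  mem_grid : ∀ t i, C t i ∈ grid s
  abs_sub_le : ∀ t i, |(C (t + 1) i).1 - (C t i).1| ≤ 1
  inSquare : ∀ t i, InSquare s (pos (t + 1) i) (C (t + 1) i)

lemma isCellPath_mobilePos (hs : 1 ≤ s) (ω : Run n) :
    IsCellPath s (mobilePos s ω) fun t i => cell s ω i t where
  mem_grid t i := cell_mem_grid hs ω i t
  abs_sub_le _ _ := (abs_move_sub_le s _ _).1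
  inSquare t i := inSquare_mobilePos_succ hs ω t i

lemma isCellPath_staticPos (hs : 1 ≤ s) (ω : Run n) :
    IsCellPath s (staticPos ω) fun _ i => cell s ω i 0 where
  mem_grid _ i := cell_mem_grid hs ω i 0
  abs_sub_le _ _ := by simp
  inSquare _ i := inSquare_cellOf s (ω.init i)

/-- Every subsquare of the `s × s` grid contains a potential receiver in slot `t`. -/
def ReceiverEverywhere (φ : Phy) (s : ℕ) (ω : Run n) (C : ℕ → Fin n → ℤ × ℤ) (t : ℕ) : Prop :=
  ∀ c ∈ grid s, ∃ i, C (t + 1) i = c ∧ i ∉ senders φ ω t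

lemma IsCellPath.abs_sub_le_of_delivers (hC : IsCellPath s pos C) (hs : 1 ≤ s) {t : ℕ}
    (hrec : ReceiverEverywhere φ s ω C t) {i j : Fin n}
    (h : Delivers φ (pos (t + 1)) (senders φ ω t) i j) :
    |(C (t + 1) j).1 - (C (t + 1) i).1| ≤ 2 := by
  obtain ⟨l, hl, hlS⟩ := hrec _ (hC.mem_grid (t + 1) i)
  have dist_receiver_le := (h.2.2.1 l hlS).trans
    ((hC.inSquare t i).dist_le hs (hl ▸ hC.inSquare t l))
  exact (hC.inSquare t i).abs_sub_le_two hs (hC.inSquare t j) dist_receiver_le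

lemma IsCellPath.abs_sub_le_of_mem_holds (hC : IsCellPath s pos C) (hs : 1 ≤ s) {m : Fin k} {d : ℕ}
    (hrec : ∀ t ∈ Finset.Ico (τ m) (τ m + d), ReceiverEverywhere φ s ω C t) {j : Fin n}
    (hj : m ∈ holds φ pos src τ ω (τ m + d) j) :
    |(C (τ m + d) j).1 - (C (τ m) (src m)).1| ≤ 3 * d := by
  induction d generalizing j with
  | zero =>
    rw [add_zero, mem_holds_injection] at hj
    simp [hj]
  | succ d ih =>
    have ih' := fun i => ih (j := i) fun t ht => hrec t (by simp at ht ⊢; omega)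
    rw [← add_assoc, mem_holds_succ] at hj
    rw [← add_assoc, abs_le]
    push_cast
    rcases hj with old | injected | ⟨i, delivers, selects⟩
    · have holder := abs_le.1 (ih' j old)
      have step := abs_le.1 (hC.abs_sub_le (τ m + d) j)
      omega
    · omega
    · have holder := abs_le.1 (ih' i selects.1)
      have step := abs_le.1 (hC.abs_sub_le (τ m + d) i)
      have hop := abs_le.1 (hC.abs_sub_le_of_delivers hs (hrec _ (by simp)) delivers)
      omega

lemma IsCellPath.le_spreadingTime (hC : IsCellPath s pos C) (hn : 2 ≤ n) (hs : 1 ≤ s) {m : Fin k}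
    (hrec : ∀ t ∈ Finset.Ico (τ m) (τ m + s), ReceiverEverywhere φ s ω C t) :
    ENNReal.ofReal (s / 7) ≤ ((spreadingTime φ pos src τ ω m : ℕ∞) : ℝ≥0∞) := by
  refine Gossip.le_spreadingTime fun d hd => ?_
  have one_le_d := one_le_of_forall_mem_holds hn hd
  suffices s ≤ 7 * d by
    have : (s : ℝ) ≤ 7 * d := by exact_mod_cast this
    linarith
  by_contra! hds
  have hrec' : ∀ t ∈ Finset.Ico (τ m) (τ m + d), ReceiverEverywhere φ s ω C t :=
    fun t ht => hrec t (by simp at ht ⊢; omega)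
  have last_slot := hrec' (τ m + d - 1) (by simp; omega)
  rw [ReceiverEverywhere, show τ m + d - 1 + 1 = τ m + d by omega] at last_slot
  obtain ⟨p, hp, _⟩ := last_slot (0, 0) (Gossip.mem_grid.2 (by simp; omega))
  obtain ⟨q, hq, _⟩ := last_slot ((s : ℤ) - 1, 0) (Gossip.mem_grid.2 (by simp; omega))
  have left := abs_le.1 (hC.abs_sub_le_of_mem_holds hs hrec' (hd p))
  have right := abs_le.1 (hC.abs_sub_le_of_mem_holds hs hrec' (hd q))
  simp only [hp, hq] at left right
  omega

lemma measure_not_receiverEverywhere_le (φ : Phy) (T : ℕ) (C : Run n → ℕ → Fin n → ℤ × ℤ)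
    (hC : ∀ t, ∀ c ∈ grid s, runLaw n {ω | ∀ i, ¬ (C ω (t + 1) i = c ∧ i ∉ senders φ ω t)} ≤
      ENNReal.ofReal (Real.exp (-(n / (s : ℝ) ^ 2 / 2)))) :
    runLaw n {ω | ¬ ∀ t ∈ Finset.Ico T (T + s), ReceiverEverywhere φ s ω (C ω) t} ≤
      ENNReal.ofReal ((s : ℝ) ^ 3 * Real.exp (-(n / (s : ℝ) ^ 2 / 2))) := by
  have subset_iUnion : {ω | ¬ ∀ t ∈ Finset.Ico T (T + s), ReceiverEverywhere φ s ω (C ω) t} ⊆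
      ⋃ p ∈ Finset.Ico T (T + s) ×ˢ grid s,
        {ω | ∀ i, ¬ (C ω (p.1 + 1) i = p.2 ∧ i ∉ senders φ ω p.1)} := fun ω hω => by
    simp only [Set.mem_ofPred_eq, ReceiverEverywhere] at hω
    push Not at hω
    obtain ⟨t, ht, c, hc, h⟩ := hω
    exact Set.mem_iUnion₂.2 ⟨(t, c), Finset.mem_product.2 ⟨ht, hc⟩, fun i hi => hi.2 (h i hi.1)⟩
  calc runLaw n {ω | ¬ ∀ t ∈ Finset.Ico T (T + s), ReceiverEverywhere φ s ω (C ω) t}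
      ≤ ∑ p ∈ Finset.Ico T (T + s) ×ˢ grid s,
          runLaw n {ω | ∀ i, ¬ (C ω (p.1 + 1) i = p.2 ∧ i ∉ senders φ ω p.1)} :=
        (measure_mono subset_iUnion).trans (measure_biUnion_finset_le _ _)
    _ ≤ ∑ p ∈ Finset.Ico T (T + s) ×ˢ grid s,
          ENNReal.ofReal (Real.exp (-(n / (s : ℝ) ^ 2 / 2))) :=
        Finset.sum_le_sum fun p hp => hC p.1 p.2 (Finset.mem_product.1 hp).2
    _ = ENNReal.ofReal ((s : ℝ) ^ 3 * Real.exp (-(n / (s : ℝ) ^ 2 / 2))) := by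
        rw [Finset.sum_const, Finset.card_product, card_grid, Nat.card_Ico, Nat.add_sub_cancel_left,
          nsmul_eq_mul, ENNReal.ofReal_mul (by positivity), ENNReal.ofReal_pow s.cast_nonneg,
          ENNReal.ofReal_natCast]
        push_cast
        ring

lemma measure_mobileTime_lt_le (φ : Phy) (hn : 2 ≤ n) (hs : 1 ≤ s) (src : Fin k → Fin n)
    (τ : Fin k → ℕ) (m : Fin k) :
    runLaw n {ω | ¬ ENNReal.ofReal (s / 7) ≤ mobileTime φ s src τ ω m} ≤
      ENNReal.ofReal ((s : ℝ) ^ 3 * Real.exp (-(n / (s : ℝ) ^ 2 / 2))) := by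
  refine (measure_mono ?_).trans
    (measure_not_receiverEverywhere_le φ (τ m) (fun ω t i => cell s ω i t)
      fun _ _ hc => measure_no_receiver_le hs φ le_rfl hc)
  intro ω hω hrec
  exact hω ((isCellPath_mobilePos hs ω).le_spreadingTime hn hs hrec)

lemma measure_staticTime_lt_le (φ : Phy) (hn : 2 ≤ n) (hs : 1 ≤ s) (src : Fin k → Fin n)
    (τ : Fin k → ℕ) (m : Fin k) :
    runLaw n {ω | ¬ ENNReal.ofReal (s / 7) ≤ staticTime φ src τ ω m} ≤
      ENNReal.ofReal ((s : ℝ) ^ 3 * Real.exp (-(n / (s : ℝ) ^ 2 / 2))) := by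
  refine (measure_mono ?_).trans
    (measure_not_receiverEverywhere_le φ (τ m) (fun ω _ i => cell s ω i 0)
      fun _ _ hc => measure_no_receiver_le hs φ (Nat.zero_le _) hc)
  intro ω hω hrec
  exact hω ((isCellPath_staticPos hs ω).le_spreadingTime hn hs hrec)

end Propagation

/-! ### Interference and reception -/

section Interference

/-- The integral over the plane of the interference kernel at unit scale. The sup norm of `ℝ × ℝ`
replaces the Euclidean one, which only costs constant factors. -/
def kernelMass (α : ℝ) : ℝ≥0∞ := ∫⁻ z : ℝ × ℝ, ENNReal.ofReal ((1 + ‖z‖) ^ (-α))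

lemma kernelMass_lt_top {α : ℝ} (hα : 2 < α) : kernelMass α < ⊤ :=
  finite_integral_one_add_norm (E := ℝ × ℝ) (by simpa using hα)

lemma lintegral_kernel {α r a : ℝ} (hr : 0 < r) (ha : 0 < a) (y : ℝ × ℝ) :
    ∫⁻ z : ℝ × ℝ, ENNReal.ofReal ((r + ‖a⁻¹ • z - y‖) ^ (-α)) =
      ENNReal.ofReal (a ^ 2 * r ^ (2 - α)) * kernelMass α := by
  let f : ℝ × ℝ → ℝ≥0∞ := fun z => ENNReal.ofReal ((1 + ‖z‖) ^ (-α))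
  have measurable_f : Measurable f := by fun_prop
  have rescale (z : ℝ × ℝ) : ENNReal.ofReal ((r + ‖a⁻¹ • z - y‖) ^ (-α)) =
      ENNReal.ofReal (r ^ (-α)) * f ((a * r)⁻¹ • z - r⁻¹ • y) := by
    have norm_eq : ‖(a * r)⁻¹ • z - r⁻¹ • y‖ = r⁻¹ * ‖a⁻¹ • z - y‖ := by
      rw [mul_inv, mul_comm a⁻¹, mul_smul, ← smul_sub, norm_smul,
        Real.norm_of_nonneg (inv_nonneg.2 hr.le)]
    rw [← ENNReal.ofReal_mul (by positivity), ← Real.mul_rpow hr.le (by positivity), norm_eq]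
    congr 2
    field_simp
  calc ∫⁻ z : ℝ × ℝ, ENNReal.ofReal ((r + ‖a⁻¹ • z - y‖) ^ (-α))
      = ENNReal.ofReal (r ^ (-α)) * ∫⁻ z, f ((a * r)⁻¹ • z - r⁻¹ • y) := by
        rw [lintegral_congr rescale, lintegral_const_mul _ (by fun_prop)]
    _ = ENNReal.ofReal (r ^ (-α)) * ∫⁻ z, f (z - r⁻¹ • y) ∂volume.map ((a * r)⁻¹ • ·) := by
        rw [lintegral_map (by fun_prop) (by fun_prop)]
    _ = ENNReal.ofReal (r ^ (-α)) * (ENNReal.ofReal ((a * r) ^ 2) * kernelMass α) := by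
        rw [Measure.map_addHaar_smul volume (by positivity), lintegral_smul_measure, smul_eq_mul,
          lintegral_sub_right_eq_self f, Module.finrank_prod, Module.finrank_self, inv_pow, inv_inv,
          abs_of_pos (by positivity), kernelMass]
    _ = ENNReal.ofReal (a ^ 2 * r ^ (2 - α)) * kernelMass α := by
        rw [← mul_assoc, ← ENNReal.ofReal_mul (by positivity), sub_eq_add_neg, Real.rpow_add hr,
          Real.rpow_two]
        ring_nf

/-- The unit square of `ℝ × ℝ` with lower left corner `c`. -/
def unitCell (c : ℤ × ℤ) : Set (ℝ × ℝ) := Set.Ico (c.1 : ℝ) (c.1 + 1) ×ˢ Set.Ico (c.2 : ℝ) (c.2 + 1)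

lemma measurableSet_unitCell (c : ℤ × ℤ) : MeasurableSet (unitCell c) :=
  measurableSet_Ico.prod measurableSet_Ico

lemma mem_unitCell_iff {c : ℤ × ℤ} {z : ℝ × ℝ} : z ∈ unitCell c ↔ (⌊z.1⌋, ⌊z.2⌋) = c := by
  simp only [unitCell, Set.mem_prod, Set.mem_Ico, Prod.ext_iff, Int.floor_eq_iff]

lemma measurePreserving_add_offset (c : ℤ × ℤ) :
    MeasurePreserving (fun o : I × I => ((c.1 : ℝ) + o.1, (c.2 : ℝ) + o.2)) volume
      (volume.restrict (unitCell c)) := by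
  have coe : MeasurePreserving (Prod.map ((↑) : I → ℝ) ((↑) : I → ℝ)) volume
      ((volume : Measure (ℝ × ℝ)).restrict (unitCell 0)) := by
    have h := unitInterval.measurePreserving_coe.prod unitInterval.measurePreserving_coe
    rw [Measure.prod_restrict, ← Measure.restrict_congr_set
      (Measure.set_prod_ae_eq Ico_ae_eq_Icc Ico_ae_eq_Icc)] at h
    simpa [unitCell, Measure.volume_eq_prod] using h
  have preimage_eq : (((c.1 : ℝ), (c.2 : ℝ)) + ·) ⁻¹' unitCell c = unitCell 0 := by
    ext z
    simp [unitCell]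
  have translate := (measurePreserving_add_left (volume : Measure (ℝ × ℝ))
    ((c.1 : ℝ), (c.2 : ℝ))).restrict_preimage (measurableSet_unitCell c)
  rw [preimage_eq] at translate
  exact translate.comp coe

lemma sum_lintegral_offset_le (C : Finset (ℤ × ℤ)) {F : ℝ × ℝ → ℝ≥0∞} (hF : Measurable F) :
    ∑ c ∈ C, ∫⁻ o : I × I, F ((c.1 : ℝ) + o.1, (c.2 : ℝ) + o.2) ≤ ∫⁻ z, F z := by
  have pairwise_disjoint : (C : Set (ℤ × ℤ)).PairwiseDisjoint unitCell := by
    intro c _ c' _ hcc'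
    refine Set.disjoint_left.2 fun z hz hz' => hcc' ?_
    rw [← mem_unitCell_iff.1 hz, mem_unitCell_iff.1 hz']
  simp_rw [fun c => (measurePreserving_add_offset c).lintegral_comp hF]
  rw [← lintegral_biUnion_finset pairwise_disjoint fun c _ => measurableSet_unitCell c]
  exact setLIntegral_le_lintegral _ _

/-- New position of a user of subsquare `c` that draws the seed `ξ`. -/
def place (s : ℕ) (c : ℤ × ℤ) (ξ : SlotSeed) : ℝ × ℝ :=
  ((((move s c ξ.1).1 : ℝ) + (ξ.2.1.1 : ℝ)) / s, (((move s c ξ.1).2 : ℝ) + (ξ.2.1.2 : ℝ)) / s)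

lemma measurable_place (s : ℕ) (c : ℤ × ℤ) : Measurable (place s c) := by
  have : Measurable fun d : Fin 3 × Fin 3 => ((move s c d).1 : ℝ) := measurable_of_countable _
  have : Measurable fun d : Fin 3 × Fin 3 => ((move s c d).2 : ℝ) := measurable_of_countable _
  unfold place
  fun_prop

lemma lintegral_slotLaw {f : SlotSeed → ℝ≥0∞} (hf : Measurable f) :
    ∫⁻ ξ, f ξ ∂slotLaw = 9⁻¹ * ∑ d, ∫⁻ u, f (d, u) := by
  rw [slotLaw_eq_prod, lintegral_prod _ hf.aemeasurable, lintegral_moveLaw]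

lemma lintegral_place (s : ℕ) (c : ℤ × ℤ) {F : ℝ × ℝ → ℝ≥0∞} (hF : Measurable F) :
    ∫⁻ ξ, F (place s c ξ) ∂slotLaw = 9⁻¹ * ∑ d, ∫⁻ o : I × I,
      F ((s : ℝ)⁻¹ • (((move s c d).1 : ℝ) + (o.1 : ℝ), ((move s c d).2 : ℝ) + (o.2 : ℝ))) := by
  rw [lintegral_slotLaw (f := fun ξ => F (place s c ξ)) (hF.comp (measurable_place s c))]
  congr 1
  refine Finset.sum_congr rfl fun d _ => ?_
  rw [← (measurePreserving_fst (μ := (volume : Measure (I × I)))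
    (ν := (volume : Measure (I × I)))).lintegral_comp (by fun_prop)]
  simp only [place, Prod.smul_mk, smul_eq_mul, div_eq_inv_mul]
  rfl

lemma sum_comp_le_mul_sum_of_occupancy_le {n : ℕ} {c : Fin n → ℤ × ℤ} {C : Finset (ℤ × ℤ)}
    (hc : ∀ l, c l ∈ C) {M : ℝ} (hM : ∀ c' ∈ C, (occupancy c c' : ℝ) ≤ M) (f : ℤ × ℤ → ℝ≥0∞) :
    ∑ l, f (c l) ≤ ENNReal.ofReal M * ∑ c' ∈ C, f c' := by
  rw [← Finset.sum_fiberwise_of_maps_to' fun l _ => hc l, Finset.mul_sum]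
  refine Finset.sum_le_sum fun c' hc' => ?_
  rw [Finset.sum_const, nsmul_eq_mul]
  gcongr
  rw [← ENNReal.ofReal_natCast]
  exact ENNReal.ofReal_le_ofReal (hM c' hc')

lemma sum_lintegral_kernel_place_le {n s : ℕ} (hs : 1 ≤ s) {c : Fin n → ℤ × ℤ}
    (hc : ∀ l, c l ∈ grid s) {M : ℝ} (hM : ∀ c' ∈ grid s, (occupancy c c' : ℝ) ≤ M)
    {α r : ℝ} (hr : 0 < r) (y : ℝ × ℝ) :
    ∑ l, ∫⁻ ξ, ENNReal.ofReal ((r + ‖place s (c l) ξ - y‖) ^ (-α)) ∂slotLaw ≤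
      ENNReal.ofReal M * (ENNReal.ofReal ((s : ℝ) ^ 2 * r ^ (2 - α)) * kernelMass α) := by
  let F : ℝ × ℝ → ℝ≥0∞ := fun z => ENNReal.ofReal ((r + ‖(s : ℝ)⁻¹ • z - y‖) ^ (-α))
  let g : ℤ × ℤ → ℝ≥0∞ := fun c' => ∫⁻ o : I × I, F ((c'.1 : ℝ) + o.1, (c'.2 : ℝ) + o.2)
  calc ∑ l, ∫⁻ ξ, ENNReal.ofReal ((r + ‖place s (c l) ξ - y‖) ^ (-α)) ∂slotLaw
      = ∑ l, 9⁻¹ * ∑ d, g (move s (c l) d) := by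
        refine Finset.sum_congr rfl fun l _ => ?_
        exact lintegral_place s (c l) (F := fun z => ENNReal.ofReal ((r + ‖z - y‖) ^ (-α)))
          (by fun_prop)
    _ ≤ ENNReal.ofReal M * ∑ c' ∈ grid s, 9⁻¹ * ∑ d, g (move s c' d) :=
        sum_comp_le_mul_sum_of_occupancy_le hc hM _
    _ = ENNReal.ofReal M * ∑ c' ∈ grid s, g c' := by
        rw [← Finset.mul_sum, sum_grid_move s g, nsmul_eq_mul, ← mul_assoc 9⁻¹, Nat.cast_ofNat,
          ENNReal.inv_mul_cancel (by norm_num) (by norm_num), one_mul]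
    _ ≤ ENNReal.ofReal M * ∫⁻ z, F z := by
        gcongr
        exact sum_lintegral_offset_le (grid s) (by fun_prop)
    _ = ENNReal.ofReal M * (ENNReal.ofReal ((s : ℝ) ^ 2 * r ^ (2 - α)) * kernelMass α) := by
        rw [lintegral_kernel hr (by positivity) y]

end Interference

section Delivery

/-- A point of `ℝ × ℝ` as a point of the Euclidean plane. -/
def toPlane (z : ℝ × ℝ) : Plane := !₂[z.1, z.2]

lemma norm_sub_le_dist_toPlane (z z' : ℝ × ℝ) : ‖z - z'‖ ≤ dist (toPlane z) (toPlane z') := by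
  rw [Prod.norm_def, max_le_iff]
  exact ⟨abs_apply_sub_apply_le_dist (toPlane z) (toPlane z') 0,
    abs_apply_sub_apply_le_dist (toPlane z) (toPlane z') 1⟩

lemma dist_toPlane_le (z z' : ℝ × ℝ) : dist (toPlane z) (toPlane z') ≤ 3 / 2 * ‖z - z'‖ :=
  dist_le_of_abs_sub_le (norm_fst_le (z - z')) (norm_snd_le (z - z'))

lemma lt_norm_of_sum_kernel_lt {ι : Type*} {L : Finset ι} {x : ι → ℝ × ℝ} {y : ℝ × ℝ}
    {r α : ℝ} (hr : 0 < r) (hα : 0 ≤ α)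
    (hL : ∑ l ∈ L, (r + ‖x l - y‖) ^ (-α) < (2 * r) ^ (-α)) {l : ι} (hl : l ∈ L) :
    r < ‖x l - y‖ := by
  by_contra! hle
  refine hL.not_ge ?_
  calc (2 * r) ^ (-α) ≤ (r + ‖x l - y‖) ^ (-α) :=
        Real.rpow_le_rpow_of_nonpos (by positivity) (by linarith) (by linarith)
    _ ≤ ∑ l ∈ L, (r + ‖x l - y‖) ^ (-α) :=
        Finset.single_le_sum (f := fun l => (r + ‖x l - y‖) ^ (-α)) (fun l _ => by positivity) hl

lemma sum_dist_toPlane_rpow_le {ι : Type*} {L : Finset ι} {x : ι → ℝ × ℝ} {y : ℝ × ℝ}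
    {r α : ℝ} (hr : 0 < r) (hα : 0 ≤ α)
    (hL : ∑ l ∈ L, (r + ‖x l - y‖) ^ (-α) < (2 * r) ^ (-α)) :
    ∑ l ∈ L, dist (toPlane (x l)) (toPlane y) ^ (-α) ≤ r ^ (-α) := by
  calc ∑ l ∈ L, dist (toPlane (x l)) (toPlane y) ^ (-α)
      ≤ ∑ l ∈ L, 2 ^ α * (r + ‖x l - y‖) ^ (-α) := by
        refine Finset.sum_le_sum fun l hl => ?_
        have far := lt_norm_of_sum_kernel_lt hr hα hL hl
        have norm_le := norm_sub_le_dist_toPlane (x l) y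
        calc dist (toPlane (x l)) (toPlane y) ^ (-α) ≤ ((r + ‖x l - y‖) / 2) ^ (-α) :=
              Real.rpow_le_rpow_of_nonpos (by positivity) (by linarith) (by linarith)
          _ = 2 ^ α * (r + ‖x l - y‖) ^ (-α) := by
              rw [Real.div_rpow (by positivity) zero_le_two, Real.rpow_neg zero_le_two,
                div_inv_eq_mul, mul_comm]
    _ ≤ 2 ^ α * (2 * r) ^ (-α) := by
        rw [← Finset.mul_sum]
        gcongr
    _ = r ^ (-α) := by
        rw [Real.mul_rpow zero_le_two hr.le, ← mul_assoc, ← Real.rpow_add two_pos, add_neg_cancel,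
          Real.rpow_zero, one_mul]

variable {n : ℕ} {S : Finset (Fin n)} {i j : Fin n}

lemma le_sinr_of_dist_le (φ : Phy) {x : Fin n → Plane} {r ρ : ℝ} (hr : 0 < r) (hr1 : r ≤ 1)
    (hρ : 0 < ρ) (hρφ : φ.β * (φ.η + φ.P) ≤ φ.P * ρ ^ (-φ.α)) (hpos : 0 < dist (x i) (x j))
    (hnear : dist (x i) (x j) ≤ ρ * r)
    (hsum : ∑ l ∈ S.erase i, dist (x l) (x j) ^ (-φ.α) ≤ r ^ (-φ.α)) :
    φ.β ≤ sinr φ x S i j := by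
  have hP := φ.P_pos
  have hη := φ.η_pos
  have hβ := φ.β_pos
  have denominator_pos :
      0 < φ.η + φ.P * ∑ l ∈ S.erase i, dist (x l) (x j) ^ (-φ.α) :=
    add_pos_of_pos_of_nonneg hη
      (mul_nonneg hP.le (Finset.sum_nonneg fun l _ => Real.rpow_nonneg dist_nonneg _))
  have one_le : 1 ≤ r ^ (-φ.α) :=
    Real.one_le_rpow_of_pos_of_le_one_of_nonpos hr hr1 (by linarith [φ.two_lt_α])
  rw [sinr, ← Finset.mul_sum, le_div_iff₀ denominator_pos]
  calc φ.β * (φ.η + φ.P * ∑ l ∈ S.erase i, dist (x l) (x j) ^ (-φ.α))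
      ≤ φ.β * (φ.η * r ^ (-φ.α) + φ.P * r ^ (-φ.α)) := by
        gcongr
        exact le_mul_of_one_le_right hη.le one_le
    _ = φ.β * (φ.η + φ.P) * r ^ (-φ.α) := by ring
    _ ≤ φ.P * ρ ^ (-φ.α) * r ^ (-φ.α) := by gcongr
    _ = φ.P * (ρ * r) ^ (-φ.α) := by rw [Real.mul_rpow hρ.le hr.le, mul_assoc]
    _ ≤ φ.P * dist (x i) (x j) ^ (-φ.α) := by
        gcongr ?_ * ?_
        exact Real.rpow_le_rpow_of_nonpos hpos hnear (by linarith [φ.two_lt_α])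

/-- A sender at sup-distance `ρ * r` from a potential receiver reaches it when all other users are
farther than `r` and produce an interference of at most `P * r ^ (-α)`. -/
structure IsCloseRange (φ : Phy) (ρ : ℝ) : Prop where
  pos : 0 < ρ
  le_one_fourth : ρ ≤ 1 / 4
  le_power : φ.β * (φ.η + φ.P) ≤ φ.P * (2 * ρ) ^ (-φ.α)

lemma exists_isCloseRange (φ : Phy) : ∃ ρ, IsCloseRange φ ρ := by
  have hP := φ.P_pos
  have hη := φ.η_pos
  have hβ := φ.β_pos
  have hα : 0 < φ.α := two_pos.trans φ.two_lt_α
  let K := φ.β * (φ.η + φ.P) / φ.P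
  have hK : 0 < K := by positivity
  let ρ := min (1 / 4) (K ^ (-φ.α⁻¹) / 2)
  have hρ : 0 < ρ := lt_min (by norm_num) (by positivity)
  refine ⟨ρ, hρ, min_le_left _ _, ?_⟩
  have two_mul_le : 2 * ρ ≤ K ^ (-φ.α⁻¹) := by linarith [min_le_right (1 / 4) (K ^ (-φ.α⁻¹) / 2)]
  calc φ.β * (φ.η + φ.P) = φ.P * K := (mul_div_cancel₀ _ hP.ne').symm
    _ = φ.P * (K ^ (-φ.α⁻¹)) ^ (-φ.α) := by
        rw [← Real.rpow_mul hK.le, neg_mul_neg, inv_mul_cancel₀ hα.ne', Real.rpow_one]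
    _ ≤ φ.P * (2 * ρ) ^ (-φ.α) := by
        gcongr ?_ * ?_
        exact Real.rpow_le_rpow_of_nonpos (by positivity) two_mul_le (neg_nonpos.2 hα.le)

lemma delivers_of_sum_kernel_lt {φ : Phy} {x : Fin n → ℝ × ℝ} (hi : i ∈ S) (hj : j ∉ S) {r ρ : ℝ}
    (hr : 0 < r) (hr1 : r ≤ 1) (hρ : IsCloseRange φ ρ)
    (hpos : 0 < ‖x i - x j‖) (hnear : ‖x i - x j‖ ≤ ρ * r)
    (hL : ∑ l ∈ (Finset.univ.erase j).erase i, (r + ‖x l - x j‖) ^ (-φ.α) < (2 * r) ^ (-φ.α)) :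
    Delivers φ (fun l => toPlane (x l)) S i j := by
  have hα : 0 ≤ φ.α := zero_le_two.trans φ.two_lt_α.le
  have dist_le : dist (toPlane (x i)) (toPlane (x j)) ≤ 2 * ρ * r := by
    linarith [dist_toPlane_le (x i) (x j), norm_nonneg (x i - x j)]
  have erase_subset : S.erase i ⊆ (Finset.univ.erase j).erase i :=
    Finset.erase_subset_erase i fun l hl =>
      Finset.mem_erase.2 ⟨ne_of_mem_of_not_mem hl hj, Finset.mem_univ l⟩
  have senders_sum_lt : ∑ l ∈ S.erase i, (r + ‖x l - x j‖) ^ (-φ.α) < (2 * r) ^ (-φ.α) :=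
    (Finset.sum_le_sum_of_subset_of_nonneg erase_subset fun l _ _ => by positivity).trans_lt hL
  refine ⟨hi, hj, fun j' hj' => ?_, ?_⟩
  · obtain rfl | hjj := eq_or_ne j' j
    · exact le_rfl
    have far : r < ‖x j' - x j‖ :=
      lt_norm_of_sum_kernel_lt hr hα hL (by simp [hjj, (ne_of_mem_of_not_mem hi hj').symm])
    have triangle := norm_sub_le_norm_sub_add_norm_sub (x j') (x i) (x j)
    have norm_le := norm_sub_le_dist_toPlane (x i) (x j')
    have close := mul_le_mul_of_nonneg_right hρ.le_one_fourth hr.le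
    rw [norm_sub_rev] at norm_le
    linarith
  · exact le_sinr_of_dist_le φ hr hr1 (mul_pos two_pos hρ.pos) hρ.le_power
      (hpos.trans_le (norm_sub_le_dist_toPlane _ _)) dist_le
      (sum_dist_toPlane_rpow_le hr hα senders_sum_lt)

end Delivery

/-! ### Passing a message to a neighbour -/

section Selection

variable {k : ℕ} {A : Finset (Fin k)} {m : Fin k}

lemma volume_selects_ge (hm : m ∈ A) : ENNReal.ofReal (1 / k) ≤ volume {u : I | Selects u A m} := by
  let q := (A.filter (· < m)).card
  have q_lt : q < A.card :=
    Finset.card_lt_card (Finset.filter_ssubset.2 ⟨m, hm, lt_irrefl m⟩)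
  have card_pos : (0 : ℝ) < A.card := by exact_mod_cast (Nat.zero_le q).trans_lt q_lt
  have q_add_one_le : (q : ℝ) + 1 ≤ A.card := by exact_mod_cast q_lt
  let a : I := ⟨q / A.card, by positivity, by rw [div_le_one card_pos]; linarith⟩
  let b : I := ⟨(q + 1) / A.card, by positivity, by rwa [div_le_one card_pos]⟩
  have b_sub_a : (b : ℝ) - a = 1 / A.card := by simp only [a, b]; ring
  calc ENNReal.ofReal (1 / k) ≤ ENNReal.ofReal (b - a) := by
        rw [b_sub_a]
        gcongr
        simpa using A.card_le_univ
    _ = volume (Set.Ico a b) := (unitInterval.volume_Ico _ _).symm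
    _ ≤ volume {u : I | Selects u A m} := by
        refine measure_mono fun u ⟨hau, hub⟩ => ⟨hm, ?_⟩
        rw [Nat.floor_eq_iff (mul_nonneg u.2.1 card_pos.le)]
        exact ⟨(div_le_iff₀ card_pos).1 hau, (lt_div_iff₀ card_pos).1 hub⟩

lemma measurableSet_selects (A : Finset (Fin k)) (m : Fin k) :
    MeasurableSet {u : I | Selects u A m} := by
  have : Measurable fun u : I => ⌊(u : ℝ) * (A.card : ℝ)⌋₊ :=
    Nat.measurable_floor.comp (by fun_prop)
  exact (MeasurableSet.const (m ∈ A)).inter (this (measurableSet_singleton _))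

end Selection

section Near

/-- Points of the unit interval at distance at most `ε` from `u`, other than `u`. The point `u`
itself is excluded because the SINR at distance `0` is a junk value. -/
def near (ε : ℝ) (u : I) : Set I := {u' | 0 < |(u' : ℝ) - u| ∧ |(u' : ℝ) - u| ≤ ε}

lemma volume_near_ge {ε : ℝ} (h0 : 0 < ε) (h1 : ε ≤ 1 / 2) (u : I) :
    ENNReal.ofReal ε ≤ volume (near ε u) := by
  have hu0 := u.2.1
  have hu1 := u.2.2
  obtain hu | hu := le_or_gt (u : ℝ) (1 / 2)
  · let b : I := ⟨u + ε, by linarith, by linarith⟩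
    calc ENNReal.ofReal ε = volume (Set.Ioc u b) := by
          rw [unitInterval.volume_Ioc, show (b : ℝ) = u + ε from rfl, add_sub_cancel_left]
      _ ≤ volume (near ε u) := by
        refine measure_mono fun v ⟨(huv : (u : ℝ) < v), (hvb : (v : ℝ) ≤ u + ε)⟩ => ?_
        rw [near, Set.mem_ofPred_eq, abs_of_pos (sub_pos.2 huv)]
        constructor <;> linarith
  · let b : I := ⟨u - ε, by linarith, by linarith⟩
    calc ENNReal.ofReal ε = volume (Set.Ico b u) := by
          rw [unitInterval.volume_Ico, show (b : ℝ) = u - ε from rfl, sub_sub_cancel]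
      _ ≤ volume (near ε u) := by
        refine measure_mono fun v ⟨(hbv : (u : ℝ) - ε ≤ v), (hvu : (v : ℝ) < u)⟩ => ?_
        rw [near, Set.mem_ofPred_eq, abs_of_neg (sub_neg.2 hvu)]
        constructor <;> linarith

end Near

section Hit

variable {n k : ℕ}

/-- The set of seeds with which a user of the subsquare `c'` stays there, at an offset close to `o`,
and pushes message `m` out of its set `A` of messages. -/
def aim (φ : Phy) (s : ℕ) (c' : ℤ × ℤ) (ε : ℝ) (A : Finset (Fin k)) (m : Fin k) (o : I × I) :
    Set SlotSeed :=
  {ξ | move s c' ξ.1 = c' ∧ ξ.2.1.1 ∈ near ε o.1 ∧ ξ.2.1.2 ∈ near ε o.2 ∧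
    (ξ.2.2.1 : ℝ) < φ.θ ∧ Selects ξ.2.2.2 A m}

/-- The set of seeds with which a user of subsquare `c` moves to `c'` and becomes a potential
receiver. -/
def land (φ : Phy) (s : ℕ) (c c' : ℤ × ℤ) : Set SlotSeed :=
  {ξ | move s c ξ.1 = c' ∧ φ.θ ≤ (ξ.2.2.1 : ℝ)}

/-- User `j` moves next to user `i` and is a potential receiver, and `i` is designated as a sender,
of message `m`. -/
def meet (φ : Phy) (s : ℕ) (c : Fin n → ℤ × ℤ) (A : Fin n → Finset (Fin k)) (m : Fin k) (ε : ℝ)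
    (i j : Fin n) : Set (Fin n → SlotSeed) :=
  {ξ | ξ j ∈ land φ s (c j) (c i) ∧ ξ i ∈ aim φ s (c i) ε (A i) m (ξ j).2.1}

/-- Total weight around user `j` of the users other than `i` and `j`. -/
def crowd (α : ℝ) (s : ℕ) (c : Fin n → ℤ × ℤ) (r : ℝ) (i j : Fin n) (ξ : Fin n → SlotSeed) : ℝ :=
  ∑ l ∈ (Finset.univ.erase j).erase i, (r + ‖place s (c l) (ξ l) - place s (c j) (ξ j)‖) ^ (-α)

/-- User `i` meets user `j` in a place that is not crowded. -/
def hit (φ : Phy) (s : ℕ) (c : Fin n → ℤ × ℤ) (A : Fin n → Finset (Fin k)) (m : Fin k) (ρ r : ℝ)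
    (i j : Fin n) : Set (Fin n → SlotSeed) :=
  meet φ s c A m (ρ * r * s) i j ∩ {ξ | crowd φ.α s c r i j ξ < (2 * r) ^ (-φ.α)}

lemma slotLaw_prod (D : Set (Fin 3 × Fin 3)) (O : Set (I × I)) (U V : Set I) :
    slotLaw (D ×ˢ (O ×ˢ (U ×ˢ V))) = moveLaw D * (volume O * (volume U * volume V)) := by
  simp only [slotLaw_eq_prod, Measure.volume_eq_prod, Measure.prod_prod]

lemma move_one (s : ℕ) (c : ℤ × ℤ) : move s c (1, 1) = c := by
  simp [move]

lemma exists_move_eq {s : ℕ} {c c' : ℤ × ℤ} (hc' : c' ∈ grid s) (h1 : |c'.1 - c.1| ≤ 1)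
    (h2 : |c'.2 - c.2| ≤ 1) : ∃ d, move s c d = c' := by
  rw [abs_le] at h1 h2
  refine ⟨(⟨(c'.1 - c.1 + 1).toNat, by omega⟩, ⟨(c'.2 - c.2 + 1).toNat, by omega⟩), ?_⟩
  have fst_eq : c.1 + (((c'.1 - c.1 + 1).toNat : ℕ) : ℤ) - 1 = c'.1 := by omega
  have snd_eq : c.2 + (((c'.2 - c.2 + 1).toNat : ℕ) : ℤ) - 1 = c'.2 := by omega
  unfold move
  dsimp only
  rw [fst_eq, snd_eq, if_pos (mem_grid.1 hc')]

lemma slotLaw_land_ge (φ : Phy) {s : ℕ} {c c' : ℤ × ℤ} (hc' : c' ∈ grid s)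
    (h1 : |c'.1 - c.1| ≤ 1) (h2 : |c'.2 - c.2| ≤ 1) :
    ENNReal.ofReal (1 / 18) ≤ slotLaw (land φ s c c') := by
  obtain ⟨d, rfl⟩ := exists_move_eq hc' h1 h2
  have subset : ({d} : Set (Fin 3 × Fin 3)) ×ˢ ((Set.univ : Set (I × I)) ×ˢ
      ({u : I | φ.θ ≤ u} ×ˢ (Set.univ : Set I))) ⊆ land φ s c (move s c d) := by
    rintro ξ ⟨rfl, -, hcoin, -⟩
    exact ⟨rfl, hcoin⟩
  refine le_trans ?_ (measure_mono subset)
  have nine_inv : (9⁻¹ : ℝ≥0∞) = ENNReal.ofReal (1 / 9) := by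
    rw [one_div, ENNReal.ofReal_inv_of_pos (by norm_num), ENNReal.ofReal_ofNat]
  rw [slotLaw_prod, moveLaw_singleton, volume_coin_ge, measure_univ, measure_univ, one_mul, mul_one,
    nine_inv, ← ENNReal.ofReal_mul (by norm_num)]
  apply ENNReal.ofReal_le_ofReal
  linarith [φ.θ_lt_half]

lemma slotLaw_aim_ge (φ : Phy) (s : ℕ) (c' : ℤ × ℤ) {ε : ℝ} (h0 : 0 < ε)
    (h1 : ε ≤ 1 / 2) {A : Finset (Fin k)} {m : Fin k} (hm : m ∈ A) (o : I × I) :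
    ENNReal.ofReal (ε ^ 2 * φ.θ / (9 * k)) ≤ slotLaw (aim φ s c' ε A m o) := by
  have subset : ({(1, 1)} : Set (Fin 3 × Fin 3)) ×ˢ ((near ε o.1 ×ˢ near ε o.2) ×ˢ
      ({u : I | (u : ℝ) < φ.θ} ×ˢ {u : I | Selects u A m})) ⊆ aim φ s c' ε A m o := by
    rintro ⟨d, ξ⟩ ⟨rfl, ⟨hfst, hsnd⟩, hcoin, hpick⟩
    exact ⟨move_one s c', hfst, hsnd, hcoin, hpick⟩
  calc ENNReal.ofReal (ε ^ 2 * φ.θ / (9 * k))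
      = ENNReal.ofReal 9⁻¹ * ((ENNReal.ofReal ε * ENNReal.ofReal ε) *
          (ENNReal.ofReal φ.θ * ENNReal.ofReal (1 / k))) := by
        rw [← ENNReal.ofReal_mul h0.le, ← ENNReal.ofReal_mul φ.θ_pos.le,
          ← ENNReal.ofReal_mul (by positivity), ← ENNReal.ofReal_mul (by positivity)]
        congr 1
        ring
    _ ≤ 9⁻¹ * ((volume (near ε o.1) * volume (near ε o.2)) *
          (ENNReal.ofReal φ.θ * volume {u : I | Selects u A m})) := by
        rw [ENNReal.ofReal_inv_of_pos (by norm_num), ENNReal.ofReal_ofNat]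
        gcongr
        · exact volume_near_ge h0 h1 _
        · exact volume_near_ge h0 h1 _
        · exact volume_selects_ge hm
    _ ≤ slotLaw (aim φ s c' ε A m o) := by
        rw [← volume_coin_lt, ← moveLaw_singleton (1, 1), ← Measure.prod_prod,
          ← Measure.volume_eq_prod, ← slotLaw_prod]
        exact measure_mono subset

lemma measurableSet_land (φ : Phy) (s : ℕ) (c c' : ℤ × ℤ) : MeasurableSet (land φ s c c') :=
  (measurable_fst (measurable_of_countable (move s c) (measurableSet_singleton c'))).inter
    (measurableSet_le measurable_const
      (by fun_prop : Measurable fun ξ : SlotSeed => (ξ.2.2.1 : ℝ)))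

lemma measurableSet_aim (φ : Phy) (s : ℕ) (c' : ℤ × ℤ) (ε : ℝ) (A : Finset (Fin k))
    (m : Fin k) : MeasurableSet {p : (I × I) × SlotSeed | p.2 ∈ aim φ s c' ε A m p.1} := by
  have measurableSet_near {f g : (I × I) × SlotSeed → I} (hf : Measurable f) (hg : Measurable g) :
      MeasurableSet {p | f p ∈ near ε (g p)} := by
    have measurable_dist : Measurable fun p => |(f p : ℝ) - g p| :=
      measurable_norm.comp (by fun_prop : Measurable fun p => (f p : ℝ) - g p)
    exact (measurableSet_lt measurable_const measurable_dist).inter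
      (measurableSet_le measurable_dist measurable_const)
  have measurableSet_stay : MeasurableSet {p : (I × I) × SlotSeed | move s c' p.2.1 = c'} :=
    (by fun_prop : Measurable fun p : (I × I) × SlotSeed => p.2.1)
      (measurable_of_countable (move s c') (measurableSet_singleton c'))
  exact measurableSet_stay.inter <| (measurableSet_near (by fun_prop) (by fun_prop)).inter <|
    (measurableSet_near (by fun_prop) (by fun_prop)).inter <|
    (measurableSet_lt (by fun_prop : Measurable fun p : (I × I) × SlotSeed => (p.2.2.2.1 : ℝ))
      measurable_const).inter <|
    (by fun_prop : Measurable fun p : (I × I) × SlotSeed => p.2.2.2.2) (measurableSet_selects A m)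

variable (φ : Phy) (s : ℕ) (c : Fin n → ℤ × ℤ) (A : Fin n → Finset (Fin k)) (m : Fin k)

lemma measurableSet_meet (ε : ℝ) (i j : Fin n) : MeasurableSet (meet φ s c A m ε i j) :=
  (measurable_pi_apply (X := fun _ : Fin n => SlotSeed) j
    (measurableSet_land φ s (c j) (c i))).inter
  ((by fun_prop : Measurable fun ξ : Fin n → SlotSeed => ((ξ j).2.1, ξ i))
    (measurableSet_aim φ s (c i) ε (A i) m))

lemma measurable_kernel_place (α r : ℝ) (l j : Fin n) :
    Measurable fun p : SlotSeed × SlotSeed =>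
      (r + ‖place s (c l) p.1 - place s (c j) p.2‖) ^ (-α) := by
  have := measurable_place s (c l)
  have := measurable_place s (c j)
  fun_prop

lemma measurable_crowd (α r : ℝ) (i j : Fin n) : Measurable (crowd α s c r i j) :=
  Finset.measurable_sum _ fun l _ =>
    (measurable_kernel_place s c α r l j).comp (g := fun p : SlotSeed × SlotSeed => _)
      (f := fun ξ : Fin n → SlotSeed => (ξ l, ξ j)) (by fun_prop)

lemma measurableSet_hit (ρ r : ℝ) (i j : Fin n) : MeasurableSet (hit φ s c A m ρ r i j) :=
  (measurableSet_meet φ s c A m _ i j).inter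
    (measurableSet_lt (measurable_crowd s c φ.α r i j) measurable_const)

variable {φ s c A m}

lemma slotsLaw_meet_ge {ε : ℝ} (h0 : 0 < ε) (h1 : ε ≤ 1 / 2) {i j : Fin n} (hij : i ≠ j)
    (hci : c i ∈ grid s) (hc1 : |(c i).1 - (c j).1| ≤ 1) (hc2 : |(c i).2 - (c j).2| ≤ 1)
    (hm : m ∈ A i) :
    ENNReal.ofReal (ε ^ 2 * φ.θ / (162 * k)) ≤ slotsLaw n (meet φ s c A m ε i j) := by
  have hθ := φ.θ_pos
  calc ENNReal.ofReal (ε ^ 2 * φ.θ / (162 * k))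
      = ENNReal.ofReal (ε ^ 2 * φ.θ / (9 * k)) * ENNReal.ofReal (1 / 18) := by
        rw [← ENNReal.ofReal_mul (by positivity)]
        congr 1
        ring
    _ ≤ ENNReal.ofReal (ε ^ 2 * φ.θ / (9 * k)) * slotLaw (land φ s (c j) (c i)) := by
        gcongr
        exact slotLaw_land_ge φ hci hc1 hc2
    _ ≤ slotsLaw n (meet φ s c A m ε i j) :=
        mul_le_pi_of_forall_le (fun _ : Fin n => slotLaw) hij.symm (measurableSet_land φ s _ _)
          (F := fun ξ => aim φ s (c i) ε (A i) m ξ.2.1)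
          ((by fun_prop : Measurable fun p : SlotSeed × SlotSeed => (p.1.2.1, p.2))
            (measurableSet_aim φ s (c i) ε (A i) m))
          fun ξ _ => slotLaw_aim_ge φ s (c i) h0 h1 hm ξ.2.1

lemma setLIntegral_meet_kernel_eq {α r ε : ℝ} {i j l : Fin n} (hli : l ≠ i) (hlj : l ≠ j) :
    ∫⁻ ξ in meet φ s c A m ε i j,
        ENNReal.ofReal ((r + ‖place s (c l) (ξ l) - place s (c j) (ξ j)‖) ^ (-α)) ∂slotsLaw n =
      ∫⁻ ξ in meet φ s c A m ε i j, ∫⁻ ξ', ENNReal.ofReal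
        ((r + ‖place s (c l) ξ' - place s (c j) (ξ j)‖) ^ (-α)) ∂slotLaw ∂slotsLaw n := by
  have measurable_kernel : Measurable fun ξ : Fin n → SlotSeed =>
      ENNReal.ofReal ((r + ‖place s (c l) (ξ l) - place s (c j) (ξ j)‖) ^ (-α)) :=
    (measurable_kernel_place s c α r l j).ennreal_ofReal.comp
      (f := fun ξ : Fin n → SlotSeed => (ξ l, ξ j)) (by fun_prop)
  rw [slotsLaw, setLIntegral_pi_update _ l (measurableSet_meet φ s c A m ε i j) ?_
    measurable_kernel]
  · simp only [Function.update_self, Function.update_of_ne hlj.symm]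
  · intro ξ ξ'
    simp only [meet, Set.mem_ofPred_eq, Function.update_of_ne hli.symm,
      Function.update_of_ne hlj.symm]

lemma setLIntegral_meet_crowd_le (hs : 1 ≤ s) (hc : ∀ l, c l ∈ grid s) {M : ℝ}
    (hM : ∀ c' ∈ grid s, (occupancy c c' : ℝ) ≤ M) {α r : ℝ} (hr : 0 < r) (ε : ℝ) (i j : Fin n) :
    ∫⁻ ξ in meet φ s c A m ε i j, ENNReal.ofReal (crowd α s c r i j ξ) ∂slotsLaw n ≤
      slotsLaw n (meet φ s c A m ε i j) *
        (ENNReal.ofReal M * (ENNReal.ofReal ((s : ℝ) ^ 2 * r ^ (2 - α)) * kernelMass α)) := by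
  let W := ENNReal.ofReal M * (ENNReal.ofReal ((s : ℝ) ^ 2 * r ^ (2 - α)) * kernelMass α)
  have measurable_kernel (l : Fin n) : Measurable fun p : SlotSeed × SlotSeed =>
      ENNReal.ofReal ((r + ‖place s (c l) p.1 - place s (c j) p.2‖) ^ (-α)) :=
    (measurable_kernel_place s c α r l j).ennreal_ofReal
  have measurable_kernel_apply (l : Fin n) (_ : l ∈ (Finset.univ.erase j).erase i) :
      Measurable fun ξ : Fin n → SlotSeed =>
        ENNReal.ofReal ((r + ‖place s (c l) (ξ l) - place s (c j) (ξ j)‖) ^ (-α)) :=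
    (measurable_kernel l).comp (f := fun ξ : Fin n → SlotSeed => (ξ l, ξ j)) (by fun_prop)
  let K (l : Fin n) (ξ : Fin n → SlotSeed) : ℝ≥0∞ :=
    ∫⁻ ξ', ENNReal.ofReal ((r + ‖place s (c l) ξ' - place s (c j) (ξ j)‖) ^ (-α)) ∂slotLaw
  have measurable_K (l : Fin n) : Measurable (K l) :=
    (measurable_kernel l).lintegral_prod_left'.comp (measurable_pi_apply j)
  calc ∫⁻ ξ in meet φ s c A m ε i j, ENNReal.ofReal (crowd α s c r i j ξ) ∂slotsLaw n
      = ∑ l ∈ (Finset.univ.erase j).erase i, ∫⁻ ξ in meet φ s c A m ε i j,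
          ENNReal.ofReal ((r + ‖place s (c l) (ξ l) - place s (c j) (ξ j)‖) ^ (-α))
            ∂slotsLaw n := by
        rw [← lintegral_finsetSum _ measurable_kernel_apply]
        exact lintegral_congr fun _ => ENNReal.ofReal_sum_of_nonneg fun l _ => by positivity
    _ = ∑ l ∈ (Finset.univ.erase j).erase i, ∫⁻ ξ in meet φ s c A m ε i j, K l ξ ∂slotsLaw n := by
        refine Finset.sum_congr rfl fun l hl => setLIntegral_meet_kernel_eq ?_ ?_
        · exact Finset.ne_of_mem_erase hl
        · exact Finset.ne_of_mem_erase (Finset.mem_of_mem_erase hl)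
    _ = ∫⁻ ξ in meet φ s c A m ε i j, ∑ l ∈ (Finset.univ.erase j).erase i, K l ξ ∂slotsLaw n :=
        (lintegral_finsetSum _ fun l _ => measurable_K l).symm
    _ ≤ ∫⁻ _ in meet φ s c A m ε i j, W ∂slotsLaw n := by
        refine lintegral_mono fun ξ => ?_
        exact (Finset.sum_le_univ_sum_of_nonneg fun _ => zero_le).trans
          (sum_lintegral_kernel_place_le hs hc hM hr (place s (c j) (ξ j)))
    _ = slotsLaw n (meet φ s c A m ε i j) * W := by
        rw [setLIntegral_const, mul_comm]

lemma slotsLaw_meet_le_two_mul_hit (hs : 1 ≤ s) (hc : ∀ l, c l ∈ grid s) {M : ℝ} (hM0 : 0 ≤ M)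
    (hM : ∀ c' ∈ grid s, (occupancy c c' : ℝ) ≤ M) {ρ r : ℝ} (hr : 0 < r)
    (hMr : M * ((s : ℝ) ^ 2 * r ^ (2 - φ.α) * (kernelMass φ.α).toReal) ≤ (2 * r) ^ (-φ.α) / 2)
    (i j : Fin n) :
    slotsLaw n (meet φ s c A m (ρ * r * s) i j) ≤ 2 * slotsLaw n (hit φ s c A m ρ r i j) := by
  have hT : 0 < (2 * r) ^ (-φ.α) := by positivity
  have hit_eq : hit φ s c A m ρ r i j = meet φ s c A m (ρ * r * s) i j ∩
      {ξ | ENNReal.ofReal (crowd φ.α s c r i j ξ) < ENNReal.ofReal ((2 * r) ^ (-φ.α))} := by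
    simp only [hit, ENNReal.ofReal_lt_ofReal_iff hT]
  rw [hit_eq]
  refine measure_le_two_mul_inter_lt (measurable_crowd s c φ.α r i j).ennreal_ofReal
    (ENNReal.ofReal_pos.2 hT).ne' ENNReal.ofReal_ne_top ?_
  refine (setLIntegral_meet_crowd_le hs hc hM hr _ i j).trans ?_
  gcongr
  calc ENNReal.ofReal M * (ENNReal.ofReal ((s : ℝ) ^ 2 * r ^ (2 - φ.α)) * kernelMass φ.α)
      = ENNReal.ofReal (M * ((s : ℝ) ^ 2 * r ^ (2 - φ.α) * (kernelMass φ.α).toReal)) := by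
        rw [ENNReal.ofReal_mul hM0,
          ENNReal.ofReal_mul (p := (s : ℝ) ^ 2 * r ^ (2 - φ.α)) (by positivity),
          ENNReal.ofReal_toReal (kernelMass_lt_top φ.two_lt_α).ne]
    _ ≤ ENNReal.ofReal ((2 * r) ^ (-φ.α) / 2) := ENNReal.ofReal_le_ofReal hMr
    _ = ENNReal.ofReal ((2 * r) ^ (-φ.α)) / 2 := by
        rw [ENNReal.ofReal_div_of_pos two_pos, ENNReal.ofReal_ofNat]

end Hit

/-! ### Isoperimetry in the grid -/

section Isoperimetry

/-- The relation of being the same or neighbouring subsquares. -/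
abbrev Touch (p q : ℤ × ℤ) : Prop := |p.1 - q.1| ≤ 1 ∧ |p.2 - q.2| ≤ 1

/-- The number of `R`-related pairs that a fuzzy subset `f` of `J` separates: for the indicator
function of a set, the pairs that leave the set. -/
def cut {ι : Type*} (J : Finset ι) (R : ι → ι → Prop) [DecidableRel R] (f : ι → ℝ) : ℝ :=
  ∑ u ∈ J, ∑ v ∈ J, if R u v then f u * (1 - f v) else 0

lemma mul_one_sub_le_add {a b c : ℝ} (ha : a ∈ Set.Icc 0 1) (hb : b ∈ Set.Icc 0 1)
    (hc : c ∈ Set.Icc 0 1) : a * (1 - c) ≤ a * (1 - b) + b * (1 - c) := by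
  nlinarith [mul_nonneg (mul_nonneg hb.1 (sub_nonneg.2 ha.2)) (sub_nonneg.2 hc.2),
    mul_nonneg (mul_nonneg ha.1 hc.1) (sub_nonneg.2 hb.2)]

lemma mul_one_sub_le_sum_range {f : ℕ → ℝ} (hf : ∀ i, f i ∈ Set.Icc 0 1) (d : ℕ) :
    f 0 * (1 - f (d + 1)) ≤ ∑ i ∈ Finset.range (d + 1), f i * (1 - f (i + 1)) := by
  induction d with
  | zero => simp
  | succ d ih =>
    rw [Finset.sum_range_succ]
    linarith [mul_one_sub_le_add (hf 0) (hf (d + 1)) (hf (d + 2))]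

lemma ite_mul_one_sub_nonneg {a b : ℝ} (ha : a ∈ Set.Icc 0 1) (hb : b ∈ Set.Icc 0 1)
    (P : Prop) [Decidable P] : 0 ≤ if P then a * (1 - b) else 0 := by
  split_ifs
  exacts [mul_nonneg ha.1 (sub_nonneg.2 hb.2), le_rfl]

lemma mul_one_sub_le_cut {f : ℤ → ℝ} (hf : ∀ x, f x ∈ Set.Icc 0 1) {s : ℕ} {x y : ℤ}
    (hx : x ∈ Finset.Ico 0 (s : ℤ)) (hy : y ∈ Finset.Ico 0 (s : ℤ)) :
    f x * (1 - f y) ≤ cut (Finset.Ico 0 (s : ℤ)) (fun u v => |u - v| ≤ 1) f := by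
  let J := Finset.Ico 0 (s : ℤ)
  let g (u : ℤ) : ℝ := ∑ v ∈ J, if |u - v| ≤ 1 then f u * (1 - f v) else 0
  have g_nonneg (u : ℤ) : 0 ≤ g u :=
    Finset.sum_nonneg fun v _ => ite_mul_one_sub_nonneg (hf u) (hf v) _
  have le_g {u v : ℤ} (hv : v ∈ J) (huv : |u - v| ≤ 1) : f u * (1 - f v) ≤ g u := by
    have := Finset.single_le_sum (fun v _ => ite_mul_one_sub_nonneg (hf u) (hf v) (|u - v| ≤ 1)) hv
    rwa [if_pos huv] at this
  change _ ≤ ∑ u ∈ J, g u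
  obtain rfl | hxy := eq_or_ne x y
  · exact (le_g hx (by simp)).trans (Finset.single_le_sum (fun u _ => g_nonneg u) hx)
  obtain ⟨ε, hε, d, rfl⟩ : ∃ ε : ℤ, |ε| = 1 ∧ ∃ d : ℕ, y = x + ε * (d + 1 : ℕ) := by
    obtain h | h := hxy.lt_or_gt
    · exact ⟨1, by simp, (y - x - 1).toNat, by omega⟩
    · exact ⟨-1, by simp, (x - y - 1).toNat, by omega⟩
  have path_mem {i : ℕ} (hi : i ≤ d + 1) : x + ε * i ∈ J := by
    simp only [J, Finset.mem_Ico] at hx hy ⊢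
    obtain rfl | rfl := (abs_eq one_pos.le).1 hε <;> omega
  have path_injective : Function.Injective fun i : ℕ => x + ε * i := by
    intro i j hij
    obtain rfl | rfl := (abs_eq one_pos.le).1 hε <;> simpa using hij
  calc f x * (1 - f (x + ε * (d + 1 : ℕ)))
      ≤ ∑ i ∈ Finset.range (d + 1), f (x + ε * i) * (1 - f (x + ε * (i + 1 : ℕ))) := by
        simpa using mul_one_sub_le_sum_range (f := fun i : ℕ => f (x + ε * i)) (fun i => hf _) d
    _ ≤ ∑ i ∈ Finset.range (d + 1), g (x + ε * i) := by
        refine Finset.sum_le_sum fun i hi => le_g (path_mem (Finset.mem_range.1 hi)) ?_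
        rw [show x + ε * i - (x + ε * (i + 1 : ℕ)) = -ε by push_cast; ring, abs_neg, hε]
    _ = ∑ u ∈ (Finset.range (d + 1)).image fun i : ℕ => x + ε * i, g u :=
        (Finset.sum_image path_injective.injOn).symm
    _ ≤ ∑ u ∈ J, g u := by
        refine Finset.sum_le_sum_of_subset_of_nonneg ?_ fun u _ _ => g_nonneg u
        exact Finset.image_subset_iff.2 fun i hi => path_mem (Finset.mem_range.1 hi).le

lemma sum_grid {M : Type*} [AddCommMonoid M] (s : ℕ) (f : ℤ × ℤ → M) :
    ∑ p ∈ grid s, f p = ∑ x ∈ Finset.Ico 0 (s : ℤ), ∑ y ∈ Finset.Ico 0 (s : ℤ), f (x, y) :=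
  Finset.sum_product _ _ _

variable {F : ℤ × ℤ → ℝ}

lemma sum_cut_rows_le (hF : ∀ p, F p ∈ Set.Icc 0 1) (s : ℕ) :
    ∑ y ∈ Finset.Ico 0 (s : ℤ),
        cut (Finset.Ico 0 (s : ℤ)) (fun u v => |u - v| ≤ 1) (fun x => F (x, y)) ≤
      cut (grid s) Touch F := by
  simp only [cut, sum_grid]
  rw [Finset.sum_comm]
  refine Finset.sum_le_sum fun x _ => Finset.sum_le_sum fun y hy =>
    Finset.sum_le_sum fun x' _ => ?_
  have := Finset.single_le_sum
    (fun y' _ => ite_mul_one_sub_nonneg (hF (x, y)) (hF (x', y')) (Touch (x, y) (x', y'))) hy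
  simpa [Touch] using this

lemma sum_cut_columns_le (hF : ∀ p, F p ∈ Set.Icc 0 1) (s : ℕ) :
    ∑ x ∈ Finset.Ico 0 (s : ℤ),
        cut (Finset.Ico 0 (s : ℤ)) (fun u v => |u - v| ≤ 1) (fun y => F (x, y)) ≤
      cut (grid s) Touch F := by
  simp only [cut, sum_grid]
  refine Finset.sum_le_sum fun x hx => Finset.sum_le_sum fun y _ => ?_
  have := Finset.single_le_sum (fun x' _ =>
    Finset.sum_nonneg fun y' (_ : y' ∈ Finset.Ico 0 (s : ℤ)) =>
      ite_mul_one_sub_nonneg (hF (x, y)) (hF (x', y')) (Touch (x, y) (x', y'))) hx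
  simpa [Touch] using this

-- Each pair of subsquares is joined by an L-shaped path, and no edge lies on more than `s ^ 3` of
-- these paths.
lemma sum_mul_one_sub_le_cut (hF : ∀ p, F p ∈ Set.Icc 0 1) (s : ℕ) :
    ∑ p ∈ grid s, ∑ q ∈ grid s, F p * (1 - F q) ≤ 2 * (s : ℝ) ^ 3 * cut (grid s) Touch F := by
  let J := Finset.Ico 0 (s : ℤ)
  let row (y : ℤ) : ℝ := cut J (fun u v => |u - v| ≤ 1) fun x => F (x, y)
  let column (x : ℤ) : ℝ := cut J (fun u v => |u - v| ≤ 1) fun y => F (x, y)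
  calc ∑ p ∈ grid s, ∑ q ∈ grid s, F p * (1 - F q)
      = ∑ x ∈ J, ∑ y ∈ J, ∑ x' ∈ J, ∑ y' ∈ J, F (x, y) * (1 - F (x', y')) := by
        simp only [sum_grid, J]
    _ ≤ ∑ _ ∈ J, ∑ y ∈ J, ∑ x' ∈ J, ∑ _ ∈ J, (row y + column x') := by
        refine Finset.sum_le_sum fun x hx => Finset.sum_le_sum fun y hy =>
          Finset.sum_le_sum fun x' hx' => Finset.sum_le_sum fun y' hy' => ?_
        exact (mul_one_sub_le_add (hF (x, y)) (hF (x', y)) (hF (x', y'))).trans <| add_le_add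
          (mul_one_sub_le_cut (f := fun u => F (u, y)) (fun _ => hF _) hx hx')
          (mul_one_sub_le_cut (f := fun u => F (x', u)) (fun _ => hF _) hy hy')
    _ = (s : ℝ) ^ 3 * (∑ y ∈ J, row y + ∑ x ∈ J, column x) := by
        simp only [Finset.sum_add_distrib, Finset.sum_const, nsmul_eq_mul, ← Finset.mul_sum, J,
          Int.card_Ico, sub_zero, Int.toNat_natCast]
        ring
    _ ≤ (s : ℝ) ^ 3 * (cut (grid s) Touch F + cut (grid s) Touch F) := by
        gcongr
        exacts [sum_cut_rows_le hF s, sum_cut_columns_le hF s]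
    _ = 2 * (s : ℝ) ^ 3 * cut (grid s) Touch F := by ring

/-- The proportion `a / (a + b)` of informed users in a place with `a` informed and `b` uninformed
users. -/
def density (a b : ℝ) : ℝ := a / (a + b)

lemma density_mem_Icc {a b : ℝ} (ha : 0 ≤ a) (hb : 0 ≤ b) : density a b ∈ Set.Icc 0 1 :=
  ⟨div_nonneg ha (add_nonneg ha hb),
    div_le_one_of_le₀ (le_add_of_nonneg_right hb) (add_nonneg ha hb)⟩

lemma mul_mem_Icc_density {a b a' b' m₀ m₁ : ℝ} (ha : 0 ≤ a) (hb' : 0 ≤ b') (hm₀ : 0 < m₀)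
    (h : a + b ∈ Set.Icc m₀ m₁) (h' : a' + b' ∈ Set.Icc m₀ m₁) :
    a * b' ∈ Set.Icc (m₀ ^ 2 * (density a b * (1 - density a' b')))
      (m₁ ^ 2 * (density a b * (1 - density a' b'))) := by
  have hpos : 0 < a + b := hm₀.trans_le h.1
  have hpos' : 0 < a' + b' := hm₀.trans_le h'.1
  have one_sub : 1 - density a' b' = b' / (a' + b') := by
    rw [density, one_sub_div hpos'.ne', add_sub_cancel_left]
  have mul_eq : a * b' = (a + b) * (a' + b') * (density a b * (1 - density a' b')) := by
    rw [one_sub, density]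
    field_simp
  have nonneg : 0 ≤ density a b * (1 - density a' b') := by
    rw [one_sub, density]
    positivity
  rw [mul_eq, sq, sq]
  exact ⟨mul_le_mul_of_nonneg_right (mul_le_mul h.1 h'.1 hm₀.le hpos.le) nonneg,
    mul_le_mul_of_nonneg_right (mul_le_mul h.2 h'.2 hpos'.le (hpos.le.trans h.2)) nonneg⟩

lemma sum_mul_le_sum_touch {s : ℕ} {a b : ℤ × ℤ → ℝ} (ha : ∀ p, 0 ≤ a p) (hb : ∀ p, 0 ≤ b p)
    {m₀ m₁ : ℝ} (hm₀ : 0 < m₀) (hm : ∀ p ∈ grid s, a p + b p ∈ Set.Icc m₀ m₁) :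
    ∑ p ∈ grid s, ∑ q ∈ grid s, a p * b q ≤ (m₁ / m₀) ^ 2 * (2 * (s : ℝ) ^ 3) *
      ∑ p ∈ grid s, ∑ q ∈ grid s, if Touch p q then a p * b q else 0 := by
  let F (p : ℤ × ℤ) : ℝ := density (a p) (b p)
  have hF (p : ℤ × ℤ) : F p ∈ Set.Icc 0 1 := density_mem_Icc (ha p) (hb p)
  have mul_mem {p q : ℤ × ℤ} (hp : p ∈ grid s) (hq : q ∈ grid s) :=
    mul_mem_Icc_density (ha p) (hb q) hm₀ (hm p hp) (hm q hq)
  calc ∑ p ∈ grid s, ∑ q ∈ grid s, a p * b q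
      ≤ m₁ ^ 2 * ∑ p ∈ grid s, ∑ q ∈ grid s, F p * (1 - F q) := by
        simp only [Finset.mul_sum]
        exact Finset.sum_le_sum fun p hp => Finset.sum_le_sum fun q hq => (mul_mem hp hq).2
    _ ≤ m₁ ^ 2 * (2 * (s : ℝ) ^ 3 * cut (grid s) Touch F) := by
        gcongr
        exact sum_mul_one_sub_le_cut hF s
    _ ≤ m₁ ^ 2 * (2 * (s : ℝ) ^ 3 * ((∑ p ∈ grid s, ∑ q ∈ grid s,
          if Touch p q then a p * b q else 0) / m₀ ^ 2)) := by
        gcongr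
        rw [le_div_iff₀' (by positivity), cut]
        simp only [Finset.mul_sum, mul_ite, mul_zero]
        gcongr with p hp q hq
        split_ifs
        exacts [(mul_mem hp hq).1, le_rfl]
    _ = _ := by ring

end Isoperimetry

section Contacts

variable {n s : ℕ} {c : Fin n → ℤ × ℤ}

/-- The pairs of a user of `S` and a user outside `S` that can meet after one move. -/
def contacts (c : Fin n → ℤ × ℤ) (S : Finset (Fin n)) : Finset (Fin n × Fin n) :=
  (S ×ˢ Sᶜ).filter fun p => Touch (c p.1) (c p.2)

lemma sum_comp_cell (hc : ∀ l, c l ∈ grid s) (S : Finset (Fin n)) (f : ℤ × ℤ → ℝ) :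
    ∑ i ∈ S, f (c i) = ∑ p ∈ grid s, ((S.filter (c · = p)).card : ℝ) * f p := by
  rw [← Finset.sum_fiberwise_of_maps_to (t := grid s) (g := c) fun l _ => hc l]
  refine Finset.sum_congr rfl fun p _ => ?_
  rw [← nsmul_eq_mul]
  exact Finset.sum_eq_card_nsmul fun i hi => by rw [(Finset.mem_filter.1 hi).2]

lemma card_eq_sum_card_cell (hc : ∀ l, c l ∈ grid s) (S : Finset (Fin n)) :
    (S.card : ℝ) = ∑ p ∈ grid s, ((S.filter (c · = p)).card : ℝ) := by
  simpa using sum_comp_cell hc S fun _ => 1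

lemma card_contacts (hc : ∀ l, c l ∈ grid s) (S : Finset (Fin n)) :
    ((contacts c S).card : ℝ) = ∑ p ∈ grid s, ∑ q ∈ grid s,
      if Touch p q then ((S.filter (c · = p)).card : ℝ) * (Sᶜ.filter (c · = q)).card else 0 := by
  calc ((contacts c S).card : ℝ) = ∑ i ∈ S, ∑ j ∈ Sᶜ, if Touch (c i) (c j) then (1 : ℝ) else 0 := by
        rw [contacts, Finset.card_filter, Finset.sum_product]
        push_cast
        rfl
    _ = ∑ p ∈ grid s, ((S.filter (c · = p)).card : ℝ) *
          ∑ j ∈ Sᶜ, if Touch p (c j) then (1 : ℝ) else 0 :=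
        sum_comp_cell hc S fun p => ∑ j ∈ Sᶜ, if Touch p (c j) then (1 : ℝ) else 0
    _ = _ := by
        refine Finset.sum_congr rfl fun p _ => ?_
        rw [sum_comp_cell hc Sᶜ fun q => if Touch p q then (1 : ℝ) else 0, Finset.mul_sum]
        refine Finset.sum_congr rfl fun q _ => ?_
        split_ifs <;> simp

lemma card_mul_card_compl_le (hc : ∀ l, c l ∈ grid s) (S : Finset (Fin n)) {m₀ m₁ : ℝ}
    (hm₀ : 0 < m₀) (hocc : ∀ p ∈ grid s, m₀ ≤ occupancy c p ∧ (occupancy c p : ℝ) ≤ m₁) :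
    (S.card : ℝ) * Sᶜ.card ≤ (m₁ / m₀) ^ 2 * (2 * (s : ℝ) ^ 3) * (contacts c S).card := by
  have card_add_card (p : ℤ × ℤ) :
      ((S.filter (c · = p)).card : ℝ) + (Sᶜ.filter (c · = p)).card = occupancy c p := by
    rw [occupancy, ← Nat.cast_add, ← Finset.card_union_of_disjoint
      (Finset.disjoint_filter_filter disjoint_compl_right), ← Finset.filter_union,
      Finset.union_compl]
  rw [card_eq_sum_card_cell hc S, card_eq_sum_card_cell hc Sᶜ, Finset.sum_mul_sum,
    card_contacts hc S]
  refine sum_mul_le_sum_touch (fun _ => Nat.cast_nonneg _) (fun _ => Nat.cast_nonneg _) hm₀ ?_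
  simpa only [card_add_card, Set.mem_Icc] using hocc

lemma card_contacts_of_eq (hc : ∀ i j, c i = c j) (S : Finset (Fin n)) :
    (contacts c S).card = S.card * Sᶜ.card := by
  rw [contacts, Finset.filter_true_of_mem, Finset.card_product]
  intro p _
  simp [Touch, hc p.1 p.2]

end Contacts

/-! ### Contraction of the odds in one slot -/

section Slot

variable {n k : ℕ}

/-- Positions after a slot that starts with the users in the subsquares `c`. -/
def slotPos (s : ℕ) (c : Fin n → ℤ × ℤ) (ξ : Fin n → SlotSeed) (i : Fin n) : Plane :=
  toPlane (place s (c i) (ξ i))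

/-- Users designated as senders by the seeds `ξ`. -/
def slotSenders (φ : Phy) (ξ : Fin n → SlotSeed) : Finset (Fin n) :=
  Finset.univ.filter fun i => ((ξ i).2.2.1 : ℝ) < φ.θ

open Classical in
/-- Messages held after a slot by user `j`, when `A` are the messages held before and `B` those
injected during the slot. -/
def slotHolds (φ : Phy) (s : ℕ) (c : Fin n → ℤ × ℤ) (A B : Fin n → Finset (Fin k))
    (ξ : Fin n → SlotSeed) (j : Fin n) : Finset (Fin k) :=
  Finset.univ.filter fun m => m ∈ A j ∨ m ∈ B j ∨
    ∃ i, Delivers φ (slotPos s c ξ) (slotSenders φ ξ) i j ∧ Selects (ξ i).2.2.2 (A i) m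

/-- The users that possess message `m`. -/
def informed (A : Fin n → Finset (Fin k)) (m : Fin k) : Finset (Fin n) :=
  Finset.univ.filter fun i => m ∈ A i

variable {φ : Phy} {s : ℕ} {c : Fin n → ℤ × ℤ} {A B : Fin n → Finset (Fin k)} {m : Fin k}
  {ξ : Fin n → SlotSeed} {i j : Fin n}

lemma mem_slotSenders : i ∈ slotSenders φ ξ ↔ ((ξ i).2.2.1 : ℝ) < φ.θ := by
  simp [slotSenders]

lemma mem_slotHolds :
    m ∈ slotHolds φ s c A B ξ j ↔ m ∈ A j ∨ m ∈ B j ∨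
      ∃ i, Delivers φ (slotPos s c ξ) (slotSenders φ ξ) i j ∧ Selects (ξ i).2.2.2 (A i) m := by
  simp [slotHolds]

lemma mem_informed : i ∈ informed A m ↔ m ∈ A i := by
  simp [informed]

lemma mem_contacts {S : Finset (Fin n)} {p : Fin n × Fin n} :
    p ∈ contacts c S ↔ p.1 ∈ S ∧ p.2 ∉ S ∧ Touch (c p.1) (c p.2) := by
  simp [contacts, and_assoc]

end Slot

section Odds

/-- Ratio of uninformed to informed users when `a` of the `n` users are informed. This is the
potential that contracts in expectation. -/
def oddsAgainst (n a : ℕ) : ℝ := ((n : ℝ) - a) / a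

variable {n a b d : ℕ}

lemma oddsAgainst_nonneg (h : a ≤ n) : 0 ≤ oddsAgainst n a :=
  div_nonneg (sub_nonneg.2 (by exact_mod_cast h)) a.cast_nonneg

lemma oddsAgainst_anti (ha : 1 ≤ a) (hab : a ≤ b) : oddsAgainst n b ≤ oddsAgainst n a := by
  have hb : 1 ≤ b := ha.trans hab
  have oddsAgainst_eq {a : ℕ} (ha : 1 ≤ a) : oddsAgainst n a = n / a - 1 := by
    rw [oddsAgainst, sub_div, div_self (by positivity)]
  rw [oddsAgainst_eq ha, oddsAgainst_eq hb]
  gcongr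

lemma oddsAgainst_add_le (ha : 1 ≤ a) (hda : d ≤ a) (hb : a + d ≤ b) :
    oddsAgainst n b ≤ oddsAgainst n a - n / (2 * (a : ℝ) ^ 2) * d := by
  refine (oddsAgainst_anti (by omega) hb).trans ?_
  have hda' : (d : ℝ) ≤ a := by exact_mod_cast hda
  have difference_eq : oddsAgainst n a - n / (2 * (a : ℝ) ^ 2) * d - oddsAgainst n (a + d) =
      n * d * (a - d) / (2 * (a : ℝ) ^ 2 * (a + d)) := by
    unfold oddsAgainst
    push_cast
    field_simp
    ring
  rw [← sub_nonneg, difference_eq]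
  have := sub_nonneg.2 hda'
  positivity

lemma inv_le_oddsAgainst {a : ℕ} (ha : 1 ≤ a) (han : a < n) : (n : ℝ)⁻¹ ≤ oddsAgainst n a := by
  have ha' : (0 : ℝ) < a := by positivity
  have han' : (a : ℝ) + 1 ≤ n := by exact_mod_cast han
  rw [oddsAgainst, inv_eq_one_div, div_le_div_iff₀ (by linarith) ha']
  nlinarith

lemma oddsAgainst_le {a : ℕ} (ha : 1 ≤ a) : oddsAgainst n a ≤ n := by
  have ha' : (1 : ℝ) ≤ a := by exact_mod_cast ha
  rw [oddsAgainst, div_le_iff₀ (by linarith)]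
  nlinarith [n.cast_nonneg (α := ℝ)]

end Odds

section OneSlot

variable {n k : ℕ} {φ : Phy} {s : ℕ} {c : Fin n → ℤ × ℤ} {A : Fin n → Finset (Fin k)} {m : Fin k}
  {ρ r : ℝ} {i j : Fin n} {ξ : Fin n → SlotSeed}

lemma norm_place_sub_of_mem_meet {ε : ℝ} (hs : 1 ≤ s) (h : ξ ∈ meet φ s c A m ε i j) :
    0 < ‖place s (c i) (ξ i) - place s (c j) (ξ j)‖ ∧
      ‖place s (c i) (ξ i) - place s (c j) (ξ j)‖ ≤ ε / s := by
  have hs' : (0 : ℝ) < s := by positivity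
  obtain ⟨⟨hmove_j, -⟩, hmove_i, hfst, hsnd, -⟩ := h
  have place_sub : place s (c i) (ξ i) - place s (c j) (ξ j) =
      ((((ξ i).2.1.1 : ℝ) - (ξ j).2.1.1) / s, (((ξ i).2.1.2 : ℝ) - (ξ j).2.1.2) / s) := by
    simp only [place, hmove_i, hmove_j, Prod.mk_sub_mk]
    congr 1 <;> ring
  rw [place_sub, Prod.norm_def]
  dsimp only
  rw [Real.norm_eq_abs, Real.norm_eq_abs, abs_div, abs_div, abs_of_pos hs']
  exact ⟨lt_max_of_lt_left (div_pos hfst.1 hs'), max_le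
    (div_le_div_of_nonneg_right hfst.2 hs'.le) (div_le_div_of_nonneg_right hsnd.2 hs'.le)⟩

lemma norm_place_sub_of_mem_hit (hs : 1 ≤ s) (h : ξ ∈ hit φ s c A m ρ r i j) :
    0 < ‖place s (c i) (ξ i) - place s (c j) (ξ j)‖ ∧
      ‖place s (c i) (ξ i) - place s (c j) (ξ j)‖ ≤ ρ * r := by
  have := norm_place_sub_of_mem_meet hs h.1
  rwa [mul_div_cancel_right₀ _ (by positivity : (s : ℝ) ≠ 0)] at this

lemma delivers_of_mem_hit (hs : 1 ≤ s) (hr : 0 < r) (hr1 : r ≤ 1) (hρ : IsCloseRange φ ρ)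
    (h : ξ ∈ hit φ s c A m ρ r i j) :
    Delivers φ (slotPos s c ξ) (slotSenders φ ξ) i j ∧ Selects (ξ i).2.2.2 (A i) m := by
  have hnear := norm_place_sub_of_mem_hit hs h
  obtain ⟨⟨⟨-, hreceiver⟩, -, -, -, hsender, hselects⟩, hcrowd⟩ := h
  exact ⟨delivers_of_sum_kernel_lt (x := fun l => place s (c l) (ξ l))
    (mem_slotSenders.2 hsender) (fun h => absurd (mem_slotSenders.1 h) (not_lt.2 hreceiver)) hr hr1
    hρ hnear.1 hnear.2 hcrowd, hselects⟩

lemma lt_norm_place_sub_of_mem_hit (hr : 0 < r) (h : ξ ∈ hit φ s c A m ρ r i j) {l : Fin n}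
    (hli : l ≠ i) (hlj : l ≠ j) : r < ‖place s (c l) (ξ l) - place s (c j) (ξ j)‖ :=
  lt_norm_of_sum_kernel_lt (x := fun l => place s (c l) (ξ l)) hr (by linarith [φ.two_lt_α]) h.2
    (by simp [hli, hlj])

open Classical in
/-- The pairs of an informed and an uninformed user that hit one another. -/
def hits (φ : Phy) (s : ℕ) (c : Fin n → ℤ × ℤ) (A : Fin n → Finset (Fin k)) (m : Fin k) (ρ r : ℝ)
    (ξ : Fin n → SlotSeed) : Finset (Fin n × Fin n) :=
  (contacts c (informed A m)).filter fun p => ξ ∈ hit φ s c A m ρ r p.1 p.2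

lemma mem_hits {p : Fin n × Fin n} (h : p ∈ hits φ s c A m ρ r ξ) :
    p.1 ∈ informed A m ∧ p.2 ∉ informed A m ∧ ξ ∈ hit φ s c A m ρ r p.1 p.2 := by
  classical
  rw [hits, Finset.mem_filter, mem_contacts] at h
  exact ⟨h.1.1, h.1.2.1, h.2⟩

lemma injOn_fst_hits (hs : 1 ≤ s) (hr : 0 < r) (hρ : IsCloseRange φ ρ) :
    Set.InjOn Prod.fst (hits φ s c A m ρ r ξ : Set (Fin n × Fin n)) := by
  rintro ⟨i, j⟩ hj ⟨i', j'⟩ hj' (rfl : i = i')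
  obtain ⟨hi, -, hit_j⟩ := mem_hits hj
  obtain ⟨-, hj'S, hit_j'⟩ := mem_hits hj'
  by_contra hne
  have far := lt_norm_place_sub_of_mem_hit hr hit_j (l := j') (fun h => hj'S (h ▸ hi))
    fun h => hne (by rw [h])
  have close := (norm_place_sub_of_mem_hit hs hit_j).2
  have close' := (norm_place_sub_of_mem_hit hs hit_j').2
  rw [norm_sub_rev] at close'
  have triangle := norm_sub_le_norm_sub_add_norm_sub (place s (c j') (ξ j')) (place s (c i) (ξ i))
    (place s (c j) (ξ j))
  nlinarith [hρ.le_one_fourth]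

lemma injOn_snd_hits (hs : 1 ≤ s) (hr : 0 < r) (hρ : IsCloseRange φ ρ) :
    Set.InjOn Prod.snd (hits φ s c A m ρ r ξ : Set (Fin n × Fin n)) := by
  rintro ⟨i, j⟩ hi ⟨i', j'⟩ hi' (rfl : j = j')
  obtain ⟨-, hj, hit_i⟩ := mem_hits hi
  obtain ⟨hi'S, -, hit_i'⟩ := mem_hits hi'
  by_contra hne
  have far := lt_norm_place_sub_of_mem_hit hr hit_i (l := i') (fun h => hne (by rw [h]))
    fun h => hj (h ▸ hi'S)
  nlinarith [(norm_place_sub_of_mem_hit hs hit_i').2, hρ.le_one_fourth]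

lemma card_hits_le (hs : 1 ≤ s) (hr : 0 < r) (hρ : IsCloseRange φ ρ) :
    (hits φ s c A m ρ r ξ).card ≤ (informed A m).card :=
  Finset.card_le_card_of_injOn Prod.fst (fun _ hp => (mem_hits hp).1) (injOn_fst_hits hs hr hρ)

lemma card_informed_add_card_hits_le (hs : 1 ≤ s) (hr : 0 < r) (hr1 : r ≤ 1)
    (hρ : IsCloseRange φ ρ) (B : Fin n → Finset (Fin k)) :
    (informed A m).card + (hits φ s c A m ρ r ξ).card ≤
      (informed (slotHolds φ s c A B ξ) m).card := by
  rw [← Finset.card_image_of_injOn (injOn_snd_hits hs hr hρ), ← Finset.card_union_of_disjoint]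
  · refine Finset.card_le_card fun j hj => mem_informed.2 <| mem_slotHolds.2 ?_
    obtain hj | hj := Finset.mem_union.1 hj
    · exact Or.inl (mem_informed.1 hj)
    · obtain ⟨p, hp, rfl⟩ := Finset.mem_image.1 hj
      exact Or.inr <| Or.inr ⟨p.1, delivers_of_mem_hit hs hr hr1 hρ (mem_hits hp).2.2⟩
  · refine Finset.disjoint_left.2 fun j hj hj' => ?_
    obtain ⟨p, hp, rfl⟩ := Finset.mem_image.1 hj'
    exact (mem_hits hp).2.1 hj

lemma oddsAgainst_slotHolds_le (hs : 1 ≤ s) (hr : 0 < r) (hr1 : r ≤ 1) (hρ : IsCloseRange φ ρ)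
    (hne : (informed A m).Nonempty) (B : Fin n → Finset (Fin k)) :
    oddsAgainst n (informed (slotHolds φ s c A B ξ) m).card ≤ oddsAgainst n (informed A m).card -
      n / (2 * ((informed A m).card : ℝ) ^ 2) * (hits φ s c A m ρ r ξ).card :=
  oddsAgainst_add_le hne.card_pos (card_hits_le hs hr hρ)
    (card_informed_add_card_hits_le hs hr hr1 hρ B)

lemma natCast_card_hits (ξ : Fin n → SlotSeed) :
    ((hits φ s c A m ρ r ξ).card : ℝ≥0∞) =
      ∑ p ∈ contacts c (informed A m), (hit φ s c A m ρ r p.1 p.2).indicator 1 ξ := by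
  classical
  rw [hits, Finset.card_filter]
  push_cast
  rfl

lemma measurable_card_hits :
    Measurable fun ξ : Fin n → SlotSeed => ((hits φ s c A m ρ r ξ).card : ℝ≥0∞) := by
  simp only [natCast_card_hits]
  exact Finset.measurable_sum _ fun p _ =>
    measurable_one.indicator (measurableSet_hit φ s c A m ρ r p.1 p.2)

lemma mul_card_contacts_le_lintegral_card_hits {q : ℝ≥0∞}
    (hhit : ∀ p ∈ contacts c (informed A m), q ≤ slotsLaw n (hit φ s c A m ρ r p.1 p.2)) :
    q * (contacts c (informed A m)).card ≤ ∫⁻ ξ, (hits φ s c A m ρ r ξ).card ∂slotsLaw n := by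
  simp only [natCast_card_hits]
  rw [lintegral_finsetSum _ fun p _ =>
    measurable_one.indicator (measurableSet_hit φ s c A m ρ r p.1 p.2), mul_comm, ← nsmul_eq_mul]
  refine Finset.card_nsmul_le_sum _ _ _ fun p hp => ?_
  rw [lintegral_indicator_one (measurableSet_hit φ s c A m ρ r p.1 p.2)]
  exact hhit p hp

lemma lintegral_oddsAgainst_slotHolds_le_of_hit (hs : 1 ≤ s) (hr : 0 < r) (hr1 : r ≤ 1)
    (hρ : IsCloseRange φ ρ) (hne : (informed A m).Nonempty) (B : Fin n → Finset (Fin k)) {q : ℝ}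
    (hq : 0 ≤ q) (hhit : ∀ p ∈ contacts c (informed A m),
      ENNReal.ofReal q ≤ slotsLaw n (hit φ s c A m ρ r p.1 p.2)) :
    ∫⁻ ξ, ENNReal.ofReal (oddsAgainst n (informed (slotHolds φ s c A B ξ) m).card) ∂slotsLaw n ≤
      ENNReal.ofReal (oddsAgainst n (informed A m).card -
        n / (2 * ((informed A m).card : ℝ) ^ 2) * (q * (contacts c (informed A m)).card)) := by
  let gain : ℝ := n / (2 * ((informed A m).card : ℝ) ^ 2)
  have gain_nonneg : 0 ≤ gain := by positivity
  have pointwise (ξ : Fin n → SlotSeed) :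
      ENNReal.ofReal (oddsAgainst n (informed (slotHolds φ s c A B ξ) m).card) +
        ENNReal.ofReal gain * (hits φ s c A m ρ r ξ).card ≤
      ENNReal.ofReal (oddsAgainst n (informed A m).card) := by
    rw [← ENNReal.ofReal_natCast, ← ENNReal.ofReal_mul gain_nonneg,
      ← ENNReal.ofReal_add (oddsAgainst_nonneg (card_finset_fin_le _)) (by positivity)]
    exact ENNReal.ofReal_le_ofReal
      (le_sub_iff_add_le.1 (oddsAgainst_slotHolds_le hs hr hr1 hρ hne B))
  refine lintegral_le_ofReal_sub (measurable_card_hits.const_mul (ENNReal.ofReal gain))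
    (by positivity) pointwise ?_
  rw [ENNReal.ofReal_mul gain_nonneg, ENNReal.ofReal_mul hq, ENNReal.ofReal_natCast,
    lintegral_const_mul _ measurable_card_hits]
  gcongr
  exact mul_card_contacts_le_lintegral_card_hits hhit

lemma exists_mul_kernelMass_le (φ : Phy) {C : ℝ} (hC : 0 < C) :
    ∃ Δ : ℝ, 0 < Δ ∧ Δ ≤ 1 ∧ C * Δ * (kernelMass φ.α).toReal ≤ 2 ^ (-φ.α) / 2 := by
  let K := (kernelMass φ.α).toReal
  have hK : 0 ≤ K := ENNReal.toReal_nonneg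
  refine ⟨min 1 (2 ^ (-φ.α) / (2 * C * (K + 1))), lt_min one_pos (by positivity), min_le_left _ _,
    ?_⟩
  calc C * min 1 (2 ^ (-φ.α) / (2 * C * (K + 1))) * K
      ≤ C * (2 ^ (-φ.α) / (2 * C * (K + 1))) * (K + 1) := by
        gcongr
        · exact min_le_right _ _
        · linarith
    _ = 2 ^ (-φ.α) / 2 := by field_simp

/-- The distance scale `√(Δ / n)`, at which a user has on average at most a constant multiple of `Δ`
other users nearby. -/
def spacing (Δ : ℝ) (n : ℕ) : ℝ := √(Δ / n)

lemma sq_spacing {Δ : ℝ} (hΔ : 0 < Δ) : spacing Δ n ^ 2 = Δ / n := Real.sq_sqrt (by positivity)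

lemma spacing_pos {Δ : ℝ} (hΔ : 0 < Δ) (hn : 0 < n) : 0 < spacing Δ n :=
  Real.sqrt_pos.2 (by positivity)

lemma spacing_mul_le_one {Δ : ℝ} (hΔ : 0 < Δ) (hΔ1 : Δ ≤ 1) (hsn : s ^ 2 ≤ n) :
    spacing Δ n * s ≤ 1 := by
  have hsn' : (s : ℝ) ^ 2 ≤ n := by exact_mod_cast hsn
  refine (abs_le_one_iff_mul_self_le_one.2 ?_).trans' (le_abs_self _)
  calc spacing Δ n * s * (spacing Δ n * s) = Δ * ((s : ℝ) ^ 2 / n) := by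
        rw [mul_mul_mul_comm, ← sq, ← sq, sq_spacing hΔ]
        ring
    _ ≤ 1 := mul_le_one₀ hΔ1 (by positivity) (div_le_one_of_le₀ hsn' n.cast_nonneg)

lemma mean_mul_spacing_rpow_le (hs : 1 ≤ s) (hn : 0 < n) {C Δ : ℝ} (hΔ : 0 < Δ)
    (hΔC : C * Δ * (kernelMass φ.α).toReal ≤ 2 ^ (-φ.α) / 2) :
    C * (n / (s : ℝ) ^ 2) *
        ((s : ℝ) ^ 2 * spacing Δ n ^ (2 - φ.α) * (kernelMass φ.α).toReal) ≤
      (2 * spacing Δ n) ^ (-φ.α) / 2 := by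
  have hr := spacing_pos hΔ hn
  calc C * (n / (s : ℝ) ^ 2) *
        ((s : ℝ) ^ 2 * spacing Δ n ^ (2 - φ.α) * (kernelMass φ.α).toReal)
      = C * Δ * (kernelMass φ.α).toReal * spacing Δ n ^ (-φ.α) := by
        rw [sub_eq_add_neg, Real.rpow_add hr, Real.rpow_two, sq_spacing hΔ]
        field_simp
    _ ≤ 2 ^ (-φ.α) / 2 * spacing Δ n ^ (-φ.α) := by gcongr
    _ = (2 * spacing Δ n) ^ (-φ.α) / 2 := by
        rw [Real.mul_rpow zero_le_two hr.le]
        ring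

lemma slotsLaw_hit_ge (hs : 1 ≤ s) (hsn : s ^ 2 ≤ n) (hc : ∀ l, c l ∈ grid s) {C : ℝ}
    (hC : 0 ≤ C) (hocc : ∀ c' ∈ grid s, (occupancy c c' : ℝ) ≤ C * (n / (s : ℝ) ^ 2))
    (hρ : IsCloseRange φ ρ) {Δ : ℝ} (hΔ : 0 < Δ) (hΔ1 : Δ ≤ 1)
    (hΔC : C * Δ * (kernelMass φ.α).toReal ≤ 2 ^ (-φ.α) / 2) {p : Fin n × Fin n}
    (hp : p ∈ contacts c (informed A m)) :
    ENNReal.ofReal (ρ ^ 2 * Δ * φ.θ / 324 / k * ((s : ℝ) ^ 2 / n)) ≤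
      slotsLaw n (hit φ s c A m ρ (spacing Δ n) p.1 p.2) := by
  have hn : 0 < n := (pow_pos hs 2).trans_le hsn
  have hr := spacing_pos hΔ hn
  have hρ0 := hρ.pos
  obtain ⟨hp1, hp2, hfst, hsnd⟩ := mem_contacts.1 hp
  have hp12 : p.1 ≠ p.2 := fun h => hp2 (h ▸ hp1)
  have ε_le : ρ * spacing Δ n * s ≤ 1 / 2 := by
    nlinarith [spacing_mul_le_one hΔ hΔ1 hsn, hρ.le_one_fourth, mul_nonneg hr.le s.cast_nonneg]
  have two_mul_eq : 2 * ENNReal.ofReal (ρ ^ 2 * Δ * φ.θ / 324 / k * ((s : ℝ) ^ 2 / n)) =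
      ENNReal.ofReal ((ρ * spacing Δ n * s) ^ 2 * φ.θ / (162 * k)) := by
    rw [← ENNReal.ofReal_ofNat, ← ENNReal.ofReal_mul zero_le_two, mul_pow, mul_pow, sq_spacing hΔ]
    congr 1
    ring
  rw [← ENNReal.mul_le_mul_iff_right two_ne_zero ENNReal.ofNat_ne_top, two_mul_eq]
  exact (slotsLaw_meet_ge (by positivity) ε_le hp12 (hc p.1) hfst hsnd
    (mem_informed.1 hp1)).trans <| slotsLaw_meet_le_two_mul_hit hs hc (by positivity) hocc hr
      (mean_mul_spacing_rpow_le hs hn hΔ hΔC) p.1 p.2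

-- Only the upper bound on the occupancies matters here: it limits the interference.
lemma exists_lintegral_oddsAgainst_le (φ : Phy) {C : ℝ} (hC : 0 < C) :
    ∃ κ : ℝ, 0 < κ ∧ κ ≤ 1 ∧ ∀ (n k s : ℕ) (c : Fin n → ℤ × ℤ) (A B : Fin n → Finset (Fin k))
      (m : Fin k), 1 ≤ s → s ^ 2 ≤ n → (∀ l, c l ∈ grid s) →
      (∀ c' ∈ grid s, (occupancy c c' : ℝ) ≤ C * (n / (s : ℝ) ^ 2)) → (informed A m).Nonempty →
      ∫⁻ ξ, ENNReal.ofReal (oddsAgainst n (informed (slotHolds φ s c A B ξ) m).card)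
        ∂slotsLaw n ≤ ENNReal.ofReal (oddsAgainst n (informed A m).card -
        n / (2 * ((informed A m).card : ℝ) ^ 2) *
          (κ / k * ((s : ℝ) ^ 2 / n) * (contacts c (informed A m)).card)) := by
  obtain ⟨ρ, hρ⟩ := exists_isCloseRange φ
  obtain ⟨Δ, hΔ, hΔ1, hΔC⟩ := exists_mul_kernelMass_le φ hC
  have hθ := φ.θ_pos
  have hρ0 := hρ.pos
  refine ⟨ρ ^ 2 * Δ * φ.θ / 324, by positivity, ?_, ?_⟩
  · have hρ1 : ρ ^ 2 ≤ 1 := pow_le_one₀ hρ0.le (hρ.le_one_fourth.trans (by norm_num))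
    have hθ1 : φ.θ ≤ 1 := φ.θ_lt_half.le.trans (by norm_num)
    linarith [mul_le_one₀ (mul_le_one₀ hρ1 hΔ.le hΔ1) hθ.le hθ1]
  intro n k s c A B m hs hsn hc hocc hne
  have hn : 0 < n := (pow_pos hs 2).trans_le hsn
  have spacing_le_one : spacing Δ n ≤ 1 :=
    (le_mul_of_one_le_right (spacing_pos hΔ hn).le (by exact_mod_cast hs)).trans
      (spacing_mul_le_one hΔ hΔ1 hsn)
  exact lintegral_oddsAgainst_slotHolds_le_of_hit hs (spacing_pos hΔ hn) spacing_le_one hρ hne B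
    (by positivity) fun p hp => slotsLaw_hit_ge hs hsn hc hC.le hocc hρ hΔ hΔ1 hΔC hp

end OneSlot

lemma exists_lintegral_oddsAgainst_le_of_card_mul_card_le (φ : Phy) {C : ℝ} (hC : 0 < C) :
    ∃ κ : ℝ, 0 < κ ∧ κ ≤ 1 ∧ ∀ (n k s : ℕ) (c : Fin n → ℤ × ℤ) (A B : Fin n → Finset (Fin k))
      (m : Fin k) (L : ℝ), 1 ≤ s → s ^ 2 ≤ n → (∀ l, c l ∈ grid s) →
      (∀ c' ∈ grid s, (occupancy c c' : ℝ) ≤ C * (n / (s : ℝ) ^ 2)) → (informed A m).Nonempty →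
      0 < L → ((informed A m).card : ℝ) * (informed A m)ᶜ.card ≤
        L * (contacts c (informed A m)).card →
      ∫⁻ ξ, ENNReal.ofReal (oddsAgainst n (informed (slotHolds φ s c A B ξ) m).card)
        ∂slotsLaw n ≤ ENNReal.ofReal
          ((1 - κ * (s : ℝ) ^ 2 / (2 * k * L)) * oddsAgainst n (informed A m).card) := by
  obtain ⟨κ, hκ, hκ1, contraction⟩ := exists_lintegral_oddsAgainst_le φ hC
  refine ⟨κ, hκ, hκ1, fun n k s c A B m L hs hsn hc hocc hne hL hcontacts => ?_⟩
  refine (contraction n k s c A B m hs hsn hc hocc hne).trans (ENNReal.ofReal_le_ofReal ?_)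
  have hn : (0 : ℝ) < n := by exact_mod_cast (pow_pos hs 2).trans_le hsn
  have hk : (0 : ℝ) < k := by exact_mod_cast m.pos
  have ha : (0 : ℝ) < (informed A m).card := by exact_mod_cast hne.card_pos
  rw [Finset.card_compl, Fintype.card_fin, Nat.cast_sub (card_finset_fin_le _)] at hcontacts
  have oddsAgainst_eq : oddsAgainst n (informed A m).card =
      (informed A m).card * (n - (informed A m).card) / ((informed A m).card : ℝ) ^ 2 := by
    rw [oddsAgainst]
    field_simp
  rw [sub_mul, one_mul, oddsAgainst_eq]
  refine sub_le_sub_left ?_ _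
  calc κ * (s : ℝ) ^ 2 / (2 * k * L) *
        ((informed A m).card * (n - (informed A m).card) / ((informed A m).card : ℝ) ^ 2)
      ≤ κ * (s : ℝ) ^ 2 / (2 * k * L) *
        (L * (contacts c (informed A m)).card / ((informed A m).card : ℝ) ^ 2) := by gcongr
    _ = n / (2 * ((informed A m).card : ℝ) ^ 2) *
        (κ / k * ((s : ℝ) ^ 2 / n) * (contacts c (informed A m)).card) := by field_simp

/-! ### The network as a Markov chain -/

lemma measurableSet_forall {α : Type*} {ι : Sort*} [MeasurableSpace α] [Countable ι]
    {p : ι → α → Prop} (h : ∀ i, MeasurableSet {x | p i x}) : MeasurableSet {x | ∀ i, p i x} :=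
  measurableSet_setOfPred.2 (Measurable.forall fun i => measurableSet_setOfPred.1 (h i))

lemma measurableSet_exists {α : Type*} {ι : Sort*} [MeasurableSpace α] [Countable ι]
    {p : ι → α → Prop} (h : ∀ i, MeasurableSet {x | p i x}) : MeasurableSet {x | ∃ i, p i x} :=
  measurableSet_setOfPred.2 (Measurable.exists fun i => measurableSet_setOfPred.1 (h i))

/-- The subsquares of the users and the messages that they hold: the states of the Markov chain that
underlies the mobile network. All sets of states are measurable. -/
def NetState (n k : ℕ) : Type := (Fin n → ℤ × ℤ) × (Fin n → Finset (Fin k))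

instance (n k : ℕ) : MeasurableSpace (NetState n k) := ⊤

instance (n k : ℕ) : Countable (NetState n k) :=
  inferInstanceAs (Countable ((Fin n → ℤ × ℤ) × (Fin n → Finset (Fin k))))

instance (n k : ℕ) : MeasurableSingletonClass (NetState n k) := ⟨fun _ => trivial⟩

section Chain

variable {n k : ℕ} (φ : Phy) (s : ℕ) (src : Fin k → Fin n) (τ : Fin k → ℕ)

/-- Messages injected at user `j` at time `t + 1`. -/
def injected (t : ℕ) (j : Fin n) : Finset (Fin k) :=
  Finset.univ.filter fun m => τ m = t + 1 ∧ src m = j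

/-- Transition of the Markov chain in slot `t`. -/
def netStep (t : ℕ) (x : NetState n k) (ξ : Fin n → SlotSeed) : NetState n k :=
  (fun i => move s (x.1 i) (ξ i).1, slotHolds φ s x.1 x.2 (injected src τ t) ξ)

/-- State of the mobile network at time `t`. -/
def netState (t : ℕ) (ω : Run n) : NetState n k :=
  (fun i => cell s ω i t, fun i => holds φ (mobilePos s ω) src τ ω t i)

lemma netState_zero (ω : Run n) :
    netState φ s src τ 0 ω =
      (fun i => cell s ω i 0, fun j => Finset.univ.filter fun m => τ m = 0 ∧ src m = j) := by
  refine Prod.ext rfl (funext fun j => Finset.ext fun m => ?_)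
  change m ∈ holds φ (mobilePos s ω) src τ ω 0 j ↔ _
  rw [mem_holds_zero]
  simp

lemma netState_succ (t : ℕ) (ω : Run n) :
    netState φ s src τ (t + 1) ω = netStep φ s src τ t (netState φ s src τ t ω) (ω.2 t) := by
  refine Prod.ext rfl (funext fun j => Finset.ext fun m => mem_holds_succ.trans ?_)
  refine Iff.trans ?_ mem_slotHolds.symm
  simp only [injected, Finset.mem_filter, Finset.mem_univ, true_and]
  rfl

variable {φ s src τ}

lemma netState_resample {t u : ℕ} (h : u ≤ t) (ω : Run n) (ξ : Fin n → SlotSeed) :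
    netState φ s src τ u (ω.resample t ξ) = netState φ s src τ u ω := by
  induction u with
  | zero => rw [netState_zero, netState_zero]; rfl
  | succ u ih =>
    rw [netState_succ, netState_succ, ih (by omega), Run.resample_snd_of_ne ω (by omega)]

lemma measurable_slotPos (c : Fin n → ℤ × ℤ) (i : Fin n) :
    Measurable fun ξ : Fin n → SlotSeed => slotPos s c ξ i := by
  have measurable_toPlane : Measurable toPlane := by
    unfold toPlane
    fun_prop
  exact measurable_toPlane.comp <| (measurable_place s (c i)).comp <|
    measurable_pi_apply (X := fun _ : Fin n => SlotSeed) i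

lemma measurable_dist_slotPos (c : Fin n → ℤ × ℤ) (i j : Fin n) :
    Measurable fun ξ : Fin n → SlotSeed => dist (slotPos s c ξ i) (slotPos s c ξ j) :=
  (measurable_slotPos c i).dist (measurable_slotPos c j)

lemma measurableSet_mem_slotSenders (i : Fin n) :
    MeasurableSet {ξ : Fin n → SlotSeed | i ∈ slotSenders φ ξ} := by
  simp only [mem_slotSenders]
  exact measurableSet_lt (by fun_prop : Measurable fun ξ : Fin n → SlotSeed => ((ξ i).2.2.1 : ℝ))
    measurable_const

lemma measurable_sinr_slotPos (c : Fin n → ℤ × ℤ) (i j : Fin n) :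
    Measurable fun ξ : Fin n → SlotSeed => sinr φ (slotPos s c ξ) (slotSenders φ ξ) i j := by
  classical
  have interference_eq (ξ : Fin n → SlotSeed) :
      ∑ l ∈ (slotSenders φ ξ).erase i,
        φ.P * dist (slotPos s c ξ l) (slotPos s c ξ j) ^ (-φ.α) =
      ∑ l ∈ Finset.univ.erase i, {ξ : Fin n → SlotSeed | l ∈ slotSenders φ ξ}.indicator
        (fun ξ => φ.P * dist (slotPos s c ξ l) (slotPos s c ξ j) ^ (-φ.α)) ξ := by
    simp only [Set.indicator_apply, Set.mem_ofPred_eq]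
    rw [← Finset.sum_filter]
    congr 1
    ext l
    simp
  have measurable_power (l : Fin n) : Measurable fun ξ : Fin n → SlotSeed =>
      φ.P * dist (slotPos s c ξ l) (slotPos s c ξ j) ^ (-φ.α) :=
    ((measurable_dist_slotPos c l j).pow_const _).const_mul _
  simp only [sinr, interference_eq]
  exact (measurable_power i).div <| measurable_const.add <| Finset.measurable_sum _ fun l _ =>
    (measurable_power l).indicator (measurableSet_mem_slotSenders l)

lemma measurableSet_delivers (c : Fin n → ℤ × ℤ) (i j : Fin n) :
    MeasurableSet {ξ : Fin n → SlotSeed | Delivers φ (slotPos s c ξ) (slotSenders φ ξ) i j} := by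
  refine (measurableSet_mem_slotSenders i).inter <|
    (measurableSet_mem_slotSenders j).compl.inter <| MeasurableSet.inter ?nearest <|
    measurableSet_le measurable_const (measurable_sinr_slotPos c i j)
  refine measurableSet_forall fun j' => (measurableSet_mem_slotSenders j').compl.imp ?_
  exact measurableSet_le (measurable_dist_slotPos c i j) (measurable_dist_slotPos c i j')

lemma measurableSet_mem_slotHolds (c : Fin n → ℤ × ℤ) (A B : Fin n → Finset (Fin k)) (j : Fin n)
    (m : Fin k) : MeasurableSet {ξ | m ∈ slotHolds φ s c A B ξ j} := by
  simp only [mem_slotHolds]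
  refine (MeasurableSet.const _).union <| (MeasurableSet.const _).union <|
    measurableSet_exists fun i => (measurableSet_delivers c i j).inter ?_
  exact (by fun_prop : Measurable fun ξ : Fin n → SlotSeed => (ξ i).2.2.2)
    (measurableSet_selects (A i) m)

variable (φ s src τ)

lemma measurable_netStep (t : ℕ) (x : NetState n k) : Measurable (netStep φ s src τ t x) := by
  refine measurable_to_countable' fun y => ?_
  have preimage_eq : netStep φ s src τ t x ⁻¹' {y} =
      {ξ | (∀ i, move s (x.1 i) (ξ i).1 = y.1 i) ∧
        ∀ j m, m ∈ slotHolds φ s x.1 x.2 (injected src τ t) ξ j ↔ m ∈ y.2 j} := by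
    ext ξ
    exact Prod.ext_iff.trans (and_congr funext_iff (funext_iff.trans
      (forall_congr' fun j => Finset.ext_iff)))
  rw [preimage_eq]
  refine (measurableSet_forall fun i => ?_).inter
    (measurableSet_forall fun j => measurableSet_forall fun m =>
      (measurableSet_mem_slotHolds x.1 x.2 (injected src τ t) j m).iff (MeasurableSet.const _))
  exact (by fun_prop : Measurable fun ξ : Fin n → SlotSeed => (ξ i).1)
    (measurable_of_countable (fun d => move s (x.1 i) d) (measurableSet_singleton (y.1 i)))

lemma measurable_netState (t : ℕ) :
    Measurable (netState φ s src τ t : Run n → NetState n k) := by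
  induction t with
  | zero =>
    let start (c : Fin n → ℤ × ℤ) : NetState n k :=
      (c, fun j => Finset.univ.filter fun m => τ m = 0 ∧ src m = j)
    rw [show netState φ s src τ 0 = start ∘ fun ω : Run n => fun i => cell s ω i 0 from
      funext (netState_zero φ s src τ)]
    exact (measurable_of_countable start).comp <|
      measurable_pi_lambda _ fun i => measurable_cell s i 0
  | succ t ih =>
    rw [show netState φ s src τ (t + 1) = Function.uncurry (netStep φ s src τ t) ∘
      fun ω : Run n => (netState φ s src τ t ω, ω.2 t) from funext (netState_succ φ s src τ t)]
    exact (measurable_from_prod_countable_right (measurable_netStep φ s src τ t)).comp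
      (ih.prodMk (by fun_prop))

/-- The runs on which the network stays in the states `G` during the slots `t₀, …, t₀ + d - 1`. -/
def staysIn (G : Set (NetState n k)) (t₀ d : ℕ) : Set (Run n) :=
  {ω | ∀ t ∈ Finset.Ico t₀ (t₀ + d), netState φ s src τ t ω ∈ G}

variable {φ s src τ} {G : Set (NetState n k)} {w : NetState n k → ℝ≥0∞} {q : ℝ≥0∞} {t₀ : ℕ}

lemma measurableSet_staysIn (G : Set (NetState n k)) (t₀ d : ℕ) :
    MeasurableSet (staysIn φ s src τ G t₀ d) :=
  measurableSet_forall fun t => measurableSet_forall fun _ =>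
    measurable_netState φ s src τ t trivial

lemma resample_mem_staysIn {t d : ℕ} (h : t₀ + d ≤ t + 1) (ω : Run n) (ξ : Fin n → SlotSeed) :
    ω.resample t ξ ∈ staysIn φ s src τ G t₀ d ↔ ω ∈ staysIn φ s src τ G t₀ d :=
  forall₂_congr fun u hu => by
    rw [netState_resample (by have := Finset.mem_Ico.1 hu; omega)]

lemma setLIntegral_staysIn_succ_le {d : ℕ}
    (hw : ∀ x ∈ G, ∫⁻ ξ, w (netStep φ s src τ (t₀ + d) x ξ) ∂slotsLaw n ≤ q * w x) :
    ∫⁻ ω in staysIn φ s src τ G t₀ (d + 1), w (netState φ s src τ (t₀ + (d + 1)) ω) ∂runLaw n ≤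
      q * ∫⁻ ω in staysIn φ s src τ G t₀ d, w (netState φ s src τ (t₀ + d) ω) ∂runLaw n := by
  have measurable_w : Measurable w := measurable_of_countable w
  have measurable_transition : Measurable (Function.uncurry fun x ξ =>
      w (netStep φ s src τ (t₀ + d) x ξ)) :=
    measurable_w.comp (measurable_from_prod_countable_right (measurable_netStep φ s src τ (t₀ + d)))
  calc ∫⁻ ω in staysIn φ s src τ G t₀ (d + 1), w (netState φ s src τ (t₀ + (d + 1)) ω) ∂runLaw n
      = ∫⁻ ω in staysIn φ s src τ G t₀ (d + 1),
          ∫⁻ ξ, w (netStep φ s src τ (t₀ + d) (netState φ s src τ (t₀ + d) ω) ξ) ∂slotsLaw n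
          ∂runLaw n := by
        rw [← setLIntegral_prodMk_seed (measurable_netState φ s src τ (t₀ + d))
          (netState_resample le_rfl) (measurableSet_staysIn G t₀ (d + 1))
          (resample_mem_staysIn le_rfl) measurable_transition]
        simp only [← add_assoc, netState_succ]
    _ ≤ ∫⁻ ω in staysIn φ s src τ G t₀ (d + 1), q * w (netState φ s src τ (t₀ + d) ω)
          ∂runLaw n :=
        setLIntegral_mono' (measurableSet_staysIn G t₀ (d + 1)) fun ω hω =>
          hw _ (hω _ (Finset.mem_Ico.2 (by omega)))
    _ ≤ ∫⁻ ω in staysIn φ s src τ G t₀ d, q * w (netState φ s src τ (t₀ + d) ω) ∂runLaw n :=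
        lintegral_mono_set fun ω hω t ht =>
          hω t (Finset.Ico_subset_Ico_right (by omega) ht)
    _ = q * ∫⁻ ω in staysIn φ s src τ G t₀ d, w (netState φ s src τ (t₀ + d) ω) ∂runLaw n :=
        lintegral_const_mul q (measurable_w.comp (measurable_netState φ s src τ _))

lemma setLIntegral_staysIn_le
    (hw : ∀ t, t₀ ≤ t → ∀ x ∈ G, ∫⁻ ξ, w (netStep φ s src τ t x ξ) ∂slotsLaw n ≤ q * w x) (d : ℕ) :
    ∫⁻ ω in staysIn φ s src τ G t₀ d, w (netState φ s src τ (t₀ + d) ω) ∂runLaw n ≤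
      q ^ d * ∫⁻ ω, w (netState φ s src τ t₀ ω) ∂runLaw n := by
  induction d with
  | zero => simpa using setLIntegral_le_lintegral _ _
  | succ d ih =>
    refine (setLIntegral_staysIn_succ_le (hw (t₀ + d) (by omega))).trans ?_
    rw [pow_succ', mul_assoc]
    gcongr

lemma src_mem_informed_netState {m : Fin k} {t : ℕ} (h : τ m ≤ t) (ω : Run n) :
    src m ∈ informed (netState φ s src τ t ω).2 m :=
  mem_informed.2 (holds_mono h (mem_holds_injection.2 rfl))

lemma inv_le_of_not_forall_mem {A : Fin n → Finset (Fin k)} {m : Fin k}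
    (hne : (informed A m).Nonempty) (h : ¬ ∀ j, m ∈ A j) :
    (n : ℝ≥0∞)⁻¹ ≤ ENNReal.ofReal (oddsAgainst n (informed A m).card) := by
  have hn : (0 : ℝ) < n := by
    obtain ⟨i, -⟩ := hne
    exact_mod_cast i.pos
  have card_lt : (informed A m).card < n := by
    have ne_univ : informed A m ≠ Finset.univ := fun huniv =>
      h fun j => mem_informed.1 (huniv ▸ Finset.mem_univ j)
    simpa using Finset.card_lt_card (Finset.ssubset_univ_iff.2 ne_univ)
  rw [← ENNReal.ofReal_natCast, ← ENNReal.ofReal_inv_of_pos hn]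
  exact ENNReal.ofReal_le_ofReal (inv_le_oddsAgainst hne.card_pos card_lt)

lemma lintegral_netState_injection_le {m : Fin k}
    (hw_le : ∀ x, w x ≤ 2 * ENNReal.ofReal (oddsAgainst n (informed x.2 m).card)) :
    ∫⁻ ω, w (netState φ s src τ (τ m) ω) ∂runLaw n ≤ 2 * n := by
  calc ∫⁻ ω, w (netState φ s src τ (τ m) ω) ∂runLaw n ≤ ∫⁻ _ : Run n, 2 * n ∂runLaw n := by
        refine lintegral_mono fun ω => (hw_le _).trans ?_
        gcongr
        rw [← ENNReal.ofReal_natCast]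
        exact ENNReal.ofReal_le_ofReal <| oddsAgainst_le <| Finset.card_pos.2
          ⟨_, src_mem_informed_netState le_rfl ω⟩
    _ = 2 * n := by simp

lemma measure_not_spread_le {m : Fin k} {r : ℝ} (hr : 0 ≤ r)
    (hw : ∀ t, τ m ≤ t → ∀ x ∈ G,
      ∫⁻ ξ, w (netStep φ s src τ t x ξ) ∂slotsLaw n ≤ ENNReal.ofReal r * w x)
    (hw_ge : ∀ x, ENNReal.ofReal (oddsAgainst n (informed x.2 m).card) ≤ w x)
    (hw_le : ∀ x, w x ≤ 2 * ENNReal.ofReal (oddsAgainst n (informed x.2 m).card)) (d : ℕ) :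
    runLaw n {ω | ¬ ∀ j, m ∈ holds φ (mobilePos s ω) src τ ω (τ m + d) j} ≤
      runLaw n (staysIn φ s src τ G (τ m) d)ᶜ + ENNReal.ofReal (r ^ d * (2 * (n : ℝ) ^ 2)) := by
  have hn : n ≠ 0 := (src m).pos.ne'
  let E := staysIn φ s src τ G (τ m) d
  let W (ω : Run n) : ℝ≥0∞ := w (netState φ s src τ (τ m + d) ω)
  have subset : {ω | ¬ ∀ j, m ∈ holds φ (mobilePos s ω) src τ ω (τ m + d) j} ⊆
      Eᶜ ∪ {ω | (n : ℝ≥0∞)⁻¹ ≤ W ω} ∩ E := by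
    intro ω hω
    by_cases hE : ω ∈ E
    · exact Or.inr ⟨(inv_le_of_not_forall_mem ⟨_, src_mem_informed_netState (by omega) ω⟩ hω).trans
        (hw_ge _), hE⟩
    · exact Or.inl hE
  refine (measure_mono subset).trans ((measure_union_le _ _).trans (add_le_add_right ?_ _))
  calc runLaw n ({ω | (n : ℝ≥0∞)⁻¹ ≤ W ω} ∩ E)
      = (runLaw n).restrict E {ω | (n : ℝ≥0∞)⁻¹ ≤ W ω} :=
        (Measure.restrict_apply' (measurableSet_staysIn G (τ m) d)).symm
    _ ≤ (∫⁻ ω in E, W ω ∂runLaw n) / (n : ℝ≥0∞)⁻¹ :=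
        meas_ge_le_lintegral_div ((measurable_of_countable w).comp
          (measurable_netState φ s src τ _)).aemeasurable (by simp) (by simp [hn])
    _ ≤ ENNReal.ofReal r ^ d * (2 * n) / (n : ℝ≥0∞)⁻¹ := by
        gcongr
        exact (setLIntegral_staysIn_le hw d).trans
          (by gcongr; exact lintegral_netState_injection_le hw_le)
    _ = ENNReal.ofReal (r ^ d * (2 * (n : ℝ) ^ 2)) := by
        rw [div_eq_mul_inv, inv_inv, ENNReal.ofReal_mul (pow_nonneg hr d), ENNReal.ofReal_pow hr,
          ENNReal.ofReal_mul zero_le_two, ENNReal.ofReal_pow n.cast_nonneg, ENNReal.ofReal_natCast,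
          ENNReal.ofReal_ofNat]
        ring

end Chain

/-! ### Balanced networks -/

section Balanced

variable {n k s : ℕ}

/-- The states in which the users are evenly spread over the grid and some user holds `m`. -/
def balanced (s : ℕ) (m : Fin k) : Set (NetState n k) :=
  {x | (∀ l, x.1 l ∈ grid s) ∧ (informed x.2 m).Nonempty ∧ ∀ c ∈ grid s,
    (n / (s : ℝ) ^ 2) / 8 ≤ occupancy x.1 c ∧ (occupancy x.1 c : ℝ) ≤ 4 * (n / (s : ℝ) ^ 2)}

lemma measure_compl_staysIn_balanced_le (φ : Phy) (hs : 1 ≤ s) (src : Fin k → Fin n)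
    (τ : Fin k → ℕ) (m : Fin k) (d : ℕ) :
    runLaw n (staysIn φ s src τ (balanced s m) (τ m) d)ᶜ ≤
      ENNReal.ofReal (d * (s : ℝ) ^ 2 * (2 * Real.exp (-(0.4 * (n / (s : ℝ) ^ 2))))) := by
  let unbalanced (p : ℕ × ℤ × ℤ) : Set (Run n) :=
    {ω | ¬ ((n / (s : ℝ) ^ 2) / 8 ≤ occupancy (fun i => cell s ω i p.1) p.2 ∧
      (occupancy (fun i => cell s ω i p.1) p.2 : ℝ) ≤ 4 * (n / (s : ℝ) ^ 2))}
  let slots := Finset.Ico (τ m) (τ m + d)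
  have subset : (staysIn φ s src τ (balanced s m) (τ m) d)ᶜ ⊆
      ⋃ p ∈ slots ×ˢ grid s, unbalanced p := by
    intro ω hω
    by_contra hcon
    refine hω fun t ht => ⟨fun l => cell_mem_grid hs ω l t,
      ⟨_, src_mem_informed_netState (Finset.mem_Ico.1 ht).1 ω⟩, fun c hc => ?_⟩
    by_contra hc'
    exact hcon (Set.mem_iUnion₂.2 ⟨(t, c), Finset.mem_product.2 ⟨ht, hc⟩, hc'⟩)
  have card_eq : (slots ×ˢ grid s).card = d * s ^ 2 := by
    rw [Finset.card_product, card_grid, Nat.card_Ico, Nat.add_sub_cancel_left]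
  calc runLaw n (staysIn φ s src τ (balanced s m) (τ m) d)ᶜ
      ≤ ∑ p ∈ slots ×ˢ grid s, runLaw n (unbalanced p) :=
        (measure_mono subset).trans (measure_biUnion_finset_le _ _)
    _ ≤ ∑ _ ∈ slots ×ˢ grid s, ENNReal.ofReal (2 * Real.exp (-(0.4 * (n / (s : ℝ) ^ 2)))) :=
        Finset.sum_le_sum fun p hp =>
          measure_occupancy_unbalanced_le hs p.1 (Finset.mem_product.1 hp).2
    _ = ENNReal.ofReal (d * (s : ℝ) ^ 2 * (2 * Real.exp (-(0.4 * (n / (s : ℝ) ^ 2))))) := by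
        rw [Finset.sum_const, card_eq, nsmul_eq_mul, ENNReal.ofReal_mul (p := d * (s : ℝ) ^ 2)
          (by positivity), ← ENNReal.ofReal_natCast]
        push_cast
        rfl

lemma exists_lintegral_oddsAgainst_le_of_mem_balanced (φ : Phy) (K : ℕ) :
    ∃ κ : ℝ, 0 < κ ∧ κ ≤ 1 ∧ ∀ (n k s : ℕ) (m : Fin k) (x : NetState n k)
      (B : Fin n → Finset (Fin k)), k ≤ K → 1 ≤ s → s ^ 2 ≤ n → x ∈ balanced s m →
      ∫⁻ ξ, ENNReal.ofReal (oddsAgainst n (informed (slotHolds φ s x.1 x.2 B ξ) m).card)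
        ∂slotsLaw n ≤
      ENNReal.ofReal ((1 - κ / s) * oddsAgainst n (informed x.2 m).card) := by
  obtain ⟨κ, hκ, hκ1, contraction⟩ :=
    exists_lintegral_oddsAgainst_le_of_card_mul_card_le φ (C := 4) (by norm_num)
  refine ⟨κ / (4096 * (K + 1)), by positivity, ?_, ?_⟩
  · rw [div_le_one (by positivity)]
    have : (0 : ℝ) ≤ K := K.cast_nonneg
    linarith
  rintro n k s m ⟨c, A⟩ B hk hs hsn ⟨hgrid, hne, hocc⟩
  have hn : (0 : ℝ) < n := by exact_mod_cast (pow_pos hs 2).trans_le hsn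
  have hk_pos : (0 : ℝ) < k := by exact_mod_cast m.pos
  have hk_le : (k : ℝ) ≤ K + 1 := by exact_mod_cast hk.trans K.le_succ
  have card_mul_card_le : ((informed A m).card : ℝ) * (informed A m)ᶜ.card ≤
      2048 * (s : ℝ) ^ 3 * (contacts c (informed A m)).card := by
    refine (card_mul_card_compl_le hgrid (informed A m) (by positivity) hocc).trans_eq ?_
    field_simp
    ring
  refine (contraction n k s c A B m _ hs hsn hgrid (fun p hp => (hocc p hp).2) hne
    (by positivity) card_mul_card_le).trans (ENNReal.ofReal_le_ofReal ?_)
  refine mul_le_mul_of_nonneg_right (sub_le_sub_left ?_ 1)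
    (oddsAgainst_nonneg (card_finset_fin_le _))
  calc κ / (4096 * (K + 1)) / s ≤ κ / (4096 * k) / s := by gcongr
    _ = κ * (s : ℝ) ^ 2 / (2 * k * (2048 * (s : ℝ) ^ 3)) := by
      field_simp
      norm_num

lemma exists_measure_not_spread_le (φ : Phy) (K : ℕ) :
    ∃ κ : ℝ, 0 < κ ∧ κ ≤ 1 ∧ ∀ (n k s : ℕ) (src : Fin k → Fin n) (τ : Fin k → ℕ) (m : Fin k)
      (d : ℕ), k ≤ K → 1 ≤ s → s ^ 2 ≤ n →
      runLaw n {ω | ¬ ∀ j, m ∈ holds φ (mobilePos s ω) src τ ω (τ m + d) j} ≤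
        ENNReal.ofReal (d * (s : ℝ) ^ 2 * (2 * Real.exp (-(0.4 * (n / (s : ℝ) ^ 2)))) +
          (1 - κ / s) ^ d * (2 * (n : ℝ) ^ 2)) := by
  obtain ⟨κ, hκ, hκ1, contraction⟩ := exists_lintegral_oddsAgainst_le_of_mem_balanced φ K
  refine ⟨κ, hκ, hκ1, fun n k s src τ m d hk hs hsn => ?_⟩
  have factor_nonneg : 0 ≤ 1 - κ / s := by
    rw [sub_nonneg]
    exact div_le_one_of_le₀ (hκ1.trans (by exact_mod_cast hs)) s.cast_nonneg
  refine (measure_not_spread_le (G := balanced s m)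
    (w := fun x => ENNReal.ofReal (oddsAgainst n (informed x.2 m).card)) factor_nonneg
    (fun t _ x hx => ?_) (fun x => le_rfl)
    (fun x => le_mul_of_one_le_left' one_le_two) d).trans ?_
  · rw [← ENNReal.ofReal_mul factor_nonneg]
    exact contraction n k s m x (injected src τ t) hk hs hsn hx
  · rw [ENNReal.ofReal_add (by positivity) (by positivity)]
    gcongr
    exact measure_compl_staysIn_balanced_le φ hs src τ m d

end Balanced

/-! ### Networks of bounded size -/

section Corner

variable {n k s : ℕ} {c : Fin n → ℤ × ℤ}

/-- Number of slots in which all users can gather in the corner subsquare `(0, 0)`. -/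
def cornerDist (c : Fin n → ℤ × ℤ) : ℕ :=
  Finset.univ.sup fun i => max (c i).1.toNat (c i).2.toNat

/-- The direction that leads from the subsquare `c` towards the corner subsquare `(0, 0)`. -/
def cornerDir (c : ℤ × ℤ) : Fin 3 × Fin 3 :=
  (if 0 < c.1 then 0 else 1, if 0 < c.2 then 0 else 1)

/-- The event that all users, located in the subsquares `c`, head for the corner. -/
def towardsCorner (c : Fin n → ℤ × ℤ) : Set (Fin n → SlotSeed) :=
  {ξ | ∀ i, (ξ i).1 = cornerDir (c i)}

lemma move_cornerDir {p : ℤ × ℤ} (hp : p ∈ grid s) :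
    move s p (cornerDir p) = (max (p.1 - 1) 0, max (p.2 - 1) 0) := by
  rw [mem_grid] at hp
  obtain ⟨x, y⟩ := p
  by_cases hx : 0 < x <;> by_cases hy : 0 < y <;>
    simp only [move, cornerDir, hx, hy, if_true, if_false, Fin.val_zero, Fin.val_one] <;>
    grind

lemma max_toNat_le_cornerDist (c : Fin n → ℤ × ℤ) (i : Fin n) :
    max (c i).1.toNat (c i).2.toNat ≤ cornerDist c :=
  Finset.le_sup (f := fun i => max (c i).1.toNat (c i).2.toNat) (Finset.mem_univ i)

lemma cornerDist_move_le (hc : ∀ l, c l ∈ grid s) :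
    cornerDist (fun i => move s (c i) (cornerDir (c i))) ≤ cornerDist c - 1 := by
  refine Finset.sup_le fun i _ => ?_
  have := max_toNat_le_cornerDist c i
  simp only [move_cornerDir (hc i)]
  omega

lemma cornerDist_le (hc : ∀ l, c l ∈ grid s) : cornerDist c ≤ s := by
  refine Finset.sup_le fun i _ => ?_
  have := mem_grid.1 (hc i)
  omega

lemma eq_of_cornerDist_eq_zero (hc : ∀ l, c l ∈ grid s) (h : cornerDist c = 0) (i j : Fin n) :
    c i = c j := by
  have eq_corner (i : Fin n) : c i = (0, 0) := by
    have := max_toNat_le_cornerDist c i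
    have := mem_grid.1 (hc i)
    refine Prod.ext ?_ ?_ <;> dsimp only <;> omega
  rw [eq_corner i, eq_corner j]

lemma slotsLaw_towardsCorner (c : Fin n → ℤ × ℤ) :
    slotsLaw n (towardsCorner c) = ENNReal.ofReal ((1 / 9) ^ n) := by
  have eq_pi : towardsCorner c = Set.univ.pi fun i => {cornerDir (c i)} ×ˢ Set.univ := by
    ext ξ
    simp [towardsCorner]
  rw [eq_pi, slotsLaw, Measure.pi_pi]
  simp only [slotLaw_eq_prod, Measure.prod_prod, moveLaw_singleton, measure_univ, mul_one,
    Finset.prod_const, Finset.card_univ, Fintype.card_fin]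
  rw [ENNReal.ofReal_pow (by norm_num), one_div, ENNReal.ofReal_inv_of_pos (by norm_num),
    ENNReal.ofReal_ofNat]

lemma measurableSet_towardsCorner (c : Fin n → ℤ × ℤ) : MeasurableSet (towardsCorner c) :=
  measurableSet_forall fun i =>
    (by fun_prop : Measurable fun ξ : Fin n → SlotSeed => (ξ i).1)
      (measurableSet_singleton (cornerDir (c i)))

lemma exists_lintegral_oddsAgainst_le_of_eq (φ : Phy) (K : ℕ) (hs : 1 ≤ s) :
    ∃ b : ℝ, 0 < b ∧ b ≤ 1 / 2 ∧ ∀ (n k : ℕ) (m : Fin k) (x : NetState n k)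
      (B : Fin n → Finset (Fin k)), k ≤ K → s ^ 2 ≤ n → (∀ l, x.1 l ∈ grid s) →
      (∀ i j, x.1 i = x.1 j) → (informed x.2 m).Nonempty →
      ∫⁻ ξ, ENNReal.ofReal (oddsAgainst n (informed (slotHolds φ s x.1 x.2 B ξ) m).card)
        ∂slotsLaw n ≤
      ENNReal.ofReal ((1 - b) * oddsAgainst n (informed x.2 m).card) := by
  have hs_one : (1 : ℝ) ≤ s := by exact_mod_cast hs
  obtain ⟨κ, hκ, hκ1, contraction⟩ :=
    exists_lintegral_oddsAgainst_le_of_card_mul_card_le φ (C := (s : ℝ) ^ 2) (by positivity)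
  refine ⟨κ / (2 * (K + 1)), by positivity, ?_, ?_⟩
  · rw [div_le_iff₀ (by positivity)]
    have : (0 : ℝ) ≤ K := K.cast_nonneg
    linarith
  rintro n k m ⟨c, A⟩ B hk hsn hgrid hall hne
  have hk_pos : (0 : ℝ) < k := by exact_mod_cast m.pos
  have hk_le : (k : ℝ) ≤ K + 1 := by exact_mod_cast hk.trans K.le_succ
  have occupancy_le (p : ℤ × ℤ) : (occupancy c p : ℝ) ≤ (s : ℝ) ^ 2 * (n / (s : ℝ) ^ 2) := by
    rw [mul_div_cancel₀ _ (by positivity)]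
    exact_mod_cast card_finset_fin_le _
  refine (contraction n k s c A B m 1 hs hsn hgrid (fun p _ => occupancy_le p) hne one_pos
    ?_).trans (ENNReal.ofReal_le_ofReal ?_)
  · rw [card_contacts_of_eq hall, one_mul, Nat.cast_mul]
  refine mul_le_mul_of_nonneg_right (sub_le_sub_left ?_ 1)
    (oddsAgainst_nonneg (card_finset_fin_le _))
  calc κ / (2 * (K + 1)) ≤ κ * 1 / (2 * k * 1) := by
        rw [mul_one, mul_one]
        gcongr
    _ ≤ κ * (s : ℝ) ^ 2 / (2 * k * 1) := by
        gcongr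
        exact one_le_pow₀ hs_one

/-- The odds, discounted by the proximity of the users to the corner: the potential for networks of
bounded size, in which both meeting in the corner and heading for it count as progress. -/
def cornerWeight (b q : ℝ) (m : Fin k) (x : NetState n k) : ℝ :=
  oddsAgainst n (informed x.2 m).card * (2 - b * q ^ cornerDist x.1)

variable {φ : Phy} {src : Fin k → Fin n} {τ : Fin k → ℕ} {t : ℕ} {m : Fin k} {x : NetState n k}
  {b q δ : ℝ}

lemma oddsAgainst_informed_nonneg (x : NetState n k) (m : Fin k) :
    0 ≤ oddsAgainst n (informed x.2 m).card :=
  oddsAgainst_nonneg (card_finset_fin_le _)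

lemma oddsAgainst_netStep_le (hne : (informed x.2 m).Nonempty) (ξ : Fin n → SlotSeed) :
    oddsAgainst n (informed (netStep φ s src τ t x ξ).2 m).card ≤
      oddsAgainst n (informed x.2 m).card :=
  oddsAgainst_anti hne.card_pos <| Finset.card_le_card fun _ hi =>
    mem_informed.2 (mem_slotHolds.2 (Or.inl (mem_informed.1 hi)))

lemma cornerWeight_le (hb : 0 ≤ b) (hq : 0 ≤ q) (m : Fin k) (x : NetState n k) :
    cornerWeight b q m x ≤ 2 * oddsAgainst n (informed x.2 m).card := by
  rw [cornerWeight, mul_comm]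
  exact mul_le_mul_of_nonneg_right (sub_le_self 2 (by positivity)) (oddsAgainst_informed_nonneg x m)

lemma oddsAgainst_le_cornerWeight (hb : 0 ≤ b) (hb1 : b ≤ 1 / 2) (hq : 0 ≤ q) (hq1 : q ≤ 1)
    (m : Fin k) (x : NetState n k) :
    oddsAgainst n (informed x.2 m).card ≤ cornerWeight b q m x := by
  refine le_mul_of_one_le_right (oddsAgainst_informed_nonneg x m) ?_
  linarith [mul_le_of_le_one_right hb (pow_le_one₀ hq hq1 (n := cornerDist x.1))]

lemma two_sub_mul_oddsAgainst_le_cornerWeight (hδ : 0 ≤ δ) (h : 2 * δ ≤ b * q ^ cornerDist x.1) :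
    (2 - 2 * (b * q ^ cornerDist x.1)) * oddsAgainst n (informed x.2 m).card ≤
      (1 - δ) * cornerWeight b q m x := by
  set u := b * q ^ cornerDist x.1
  have factor_le : 2 - 2 * u ≤ (1 - δ) * (2 - u) := by nlinarith
  calc (2 - 2 * u) * oddsAgainst n (informed x.2 m).card
      ≤ (1 - δ) * (2 - u) * oddsAgainst n (informed x.2 m).card :=
        mul_le_mul_of_nonneg_right factor_le (oddsAgainst_informed_nonneg x m)
    _ = (1 - δ) * (oddsAgainst n (informed x.2 m).card * (2 - u)) := by ring

lemma lintegral_cornerWeight_le_of_cornerDist_eq_zero (hb : 0 ≤ b) (hq : 0 ≤ q) (hδ : 0 ≤ δ)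
    (hδb : 2 * δ ≤ b) (hzero : cornerDist x.1 = 0)
    (contraction : ∫⁻ ξ, ENNReal.ofReal (oddsAgainst n
        (informed (slotHolds φ s x.1 x.2 (injected src τ t) ξ) m).card) ∂slotsLaw n ≤
      ENNReal.ofReal ((1 - b) * oddsAgainst n (informed x.2 m).card)) :
    ∫⁻ ξ, ENNReal.ofReal (cornerWeight b q m (netStep φ s src τ t x ξ)) ∂slotsLaw n ≤
      ENNReal.ofReal ((1 - δ) * cornerWeight b q m x) := by
  calc ∫⁻ ξ, ENNReal.ofReal (cornerWeight b q m (netStep φ s src τ t x ξ)) ∂slotsLaw n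
      ≤ ∫⁻ ξ, ENNReal.ofReal 2 * ENNReal.ofReal (oddsAgainst n
          (informed (slotHolds φ s x.1 x.2 (injected src τ t) ξ) m).card) ∂slotsLaw n := by
        refine lintegral_mono fun ξ => ?_
        rw [← ENNReal.ofReal_mul zero_le_two]
        exact ENNReal.ofReal_le_ofReal (cornerWeight_le hb hq m (netStep φ s src τ t x ξ))
    _ ≤ ENNReal.ofReal 2 * ENNReal.ofReal ((1 - b) * oddsAgainst n (informed x.2 m).card) := by
        rw [lintegral_const_mul' _ _ ENNReal.ofReal_ne_top]
        gcongr
    _ = ENNReal.ofReal ((2 - 2 * (b * q ^ cornerDist x.1)) *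
          oddsAgainst n (informed x.2 m).card) := by
        rw [← ENNReal.ofReal_mul zero_le_two, hzero]
        ring_nf
    _ ≤ ENNReal.ofReal ((1 - δ) * cornerWeight b q m x) :=
        ENNReal.ofReal_le_ofReal <| two_sub_mul_oddsAgainst_le_cornerWeight hδ <| by
          rwa [hzero, pow_zero, mul_one]

lemma cornerDist_netStep_le (hgrid : ∀ l, x.1 l ∈ grid s) {ξ : Fin n → SlotSeed}
    (hξ : ξ ∈ towardsCorner x.1) :
    cornerDist (netStep φ s src τ t x ξ).1 ≤ cornerDist x.1 - 1 := by
  simpa only [netStep, hξ _] using cornerDist_move_le hgrid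

lemma cornerWeight_netStep_add_le (hb : 0 ≤ b) (hb1 : b ≤ 1 / 2) (hq : 0 ≤ q) (hq1 : q ≤ 1)
    (hgrid : ∀ l, x.1 l ∈ grid s) (hne : (informed x.2 m).Nonempty) {ξ : Fin n → SlotSeed}
    (hξ : ξ ∈ towardsCorner x.1) :
    cornerWeight b q m (netStep φ s src τ t x ξ) +
      oddsAgainst n (informed x.2 m).card * (b * q ^ (cornerDist x.1 - 1)) ≤
      2 * oddsAgainst n (informed x.2 m).card := by
  set y := netStep φ s src τ t x ξ
  have discount_le : b * q ^ cornerDist y.1 ≤ 2 :=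
    (mul_le_of_le_one_right hb (pow_le_one₀ hq hq1)).trans (by linarith)
  have discount_ge : b * q ^ (cornerDist x.1 - 1) ≤ b * q ^ cornerDist y.1 :=
    mul_le_mul_of_nonneg_left
      (pow_le_pow_of_le_one hq hq1 (cornerDist_netStep_le hgrid hξ)) hb
  calc cornerWeight b q m y + oddsAgainst n (informed x.2 m).card * (b * q ^ (cornerDist x.1 - 1))
      ≤ oddsAgainst n (informed x.2 m).card * (2 - b * q ^ cornerDist y.1) +
        oddsAgainst n (informed x.2 m).card * (b * q ^ cornerDist y.1) :=
        add_le_add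
          (mul_le_mul_of_nonneg_right (oddsAgainst_netStep_le hne ξ) (sub_nonneg.2 discount_le))
          (mul_le_mul_of_nonneg_left discount_ge (oddsAgainst_informed_nonneg x m))
    _ = 2 * oddsAgainst n (informed x.2 m).card := by ring

lemma lintegral_cornerWeight_le_of_cornerDist_pos (hb : 0 ≤ b) (hb1 : b ≤ 1 / 2)
    (hq : 0 ≤ q) (hq1 : q ≤ 1) (hprob : ENNReal.ofReal (2 * q) ≤ slotsLaw n (towardsCorner x.1))
    (hδ : 0 ≤ δ) (hδb : 2 * δ ≤ b * q ^ cornerDist x.1) (hpos : 0 < cornerDist x.1)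
    (hgrid : ∀ l, x.1 l ∈ grid s) (hne : (informed x.2 m).Nonempty) :
    ∫⁻ ξ, ENNReal.ofReal (cornerWeight b q m (netStep φ s src τ t x ξ)) ∂slotsLaw n ≤
      ENNReal.ofReal ((1 - δ) * cornerWeight b q m x) := by
  have odds_nonneg := oddsAgainst_informed_nonneg x m
  set gain := oddsAgainst n (informed x.2 m).card * (b * q ^ (cornerDist x.1 - 1))
  have gain_nonneg : 0 ≤ gain := by positivity
  have pointwise (ξ : Fin n → SlotSeed) :
      ENNReal.ofReal (cornerWeight b q m (netStep φ s src τ t x ξ)) +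
        (towardsCorner x.1).indicator (fun _ => ENNReal.ofReal gain) ξ ≤
      ENNReal.ofReal (2 * oddsAgainst n (informed x.2 m).card) := by
    have weight_nonneg : 0 ≤ cornerWeight b q m (netStep φ s src τ t x ξ) :=
      (oddsAgainst_informed_nonneg _ m).trans (oddsAgainst_le_cornerWeight hb hb1 hq hq1 m _)
    by_cases hξ : ξ ∈ towardsCorner x.1
    · rw [Set.indicator_of_mem hξ, ← ENNReal.ofReal_add weight_nonneg gain_nonneg]
      exact ENNReal.ofReal_le_ofReal (cornerWeight_netStep_add_le hb hb1 hq hq1 hgrid hne hξ)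
    · rw [Set.indicator_of_notMem hξ, add_zero]
      exact ENNReal.ofReal_le_ofReal <| (cornerWeight_le hb hq m _).trans
        (mul_le_mul_of_nonneg_left (oddsAgainst_netStep_le hne ξ) zero_le_two)
  refine (lintegral_le_ofReal_sub (b := gain * (2 * q))
    (measurable_const.indicator (measurableSet_towardsCorner x.1)) (by positivity) pointwise
    ?_).trans (ENNReal.ofReal_le_ofReal ?_)
  · rw [lintegral_indicator_const (measurableSet_towardsCorner x.1),
      ENNReal.ofReal_mul gain_nonneg]
    gcongr
  · refine (two_sub_mul_oddsAgainst_le_cornerWeight hδ hδb).trans' (le_of_eq ?_)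
    rw [← Nat.sub_one_add_one hpos.ne', pow_succ]
    ring

lemma exists_lintegral_cornerWeight_le (φ : Phy) (K : ℕ) (hs : 1 ≤ s) (hsn : s ^ 2 ≤ n) :
    ∃ b q δ : ℝ, 0 ≤ b ∧ b ≤ 1 / 2 ∧ 0 ≤ q ∧ q ≤ 1 ∧ 0 < δ ∧ δ ≤ 1 ∧
      ∀ (k : ℕ) (src : Fin k → Fin n) (τ : Fin k → ℕ) (t : ℕ) (m : Fin k) (x : NetState n k),
      k ≤ K → (∀ l, x.1 l ∈ grid s) → (informed x.2 m).Nonempty →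
      ∫⁻ ξ, ENNReal.ofReal (cornerWeight b q m (netStep φ s src τ t x ξ)) ∂slotsLaw n ≤
        ENNReal.ofReal ((1 - δ) * cornerWeight b q m x) := by
  obtain ⟨b, hb, hb1, contraction⟩ := exists_lintegral_oddsAgainst_le_of_eq φ K hs
  obtain ⟨q, hq_eq⟩ : ∃ q : ℝ, 2 * q = (1 / 9) ^ n := ⟨_, mul_div_cancel₀ _ two_ne_zero⟩
  have hq : 0 < q := by linarith [show (0 : ℝ) < (1 / 9) ^ n by positivity]
  have hq1 : q ≤ 1 := by
    linarith [pow_le_one₀ (n := n) (by norm_num : (0 : ℝ) ≤ 1 / 9) (by norm_num)]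
  obtain ⟨δ, hδ_eq⟩ : ∃ δ : ℝ, 2 * δ = b * q ^ s := ⟨_, mul_div_cancel₀ _ two_ne_zero⟩
  have hδ : 0 < δ := by linarith [show 0 < b * q ^ s by positivity]
  have hδ1 : δ ≤ 1 := by linarith [mul_le_of_le_one_right hb.le (pow_le_one₀ hq.le hq1 (n := s))]
  have two_mul_delta_le {L : ℕ} (hL : L ≤ s) : 2 * δ ≤ b * q ^ L :=
    hδ_eq.trans_le (mul_le_mul_of_nonneg_left (pow_le_pow_of_le_one hq.le hq1 hL) hb.le)
  refine ⟨b, q, δ, hb.le, hb1, hq.le, hq1, hδ, hδ1, fun k src τ t m x hk hgrid hne => ?_⟩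
  rcases Nat.eq_zero_or_pos (cornerDist x.1) with hzero | hpos
  · refine lintegral_cornerWeight_le_of_cornerDist_eq_zero hb.le hq.le hδ.le ?_ hzero
      (contraction n k m x _ hk hsn hgrid (eq_of_cornerDist_eq_zero hgrid hzero) hne)
    simpa using two_mul_delta_le s.zero_le
  · exact lintegral_cornerWeight_le_of_cornerDist_pos hb.le hb1 hq.le hq1
      (by rw [slotsLaw_towardsCorner, hq_eq]) hδ.le (two_mul_delta_le (cornerDist_le hgrid)) hpos
      hgrid hne

lemma exists_measure_not_spread_le_geometric (φ : Phy) (K : ℕ) (hs : 1 ≤ s) (hsn : s ^ 2 ≤ n) :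
    ∃ δ : ℝ, 0 < δ ∧ δ ≤ 1 ∧ ∀ (k : ℕ) (src : Fin k → Fin n) (τ : Fin k → ℕ) (m : Fin k)
      (d : ℕ), k ≤ K →
      runLaw n {ω | ¬ ∀ j, m ∈ holds φ (mobilePos s ω) src τ ω (τ m + d) j} ≤
        ENNReal.ofReal ((1 - δ) ^ d * (2 * (n : ℝ) ^ 2)) := by
  obtain ⟨b, q, δ, hb, hb1, hq, hq1, hδ, hδ1, contraction⟩ :=
    exists_lintegral_cornerWeight_le φ K hs hsn
  refine ⟨δ, hδ, hδ1, fun k src τ m d hk => ?_⟩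
  let G : Set (NetState n k) := {x | (∀ l, x.1 l ∈ grid s) ∧ (informed x.2 m).Nonempty}
  have staysIn_eq_univ : staysIn φ s src τ G (τ m) d = Set.univ :=
    Set.eq_univ_of_forall fun ω t ht => ⟨fun l => cell_mem_grid hs ω l t,
      ⟨_, src_mem_informed_netState (Finset.mem_Ico.1 ht).1 ω⟩⟩
  have factor_nonneg : 0 ≤ 1 - δ := sub_nonneg.2 hδ1
  refine (measure_not_spread_le (G := G) (w := fun x => ENNReal.ofReal (cornerWeight b q m x))
    factor_nonneg (fun t _ x hx => ?_) (fun x => ?_) (fun x => ?_) d).trans_eq ?_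
  · rw [← ENNReal.ofReal_mul factor_nonneg]
    exact contraction k src τ t m x hk hx.1 hx.2
  · exact ENNReal.ofReal_le_ofReal (oddsAgainst_le_cornerWeight hb hb1 hq hq1 m x)
  · rw [← ENNReal.ofReal_ofNat, ← ENNReal.ofReal_mul zero_le_two]
    exact ENNReal.ofReal_le_ofReal (cornerWeight_le hb hq m x)
  · rw [staysIn_eq_univ, Set.compl_univ, measure_empty, zero_add]

end Corner

/-! ### Choice of the constants -/

section Measure

variable {α β ι : Type*} [MeasurableSpace α] [MeasurableSpace β] {μ : Measure α} {ν : Measure β}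
  {ε : ℝ}

lemma le_measureReal_of_measure_compl_le [IsProbabilityMeasure μ] {S : Set α} (hε : 0 ≤ ε)
    (h : μ Sᶜ ≤ ENNReal.ofReal ε) : 1 - ε ≤ μ.real S := by
  have : μ.real Sᶜ ≤ ε := ENNReal.toReal_le_of_le_ofReal hε h
  have : 1 ≤ μ.real S + μ.real Sᶜ := by
    simpa using measureReal_union_le (μ := μ) S Sᶜ
  linarith

lemma measure_not_and_le {p q : α → Prop} (hε : 0 ≤ ε) (hp : μ {x | ¬ p x} ≤ ENNReal.ofReal ε)
    (hq : μ {x | ¬ q x} ≤ ENNReal.ofReal ε) :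
    μ {x | ¬ (p x ∧ q x)} ≤ ENNReal.ofReal (2 * ε) := by
  calc μ {x | ¬ (p x ∧ q x)} ≤ μ ({x | ¬ p x} ∪ {x | ¬ q x}) :=
        measure_mono fun _ hx => not_and_or.1 hx
    _ ≤ ENNReal.ofReal ε + ENNReal.ofReal ε := (measure_union_le _ _).trans (add_le_add hp hq)
    _ = ENNReal.ofReal (2 * ε) := by rw [two_mul, ENNReal.ofReal_add hε hε]

lemma measure_not_forall_le [Fintype ι] {p : ι → α → Prop}
    (h : ∀ i, μ {x | ¬ p i x} ≤ ENNReal.ofReal ε) :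
    μ {x | ¬ ∀ i, p i x} ≤ ENNReal.ofReal (Fintype.card ι * ε) := by
  calc μ {x | ¬ ∀ i, p i x} ≤ μ (⋃ i, {x | ¬ p i x}) :=
        measure_mono fun _ hx => Set.mem_iUnion.2 (not_forall.1 hx)
    _ ≤ ∑ i, μ {x | ¬ p i x} := measure_iUnion_fintype_le _ _
    _ ≤ ∑ _ : ι, ENNReal.ofReal ε := Finset.sum_le_sum fun i _ => h i
    _ = ENNReal.ofReal (Fintype.card ι * ε) := by
        rw [Finset.sum_const, Finset.card_univ, nsmul_eq_mul,
          ENNReal.ofReal_mul (Nat.cast_nonneg _), ENNReal.ofReal_natCast]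

lemma measure_not_le_ofReal_anti (f : α → ℝ≥0∞) {x y : ℝ} (hxy : x ≤ y) :
    μ {ω | ¬ f ω ≤ ENNReal.ofReal y} ≤ μ {ω | ¬ f ω ≤ ENNReal.ofReal x} :=
  measure_mono fun _ not_le le => not_le (le.trans (ENNReal.ofReal_le_ofReal hxy))

lemma measure_not_ofReal_le_mono (f : α → ℝ≥0∞) {x y : ℝ} (hxy : x ≤ y) :
    μ {ω | ¬ ENNReal.ofReal x ≤ f ω} ≤ μ {ω | ¬ ENNReal.ofReal y ≤ f ω} :=
  measure_mono fun _ not_le le => not_le ((ENNReal.ofReal_le_ofReal hxy).trans le)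

lemma measure_prod_not_mul_le [IsProbabilityMeasure μ] [IsProbabilityMeasure ν] {f : α → ℝ≥0∞}
    {g : β → ℝ≥0∞} {x y z : ℝ} (hx : 0 ≤ x) (hε : 0 ≤ ε) (hxyz : x * y = z)
    (hf : μ {ω | ¬ f ω ≤ ENNReal.ofReal y} ≤ ENNReal.ofReal ε)
    (hg : ν {ω | ¬ ENNReal.ofReal z ≤ g ω} ≤ ENNReal.ofReal ε) :
    (μ.prod ν) {ω | ¬ ENNReal.ofReal x * f ω.1 ≤ g ω.2} ≤ ENNReal.ofReal (2 * ε) := by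
  have mul_le : ∀ ω : α × β, f ω.1 ≤ ENNReal.ofReal y ∧ ENNReal.ofReal z ≤ g ω.2 →
      ENNReal.ofReal x * f ω.1 ≤ g ω.2 := fun ω ⟨hfω, hgω⟩ => by
    calc ENNReal.ofReal x * f ω.1 ≤ ENNReal.ofReal x * ENNReal.ofReal y := by gcongr
      _ = ENNReal.ofReal z := by rw [← hxyz, ENNReal.ofReal_mul hx]
      _ ≤ g ω.2 := hgω
  refine (measure_mono fun ω => mt (mul_le ω)).trans (measure_not_and_le hε ?_ ?_)
  · rw [← one_mul (ENNReal.ofReal ε), ← mul_one (1 : ℝ≥0∞), ← measure_univ (μ := ν)]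
    rw [show {ω : α × β | ¬ f ω.1 ≤ ENNReal.ofReal y} =
      {ω | ¬ f ω ≤ ENNReal.ofReal y} ×ˢ Set.univ by ext; simp, Measure.prod_prod]
    simpa using hf
  · rw [show {ω : α × β | ¬ ENNReal.ofReal z ≤ g ω.2} =
      Set.univ ×ˢ {ω | ¬ ENNReal.ofReal z ≤ g ω} by ext; simp, Measure.prod_prod]
    simpa using hg

end Measure

section Dense

variable {n s : ℕ}

lemma exp_neg_mul_log {x : ℝ} (hx : 0 < x) (j : ℕ) :
    Real.exp (-(j * Real.log x)) = 1 / x ^ j := by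
  rw [Real.exp_neg, Real.exp_nat_mul, Real.exp_log hx, one_div]

/-- The velocity `1 / s` is at least the connectivity threshold `√(32 log n / n)`, so that every
subsquare of the `s × s` grid contains at least `32 log n` users on average. -/
structure Dense (n s : ℕ) : Prop where
  one_le : 1 ≤ s
  one_le_log : 1 ≤ Real.log n
  log_mul_le : 32 * Real.log n * (s : ℝ) ^ 2 ≤ n

lemma dense_of_sqrt_lt (hn : 2 ≤ n) (hs : 1 ≤ s)
    (h : Real.sqrt (32 * Real.log n / n) < 1 / (s : ℝ)) : Dense n s := by
  have hn' : (2 : ℝ) ≤ n := by exact_mod_cast hn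
  have hs' : (1 : ℝ) ≤ (s : ℝ) ^ 2 := one_le_pow₀ (by exact_mod_cast hs)
  have log_ge : 0.69 ≤ Real.log n := by
    linarith [Real.log_two_gt_d9, Real.log_le_log two_pos hn']
  have log_mul_lt : 32 * Real.log n * (s : ℝ) ^ 2 < n := by
    have := (Real.sqrt_lt' (by positivity)).1 h
    rwa [div_pow, one_pow, div_lt_div_iff₀ (by linarith) (by positivity), one_mul] at this
  have three_le : (3 : ℝ) ≤ n := by nlinarith
  refine ⟨hs, ?_, log_mul_lt.le⟩
  rw [Real.le_log_iff_exp_le (by linarith)]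
  linarith [Real.exp_one_lt_d9]

namespace Dense

lemma one_le_cast (h : Dense n s) : (1 : ℝ) ≤ s := by exact_mod_cast h.one_le

lemma sq_le_cast (h : Dense n s) : (s : ℝ) ^ 2 ≤ n := by
  nlinarith [h.log_mul_le, h.one_le_log, sq_nonneg (s : ℝ)]

lemma sq_le (h : Dense n s) : s ^ 2 ≤ n := by exact_mod_cast h.sq_le_cast

lemma le_cast (h : Dense n s) : (s : ℝ) ≤ n :=
  (le_self_pow₀ h.one_le_cast two_ne_zero).trans h.sq_le_cast

lemma log_pos (h : Dense n s) : 0 < Real.log n := zero_lt_one.trans_le h.one_le_log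

lemma thirtyTwo_mul_log_le (h : Dense n s) : 32 * Real.log n ≤ n := by
  nlinarith [h.log_mul_le, h.one_le_log, one_le_pow₀ h.one_le_cast (n := 2)]

lemma two_le (h : Dense n s) : 2 ≤ n := by
  have : (2 : ℝ) ≤ n := by linarith [h.thirtyTwo_mul_log_le, h.one_le_log]
  exact_mod_cast this

lemma cast_pos (h : Dense n s) : (0 : ℝ) < n := by
  have := h.two_le
  positivity

lemma cube_le (h : Dense n s) : (s : ℝ) ^ 3 ≤ (n : ℝ) ^ 2 := by
  calc (s : ℝ) ^ 3 = (s : ℝ) ^ 2 * s := by ring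
    _ ≤ (n : ℝ) * n := mul_le_mul h.sq_le_cast h.le_cast s.cast_nonneg n.cast_nonneg
    _ = (n : ℝ) ^ 2 := by ring

lemma exp_le (h : Dense n s) {c : ℝ} (j : ℕ) (hc : (j : ℝ) ≤ 32 * c) :
    Real.exp (-(c * (n / (s : ℝ) ^ 2))) ≤ 1 / (n : ℝ) ^ j := by
  have := h.one_le_cast
  have := h.log_pos
  have c_nonneg : 0 ≤ c := by linarith [j.cast_nonneg (α := ℝ)]
  have occupancy : 32 * Real.log n ≤ n / (s : ℝ) ^ 2 := by
    rw [le_div_iff₀ (by positivity)]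
    exact h.log_mul_le
  rw [← exp_neg_mul_log h.cast_pos, Real.exp_le_exp, neg_le_neg_iff]
  calc j * Real.log n ≤ 32 * c * Real.log n := by gcongr
    _ = c * (32 * Real.log n) := by ring
    _ ≤ c * (n / (s : ℝ) ^ 2) := by gcongr

lemma sqrt_div_log_le (h : Dense n s) : Real.sqrt n / Real.log n ≤ n := by
  have one_le_n : (1 : ℝ) ≤ n := h.one_le_cast.trans h.le_cast
  calc Real.sqrt n / Real.log n ≤ Real.sqrt n := div_le_self (Real.sqrt_nonneg _) h.one_le_log
    _ ≤ n := Real.sqrt_le_iff.2 ⟨n.cast_nonneg, le_self_pow₀ one_le_n two_ne_zero⟩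

lemma exists_finest (h : Dense n s) :
    ∃ r : ℕ, Dense n r ∧ Real.sqrt n / Real.log n ≤ 12 * r := by
  have log_pos := h.log_pos
  set x := Real.sqrt (n / (32 * Real.log n))
  have x_sq : x ^ 2 = n / (32 * Real.log n) := Real.sq_sqrt (by positivity)
  have one_le_x : 1 ≤ x :=
    Real.one_le_sqrt.2 ((one_le_div (by positivity)).2 h.thirtyTwo_mul_log_le)
  have one_le_floor : 1 ≤ ⌊x⌋₊ := Nat.le_floor (by exact_mod_cast one_le_x)
  refine ⟨⌊x⌋₊, ⟨one_le_floor, h.one_le_log, ?_⟩, ?_⟩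
  · calc 32 * Real.log n * (⌊x⌋₊ : ℝ) ^ 2 ≤ 32 * Real.log n * x ^ 2 := by
          gcongr
          exact Nat.floor_le (Real.sqrt_nonneg _)
      _ = (n : ℝ) := by
          rw [x_sq]
          field_simp
  · have sqrt_le : Real.sqrt n / Real.log n ≤ 6 * x := by
      rw [div_le_iff₀ log_pos]
      refine Real.sqrt_le_iff.2 ⟨by positivity, ?_⟩
      calc (n : ℝ) ≤ 36 / 32 * (n * Real.log n) := by nlinarith [h.one_le_log, h.cast_pos]
        _ = (6 * x * Real.log n) ^ 2 := by
          rw [mul_pow, mul_pow, x_sq]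
          field_simp
          ring
    have one_le_floor' : (1 : ℝ) ≤ ⌊x⌋₊ := by exact_mod_cast one_le_floor
    linarith [Nat.lt_floor_add_one x]

end Dense

end Dense

section Tolerance

variable {n s k K : ℕ}

/-- The failure probability allowed for each of at most `K` messages; a union bound over the
messages and over two events per message then stays below `n⁻²`. -/
def tolerance (K n : ℕ) : ℝ := 1 / ((K + 1) * (n : ℝ) ^ 3)

lemma tolerance_nonneg (K n : ℕ) : 0 ≤ tolerance K n := by
  unfold tolerance
  positivity

lemma div_pow_six_le_tolerance {c : ℝ} (hn : 1 ≤ n) (hc : c * (K + 1) ≤ n) :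
    c / (n : ℝ) ^ 6 ≤ tolerance K n := by
  have hn0 : (1 : ℝ) ≤ n := by exact_mod_cast hn
  rw [tolerance, div_le_div_iff₀ (by positivity) (by positivity), one_mul]
  calc c * ((K + 1) * (n : ℝ) ^ 3) = c * (K + 1) * (n : ℝ) ^ 3 := by ring
    _ ≤ n * (n : ℝ) ^ 3 := by gcongr
    _ = (n : ℝ) ^ 4 := by ring
    _ ≤ (n : ℝ) ^ 6 := pow_le_pow_right₀ hn0 (by norm_num)

lemma mul_two_mul_tolerance_le (hk : k ≤ K) (hn : 2 ≤ n) :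
    k * (2 * tolerance K n) ≤ 1 / (n : ℝ) ^ 2 := by
  have hn0 : (2 : ℝ) ≤ n := by exact_mod_cast hn
  have hkK : (k : ℝ) ≤ K + 1 := by exact_mod_cast hk.trans K.le_succ
  calc (k : ℝ) * (2 * tolerance K n) ≤ (K + 1) * (n * tolerance K n) := by
        have := tolerance_nonneg K n
        gcongr
    _ = 1 / (n : ℝ) ^ 2 := by
        rw [tolerance]
        field_simp

lemma le_measureReal_forall_of_tolerance {α : Type*} {_ : MeasurableSpace α} {μ : Measure α}
    [IsProbabilityMeasure μ] {p : Fin k → α → Prop} (hk : k ≤ K) (hn : 2 ≤ n)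
    (h : ∀ m, μ {x | ¬ p m x} ≤ ENNReal.ofReal (2 * tolerance K n)) :
    1 - 1 / (n : ℝ) ^ 2 ≤ μ.real {x | ∀ m, p m x} := by
  refine le_measureReal_of_measure_compl_le (by positivity)
    ((measure_not_forall_le h).trans (ENNReal.ofReal_le_ofReal ?_))
  rw [Fintype.card_fin]
  exact mul_two_mul_tolerance_le hk hn

lemma Dense.cube_mul_exp_le_tolerance (h : Dense n s) (hK : K + 1 ≤ n) :
    (s : ℝ) ^ 3 * Real.exp (-(n / (s : ℝ) ^ 2 / 2)) ≤ tolerance K n := by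
  have := h.cast_pos
  have one_mul_le : (1 : ℝ) * (K + 1) ≤ n := by exact_mod_cast (one_mul (K + 1)).trans_le hK
  calc (s : ℝ) ^ 3 * Real.exp (-(n / (s : ℝ) ^ 2 / 2))
      = (s : ℝ) ^ 3 * Real.exp (-(1 / 2 * (n / (s : ℝ) ^ 2))) := by
        congr 3
        ring
    _ ≤ (n : ℝ) ^ 2 * (1 / (n : ℝ) ^ 8) := by
        gcongr
        exacts [h.cube_le, h.exp_le 8 (by norm_num)]
    _ = 1 / (n : ℝ) ^ 6 := by field_simp
    _ ≤ tolerance K n := div_pow_six_le_tolerance (by linarith [h.two_le]) one_mul_le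

end Tolerance

section SpreadingTime

variable {n s k K : ℕ} {src : Fin k → Fin n} {τ : Fin k → ℕ} {m : Fin k}

lemma measure_not_ofReal_le_spreadingTime_eq_zero (φ : Phy) (pos : Run n → ℕ → Fin n → Plane)
    (hn : 2 ≤ n) {x : ℝ} (hx : x ≤ 1) :
    runLaw n {ω | ¬ ENNReal.ofReal x ≤
      ((spreadingTime φ (pos ω) src τ ω m : ℕ∞) : ℝ≥0∞)} = 0 := by
  have ofReal_le (ω : Run n) :
      ENNReal.ofReal x ≤ ((spreadingTime φ (pos ω) src τ ω m : ℕ∞) : ℝ≥0∞) :=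
    le_spreadingTime fun d hd => hx.trans (by exact_mod_cast one_le_of_forall_mem_holds hn hd)
  simp [ofReal_le]

lemma exists_le_mobileTime (φ : Phy) (K : ℕ) :
    ∃ a : ℝ, 0 < a ∧ ∀ {n k s : ℕ} (src : Fin k → Fin n) (τ : Fin k → ℕ) (m : Fin k),
      Dense n s → runLaw n {ω | ¬ ENNReal.ofReal (a * s) ≤ mobileTime φ s src τ ω m} ≤
        ENNReal.ofReal (tolerance K n) := by
  refine ⟨1 / (K + 7), by positivity, fun {n k s} src τ m h => ?_⟩
  rw [one_div_mul_eq_div]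
  rcases le_or_gt (K + 1) n with hK | hK
  · refine ((measure_not_ofReal_le_mono _ ?_).trans
      (measure_mobileTime_lt_le φ h.two_le h.one_le src τ m)).trans
      (ENNReal.ofReal_le_ofReal (h.cube_mul_exp_le_tolerance hK))
    gcongr
    linarith [K.cast_nonneg (α := ℝ)]
  · refine (measure_not_ofReal_le_spreadingTime_eq_zero φ (mobilePos s) h.two_le ?_).trans_le
      zero_le
    have : (n : ℝ) < K + 1 := by exact_mod_cast hK
    rw [div_le_one (by positivity)]
    linarith [h.le_cast]

lemma exists_le_staticTime (φ : Phy) (K : ℕ) :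
    ∃ h : ℝ, 0 < h ∧ ∀ {n k s : ℕ} (src : Fin k → Fin n) (τ : Fin k → ℕ) (m : Fin k), Dense n s →
      runLaw n {ω | ¬ ENNReal.ofReal (h * (Real.sqrt n / Real.log n)) ≤ staticTime φ src τ ω m} ≤
        ENNReal.ofReal (tolerance K n) := by
  refine ⟨1 / (K + 84), by positivity, fun {n k s} src τ m h => ?_⟩
  rcases le_or_gt (K + 1) n with hK | hK
  · obtain ⟨r, hr, sqrt_le⟩ := h.exists_finest
    refine ((measure_not_ofReal_le_mono _ ?_).trans
      (measure_staticTime_lt_le φ h.two_le hr.one_le src τ m)).trans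
      (ENNReal.ofReal_le_ofReal (hr.cube_mul_exp_le_tolerance hK))
    calc 1 / ((K : ℝ) + 84) * (Real.sqrt n / Real.log n) ≤ 1 / 84 * (12 * r) := by
          gcongr
          linarith [K.cast_nonneg (α := ℝ)]
      _ = r / 7 := by ring
  · refine (measure_not_ofReal_le_spreadingTime_eq_zero φ staticPos h.two_le ?_).trans_le zero_le
    have : (n : ℝ) < K + 1 := by exact_mod_cast hK
    rw [one_div_mul_eq_div, div_le_one (by positivity)]
    linarith [h.sqrt_div_log_le]

lemma measure_not_mobileTime_le (φ : Phy) (s : ℕ) {d : ℕ} {x : ℝ} (hd : d ≤ x) :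
    runLaw n {ω | ¬ mobileTime φ s src τ ω m ≤ ENNReal.ofReal x} ≤
      runLaw n {ω | ¬ ∀ j, m ∈ holds φ (mobilePos s ω) src τ ω (τ m + d) j} :=
  measure_mono fun _ not_le spread =>
    not_le ((spreadingTime_le spread).trans (ENNReal.ofReal_le_ofReal hd))

lemma exists_measure_not_spread_le_tolerance (φ : Phy) (K : ℕ) (h : Dense n s) :
    ∃ D : ℕ, ∀ {k : ℕ} (src : Fin k → Fin n) (τ : Fin k → ℕ) (m : Fin k), k ≤ K →
      runLaw n {ω | ¬ ∀ j, m ∈ holds φ (mobilePos s ω) src τ ω (τ m + D) j} ≤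
        ENNReal.ofReal (tolerance K n) := by
  have := h.cast_pos
  obtain ⟨δ, hδ0, _, hδ⟩ := exists_measure_not_spread_le_geometric φ K h.one_le h.sq_le
  have target_pos : 0 < tolerance K n / (2 * (n : ℝ) ^ 2) := by
    unfold tolerance
    positivity
  obtain ⟨D, hD⟩ := exists_pow_lt_of_lt_one target_pos (show 1 - δ < 1 by linarith)
  exact ⟨D, fun src τ m hk => (hδ _ src τ m D hk).trans
    (ENNReal.ofReal_le_ofReal ((lt_div_iff₀ (by positivity)).1 hD).le)⟩

lemma exists_mobileTime_le_of_bounded (φ : Phy) (K N : ℕ) :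
    ∃ b : ℝ, 0 ≤ b ∧ ∀ {n k s : ℕ} (src : Fin k → Fin n) (τ : Fin k → ℕ) (m : Fin k),
      n < N → k ≤ K → Dense n s →
      runLaw n {ω | ¬ mobileTime φ s src τ ω m ≤ ENNReal.ofReal (b * (Real.log n * s))} ≤
        ENNReal.ofReal (tolerance K n) := by
  classical
  choose D hD using fun n s (h : Dense n s) => exists_measure_not_spread_le_tolerance φ K h
  let time (p : ℕ × ℕ) : ℕ := if h : Dense p.1 p.2 then D p.1 p.2 h else 0
  let M : ℕ := (Finset.range N ×ˢ Finset.range N).sup time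
  refine ⟨M, M.cast_nonneg, fun {n k s} src τ m hn hk h =>
    (measure_not_mobileTime_le φ s ?_).trans (hD n s h src τ m hk)⟩
  have hsn : s ≤ n := by exact_mod_cast h.le_cast
  have time_le : time (n, s) ≤ M :=
    Finset.le_sup (Finset.mk_mem_product (by simpa using hn) (by simpa using hsn.trans_lt hn))
  have D_le : D n s h ≤ M := by simpa only [time, dif_pos h] using time_le
  calc (D n s h : ℝ) ≤ M := by exact_mod_cast D_le
    _ ≤ M * (Real.log n * s) := le_mul_of_one_le_right M.cast_nonneg
        (one_le_mul_of_one_le_of_one_le h.one_le_log h.one_le_cast)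

lemma Dense.mul_sq_mul_exp_le (h : Dense n s) {c : ℝ} (hc : 0 ≤ c) :
    c * (Real.log n * s) * (s : ℝ) ^ 2 * (2 * Real.exp (-(0.4 * (n / (s : ℝ) ^ 2)))) ≤
      2 * c / (n : ℝ) ^ 6 := by
  have := h.cast_pos
  have := h.log_pos
  have log_le : Real.log n ≤ n := by linarith [h.thirtyTwo_mul_log_le]
  calc c * (Real.log n * s) * (s : ℝ) ^ 2 * (2 * Real.exp (-(0.4 * (n / (s : ℝ) ^ 2))))
      = c * (Real.log n * (s : ℝ) ^ 3) * (2 * Real.exp (-(0.4 * (n / (s : ℝ) ^ 2)))) := by ring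
    _ ≤ c * (n * (n : ℝ) ^ 2) * (2 * (1 / (n : ℝ) ^ 9)) := by
        gcongr
        exacts [h.cube_le, h.exp_le 9 (by norm_num)]
    _ = 2 * c / (n : ℝ) ^ 6 := by field_simp

lemma one_sub_pow_floor_le {p x : ℝ} (j : ℕ) (hp : 0 ≤ p) (hp1 : p ≤ 1) (hn : 0 < n)
    (hx : x * p = j * Real.log n) : (1 - p) ^ ⌊x⌋₊ ≤ 3 / (n : ℝ) ^ j := by
  have le_floor_mul : j * Real.log n - 1 ≤ ⌊x⌋₊ * p := by
    nlinarith [Nat.lt_floor_add_one x]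
  calc (1 - p) ^ ⌊x⌋₊ ≤ Real.exp (-p) ^ ⌊x⌋₊ :=
        pow_le_pow_left₀ (sub_nonneg.2 hp1) (Real.one_sub_le_exp_neg p) _
    _ = Real.exp (-(⌊x⌋₊ * p)) := by rw [← Real.exp_nat_mul, mul_neg]
    _ ≤ Real.exp (1 + -(j * Real.log n)) := Real.exp_le_exp.2 (by linarith)
    _ = Real.exp 1 * (1 / (n : ℝ) ^ j) := by
        rw [Real.exp_add, exp_neg_mul_log (by exact_mod_cast hn)]
    _ ≤ 3 * (1 / (n : ℝ) ^ j) := by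
        gcongr
        linarith [Real.exp_one_lt_d9]
    _ = 3 / (n : ℝ) ^ j := by ring

lemma exists_mobileTime_le_of_large (φ : Phy) (K : ℕ) :
    ∃ (b : ℝ) (N : ℕ), 0 < b ∧
      ∀ {n k s : ℕ} (src : Fin k → Fin n) (τ : Fin k → ℕ) (m : Fin k), N ≤ n → k ≤ K → Dense n s →
      runLaw n {ω | ¬ mobileTime φ s src τ ω m ≤ ENNReal.ofReal (b * (Real.log n * s))} ≤
        ENNReal.ofReal (tolerance K n) := by
  obtain ⟨κ, hκ, hκ1, not_spread_le⟩ := exists_measure_not_spread_le φ K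
  refine ⟨8 / κ, ⌈(2 * (8 / κ) + 6) * (K + 1)⌉₊, by positivity,
    fun {n k s} src τ m hN hk h => ?_⟩
  have := h.cast_pos
  have hs := h.one_le_cast
  have := h.log_pos
  set x := 8 / κ * (Real.log n * s) with hx
  have floor_le : (⌊x⌋₊ : ℝ) ≤ x := Nat.floor_le (by positivity)
  refine (measure_not_mobileTime_le φ s floor_le).trans
    ((not_spread_le n k s src τ m ⌊x⌋₊ hk h.one_le h.sq_le).trans (ENNReal.ofReal_le_ofReal ?_))
  have pow_le : (1 - κ / s) ^ ⌊x⌋₊ ≤ 3 / (n : ℝ) ^ 8 :=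
    one_sub_pow_floor_le 8 (by positivity) ((div_le_one (by positivity)).2 (hκ1.trans hs))
      (by linarith [h.two_le]) (by rw [hx]; field_simp; push_cast; ring)
  calc (⌊x⌋₊ : ℝ) * (s : ℝ) ^ 2 * (2 * Real.exp (-(0.4 * (n / (s : ℝ) ^ 2)))) +
        (1 - κ / s) ^ ⌊x⌋₊ * (2 * (n : ℝ) ^ 2)
      ≤ x * (s : ℝ) ^ 2 * (2 * Real.exp (-(0.4 * (n / (s : ℝ) ^ 2)))) +
        3 / (n : ℝ) ^ 8 * (2 * (n : ℝ) ^ 2) := by gcongr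
    _ ≤ 2 * (8 / κ) / (n : ℝ) ^ 6 + 6 / (n : ℝ) ^ 6 := by
        refine add_le_add (h.mul_sq_mul_exp_le (by positivity)) (le_of_eq ?_)
        field_simp
        norm_num
    _ = (2 * (8 / κ) + 6) / (n : ℝ) ^ 6 := (add_div _ _ _).symm
    _ ≤ tolerance K n := div_pow_six_le_tolerance (by linarith [h.two_le]) (Nat.ceil_le.1 hN)

lemma exists_mobileTime_le (φ : Phy) (K : ℕ) :
    ∃ b : ℝ, 0 < b ∧ ∀ {n k s : ℕ} (src : Fin k → Fin n) (τ : Fin k → ℕ) (m : Fin k),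
      k ≤ K → Dense n s →
      runLaw n {ω | ¬ mobileTime φ s src τ ω m ≤ ENNReal.ofReal (b * (Real.log n * s))} ≤
        ENNReal.ofReal (tolerance K n) := by
  obtain ⟨b, N, hb, large⟩ := exists_mobileTime_le_of_large φ K
  obtain ⟨b', hb', bounded⟩ := exists_mobileTime_le_of_bounded φ K N
  refine ⟨b + b', by positivity, fun {n k s} src τ m hk h => ?_⟩
  have : 0 ≤ Real.log n * s :=
    mul_nonneg h.log_pos.le s.cast_nonneg
  rcases le_or_gt N n with hN | hN
  · exact (measure_not_le_ofReal_anti _ (by gcongr; linarith)).trans (large src τ m hN hk h)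
  · exact (measure_not_le_ofReal_anti _ (by gcongr; linarith)).trans (bounded src τ m hN hk h)

end SpreadingTime

end Gossip

end

theorem theorem1 (φ : Gossip.Phy) (K : ℕ) :
    ∃ a b g h : ℝ, 0 < a ∧ 0 < b ∧ 0 < g ∧ 0 < h ∧
      ∀ (n k s : ℕ) (v : ℝ), 1 ≤ k → k ≤ K → 1 ≤ s → v = 1 / (s : ℝ) →
        Real.sqrt (32 * Real.log n / n) < v →
        ∀ (src : Fin k → Fin n) (τ : Fin k → ℕ),
          -- spreading time in the mobile network
          1 - 1 / (n : ℝ) ^ 2 ≤ (Gossip.runLaw n).real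
            {ω | ∀ m, ENNReal.ofReal (a / v) ≤ Gossip.mobileTime φ s src τ ω m ∧
              Gossip.mobileTime φ s src τ ω m ≤ ENNReal.ofReal (b * (Real.log n / v))} ∧
          -- spreading time in the static network
          1 - 1 / (n : ℝ) ^ 2 ≤ (Gossip.runLaw n).real
            {ω | ∀ m, ENNReal.ofReal (h * (Real.sqrt n / Real.log n)) ≤
              Gossip.staticTime φ src τ ω m} ∧
          -- gain of an independent mobile network over a static one
          1 - 1 / (n : ℝ) ^ 2 ≤ ((Gossip.runLaw n).prod (Gossip.runLaw n)).real
            {ω | ∀ m, ENNReal.ofReal (g * (v * Real.sqrt n / (Real.log n) ^ 2)) *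
              Gossip.mobileTime φ s src τ ω.1 m ≤ Gossip.staticTime φ src τ ω.2 m} := by
  obtain ⟨a, ha, mobile_ge⟩ := Gossip.exists_le_mobileTime φ K
  obtain ⟨b, hb, mobile_le⟩ := Gossip.exists_mobileTime_le φ K
  obtain ⟨h, hh, static_ge⟩ := Gossip.exists_le_staticTime φ K
  refine ⟨a, b, h / b, h, ha, hb, by positivity, hh, ?_⟩
  rintro n k s v hk hkK hs rfl hv src τ
  obtain rfl | hn : n = 1 ∨ 2 ≤ n := by
    have := (src ⟨0, hk⟩).pos
    omega
  · norm_num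
  have dense := Gossip.dense_of_sqrt_lt hn hs hv
  have tol_nonneg := Gossip.tolerance_nonneg K n
  have := dense.log_pos
  have := dense.one_le_cast
  rw [div_div_eq_mul_div, div_div_eq_mul_div, div_one, div_one]
  refine ⟨Gossip.le_measureReal_forall_of_tolerance hkK hn fun m => ?mobile,
    Gossip.le_measureReal_forall_of_tolerance hkK hn fun m => ?static,
    Gossip.le_measureReal_forall_of_tolerance hkK hn fun m => ?gain⟩
  case mobile =>
    exact Gossip.measure_not_and_le tol_nonneg (mobile_ge src τ m dense)
      (mobile_le src τ m hkK dense)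
  case static =>
    exact (static_ge src τ m dense).trans (ENNReal.ofReal_le_ofReal (by linarith))
  case gain =>
    exact Gossip.measure_prod_not_mul_le (by positivity) tol_nonneg (by field_simp)
      (mobile_le src τ m hkK dense) (static_ge src τ m dense)
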